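/- **Conventions.** A point-line geometry consists of points, lines and an incidence relation. It is a *partial linear space* if every line has at least two points and two distinct points are on at most one common line. Distances are measured in the collinearity graph, in which two distinct points are adjacent (*collinear*) when they are on a common line. A *near $2d$-gon* is a partial linear space with connected nonempty collinearity graph of diameter $d$ such that for every point $x$ and line $L$ there is a unique point on $L$ nearest to $x$; it is a near octagon if $d=4$ and a near hexagon if $d=3$. A geometry has *order* $(s,t)$ if every line has exactly $s+1$ points and every point is on exactly $t+1$ lines. A *line spread* is a set of lines such that every point is on exactly one of them. A *subspace* is a set of points containing every line that meets it in at least two points; it is *convex* if it contains all points of all shortest paths between its points. A *quad* is a convex subspace $Q$ such that the points of $Q$, with the lines contained in $Q$, form a non-degenerate generalized quadrangle (a nonempty partial linear space with at least two lines on every point, in which for every line $L$ and point $x\notin L$ exactly one point of $L$ is collinear with $x$). A *generalized hexagon* is a near hexagon with at least two lines on every point in which two points at distance $2$ always have a unique common neighbour. An involution of a finite group is *central* if it centralizes some Sylow $2$-subgroup. Let $G_2=\mathrm{L}_3(4){:}2^2$, that is, any group isomorphic to the group of all collineations and correlations of $\mathrm{PG}(2,4)$ whose matrix has determinant $1$.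 (A collineation with $3\times 3$ matrix $A$ over $\mathbb{F}_4$ and automorphism $\tau$ of $\mathbb{F}_4$ maps the point $x$ to the point $Ax^\tau$ and the line $y$ to the line $(A^T)^{-1}y^\tau$; a correlation maps the point $x$ to the line $Ax^\tau$ and the line $y$ to the point $(A^T)^{-1}y^\tau$. Here the line $y$ consists of the points $x$ with $x_1y_1+x_2y_2+x_3y_3=0$. The matrix is determined up to a nonzero factor, which does not affect the determinant.) Let $\mathrm{H}(4,1)$ be the generalized hexagon whose points are the flags of $\mathrm{PG}(2,4)$ and whose lines are the points and lines of $\mathrm{PG}(2,4)$, with reverse containment as incidence. **Theorem 1.2.** The group $G_2$ has exactly $315$ central involutions, and under each isomorphism with the above group of collineations and correlations they correspond exactly to the nontrivial elations of $\mathrm{PG}(2,4)$. (a) Let $\mathbb{O}_2$ be the point-line geometry whose points are the central involutions of $G_2$ and whose lines are all sets $\{x,y,xy\}$, where $x$ and $y$ are two distinct commuting central involutions with $[G_2:N_{G_2}(\langle x,y\rangle)]\in\{105,420\}$, with incidence being containment. Then $\mathbb{O}_2$ is a near octagon of order $(2,4)$. (b) Let $S_2$ be the set of all lines $\{x,y,xy\}$,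 where $x$ and $y$ are two distinct commuting central involutions with $[G_2:N_{G_2}(\langle x,y\rangle)]=105$. Then $S_2$ is a line spread of $\mathbb{O}_2$. For every quad $Q$ of $\mathbb{O}_2$, the lines of $S_2$ contained in $Q$ form a line spread of $Q$. The point-line geometry with point set $S_2$, with the quads of $\mathbb{O}_2$ as lines and with containment as incidence, is a generalized hexagon of order $(4,1)$ isomorphic to $\mathrm{H}(4,1)$. -/

import Mathlib

open scoped LinearAlgebra.Projectivization

/-- A point-line geometry: a type `P` of points, a type `L` of lines and an incidence relation. -/
structure PointLineGeometry (P L : Type*) where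
  /-- `Inc x l` means that the point `x` is incident with the line `l`. -/
  Inc : P → L → Prop

namespace PointLineGeometry

section

variable {P L P' L' : Type*}

/-- The collinearity graph: two distinct points are adjacent if some line is incident with both. -/
def collinearityGraph (S : PointLineGeometry P L) : SimpleGraph P where
  Adj x y := x ≠ y ∧ ∃ l, S.Inc x l ∧ S.Inc y l
  symm := ⟨fun _ _ h => ⟨h.1.symm, h.2.imp fun _ hl => ⟨hl.2, hl.1⟩⟩⟩
  loopless := ⟨fun _ h => h.1 rfl⟩

/-- A partial linear space: every line is incident with at least two points, and two distinct
points are incident with at most one common line. -/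
def IsPartialLinearSpace (S : PointLineGeometry P L) : Prop :=
  (∀ l, ∃ x y, x ≠ y ∧ S.Inc x l ∧ S.Inc y l) ∧
  (∀ x y, x ≠ y → ∀ l m, S.Inc x l → S.Inc y l → S.Inc x m → S.Inc y m → l = m)

/-- `y` is a point on the line `l` nearest to `x`, in the collinearity graph. -/
def IsNearest (S : PointLineGeometry P L) (x : P) (l : L) (y : P) : Prop :=
  S.Inc y l ∧ ∀ z, S.Inc z l → S.collinearityGraph.dist x y ≤ S.collinearityGraph.dist x z

/-- A near `2d`-gon: a partial linear space whose collinearity graph is connected (in particular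
nonempty) of diameter `d`, such that for every point `x` and line `l` there is a unique point on
`l` nearest to `x`. A near hexagon is the case `d = 3`, a near octagon is the case `d = 4`. -/
def IsNearPolygon (S : PointLineGeometry P L) (d : ℕ) : Prop :=
  S.IsPartialLinearSpace ∧ S.collinearityGraph.Connected ∧ S.collinearityGraph.ediam = d ∧
  ∀ x l, ∃! y, S.IsNearest x l y

/-- Order `(s, t)`: every line has exactly `s + 1` points, every point is on exactly `t + 1`
lines. -/
def HasOrder (S : PointLineGeometry P L) (s t : ℕ) : Prop :=
  (∀ l, {x | S.Inc x l}.encard = s + 1) ∧ (∀ x, {l | S.Inc x l}.encard = t + 1)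

/-- A line spread: every point is on exactly one line of `T`. -/
def IsLineSpread (S : PointLineGeometry P L) (T : Set L) : Prop :=
  ∀ x, ∃! l, l ∈ T ∧ S.Inc x l

/-- A subspace: a set of points that contains all points of a line as soon as it contains two
distinct points of it. -/
def IsSubspace (S : PointLineGeometry P L) (X : Set P) : Prop :=
  ∀ x ∈ X, ∀ y ∈ X, x ≠ y → ∀ l, S.Inc x l → S.Inc y l → ∀ z, S.Inc z l → z ∈ X

/-- A convex subspace: a subspace that contains every point on every shortest path between any
two of its points. -/
def IsConvexSubspace (S : PointLineGeometry P L) (X : Set P) : Prop :=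
  S.IsSubspace X ∧ ∀ x ∈ X, ∀ y ∈ X, ∀ w : S.collinearityGraph.Walk x y,
    w.length = S.collinearityGraph.dist x y → ∀ z ∈ w.support, z ∈ X

/-- The line `l` is completely contained in the set `X` of points. -/
def LineIn (S : PointLineGeometry P L) (X : Set P) (l : L) : Prop :=
  ∀ x, S.Inc x l → x ∈ X

/-- The geometry induced on a set `X` of points: the points of `X` and the lines that are
completely contained in `X`. -/
def induced (S : PointLineGeometry P L) (X : Set P) :
    PointLineGeometry {x // x ∈ X} {l // S.LineIn X l} where
  Inc x l := S.Inc x.1 l.1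

/-- A non-degenerate generalized quadrangle: a nonempty partial linear space in which every point
is on at least two lines, such that for every point `x` and every line `l` not through `x` there
is exactly one point on `l` collinear with `x`. -/
def IsGeneralizedQuadrangle (S : PointLineGeometry P L) : Prop :=
  Nonempty P ∧ S.IsPartialLinearSpace ∧
  (∀ x, ∃ l m, l ≠ m ∧ S.Inc x l ∧ S.Inc x m) ∧
  ∀ x l, ¬ S.Inc x l → ∃! y, S.Inc y l ∧ S.collinearityGraph.Adj x y

/-- A quad: a convex subspace whose induced geometry is a non-degenerate generalized
quadrangle. -/
def IsQuad (S : PointLineGeometry P L) (Q : Set P) : Prop :=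
  S.IsConvexSubspace Q ∧ (S.induced Q).IsGeneralizedQuadrangle

/-- The geometry whose points are the lines in `T`, whose lines are the quads, and whose incidence
is containment of a line in a quad. -/
def lineQuadGeometry (S : PointLineGeometry P L) (T : Set L) :
    PointLineGeometry {l // l ∈ T} {Q // S.IsQuad Q} where
  Inc l Q := S.LineIn Q.1 l.1

/-- A generalized hexagon: a near hexagon in which every point is on at least two lines and any
two points at distance `2` have a unique common neighbour. -/
def IsGeneralizedHexagon (S : PointLineGeometry P L) : Prop :=
  S.IsNearPolygon 3 ∧ (∀ x, ∃ l m, l ≠ m ∧ S.Inc x l ∧ S.Inc x m) ∧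
  ∀ x y, S.collinearityGraph.dist x y = 2 →
    ∃! z, S.collinearityGraph.Adj x z ∧ S.collinearityGraph.Adj z y

/-- Two geometries are isomorphic: there are bijections between the points and between the lines
that preserve incidence in both directions. -/
def Isomorphic (S : PointLineGeometry P L) (S' : PointLineGeometry P' L') : Prop :=
  ∃ (f : P ≃ P') (g : L ≃ L'), ∀ x l, S.Inc x l ↔ S'.Inc (f x) (g l)

end

end PointLineGeometry

namespace PlaneGroup

section

variable {K : Type*} [Field K]

/-- The points of the projective plane `PG(2, K)`, in homogeneous coordinates. By means of the
dual basis, the lines are represented by homogeneous coordinates as well: the point `x` is on the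
line `y` if `x₁ y₁ + x₂ y₂ + x₃ y₃ = 0`, that is, if `x.orthogonal y`. -/
abbrev PG2 (K : Type*) [Field K] := ℙ K (Fin 3 → K)

/-- The points and the lines (in this order) of `PG(2, K)`. -/
abbrev PG2Elements (K : Type*) [Field K] := PG2 K ⊕ PG2 K

/-- The map `x ↦ A x^τ` on coordinate vectors. -/
def semilin (A : Matrix.SpecialLinearGroup (Fin 3) K) (τ : K ≃+* K) (x : Fin 3 → K) : Fin 3 → K :=
  A.1.mulVec fun i => τ (x i)

theorem semilin_mul (A B : Matrix.SpecialLinearGroup (Fin 3) K) (τ σ : K ≃+* K)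
    (x : Fin 3 → K) : semilin A τ (semilin B σ x) =
      semilin (A * Matrix.SpecialLinearGroup.map (τ : K →+* K) B) (σ.trans τ) x := by
  ext i
  simp [semilin, Matrix.mulVec, dotProduct, Matrix.mul_apply, Fin.sum_univ_three]
  ring

theorem semilin_one (x : Fin 3 → K) : semilin 1 (RingEquiv.refl K) x = x := by
  simp [semilin]

theorem semilin_ne_zero (A : Matrix.SpecialLinearGroup (Fin 3) K) (τ : K ≃+* K)
    {x : Fin 3 → K} (hx : x ≠ 0) : semilin A τ x ≠ 0 := by
  intro h
  apply hx
  have h2 : (A⁻¹ * A).1.mulVec (fun i => τ (x i)) = 0 := by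
    rw [Matrix.SpecialLinearGroup.coe_mul, ← Matrix.mulVec_mulVec]
    rw [semilin] at h
    rw [h, Matrix.mulVec_zero]
  ext i
  have h3 := congrFun h2 i
  simpa using h3

/-- The map `⟨x⟩ ↦ ⟨A x^τ⟩` on homogeneous coordinates. -/
def projMap (A : Matrix.SpecialLinearGroup (Fin 3) K) (τ : K ≃+* K) : PG2 K → PG2 K :=
  Projectivization.lift (fun x => Projectivization.mk K (semilin A τ x.1)
      (semilin_ne_zero A τ x.2)) (by
    rintro ⟨a, ha⟩ ⟨b, hb⟩ t h
    simp only at h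
    rw [Projectivization.mk_eq_mk_iff']
    refine ⟨τ t, ?_⟩
    ext i
    simp [semilin, Matrix.mulVec, dotProduct, Fin.sum_univ_three, h]
    ring)

theorem projMap_mk (A : Matrix.SpecialLinearGroup (Fin 3) K) (τ : K ≃+* K)
    (x : Fin 3 → K) (hx : x ≠ 0) : projMap A τ (Projectivization.mk K x hx) =
      Projectivization.mk K (semilin A τ x) (semilin_ne_zero A τ hx) := rfl

theorem projMap_mul (A B : Matrix.SpecialLinearGroup (Fin 3) K) (τ σ : K ≃+* K) (p : PG2 K) :
    projMap A τ (projMap B σ p) =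
      projMap (A * Matrix.SpecialLinearGroup.map (τ : K →+* K) B) (σ.trans τ) p := by
  induction p using Projectivization.ind with
  | h x hx => simp only [projMap_mk, semilin_mul]

theorem projMap_one (p : PG2 K) : projMap 1 (RingEquiv.refl K) p = p := by
  induction p using Projectivization.ind with
  | h x hx => simp only [projMap_mk, semilin_one]

theorem map_symm_map (τ : K ≃+* K) (A : Matrix.SpecialLinearGroup (Fin 3) K) :
    Matrix.SpecialLinearGroup.map (τ : K →+* K)
      (Matrix.SpecialLinearGroup.map (τ.symm : K →+* K) A) = A := by
  ext i j
  simp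

/-- The permutation `⟨x⟩ ↦ ⟨A x^τ⟩` of homogeneous coordinates. -/
def projPerm (A : Matrix.SpecialLinearGroup (Fin 3) K) (τ : K ≃+* K) : Equiv.Perm (PG2 K) where
  toFun := projMap A τ
  invFun := projMap (Matrix.SpecialLinearGroup.map (τ.symm : K →+* K) A⁻¹) τ.symm
  left_inv p := by
    rw [projMap_mul, ← map_mul, inv_mul_cancel, map_one, RingEquiv.self_trans_symm, projMap_one]
  right_inv p := by
    rw [projMap_mul, map_symm_map, mul_inv_cancel, RingEquiv.symm_trans_self, projMap_one]

theorem projPerm_mul (A B : Matrix.SpecialLinearGroup (Fin 3) K) (τ σ : K ≃+* K) (p : PG2 K) :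
    projPerm A τ (projPerm B σ p) =
      projPerm (A * Matrix.SpecialLinearGroup.map (τ : K →+* K) B) (σ.trans τ) p :=
  projMap_mul A B τ σ p

theorem projPerm_one (p : PG2 K) : projPerm 1 (RingEquiv.refl K) p = p := projMap_one p

/-- The contragredient matrix `(Aᵀ)⁻¹`. -/
def contra (A : Matrix.SpecialLinearGroup (Fin 3) K) : Matrix.SpecialLinearGroup (Fin 3) K :=
  (A⁻¹).transpose

theorem contra_mul (A B : Matrix.SpecialLinearGroup (Fin 3) K) :
    contra (A * B) = contra A * contra B := by
  apply Subtype.ext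
  simp [contra, mul_inv_rev, Matrix.SpecialLinearGroup.coe_mul, Matrix.transpose_mul,
    -Matrix.SpecialLinearGroup.coe_inv]

theorem contra_one : contra (1 : Matrix.SpecialLinearGroup (Fin 3) K) = 1 := by
  apply Subtype.ext
  simp [contra]

theorem contra_inv (A : Matrix.SpecialLinearGroup (Fin 3) K) : contra A⁻¹ = (contra A)⁻¹ := by
  rw [eq_inv_iff_mul_eq_one, ← contra_mul, inv_mul_cancel, contra_one]

theorem contra_contra (A : Matrix.SpecialLinearGroup (Fin 3) K) : contra (contra A) = A := by
  have h : (contra A)⁻¹ = A.transpose := by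
    rw [← contra_inv, contra, inv_inv]
  rw [contra, h]
  rfl

theorem map_contra (τ : K ≃+* K) (A : Matrix.SpecialLinearGroup (Fin 3) K) :
    Matrix.SpecialLinearGroup.map (τ : K →+* K) (contra A) =
      contra (Matrix.SpecialLinearGroup.map (τ : K →+* K) A) := by
  rw [contra, contra, ← map_inv]
  rfl

/-- The collineation with matrix `A` and field automorphism `τ`: it maps the point `x` to the
point `A x^τ` and the line `y` to the line `(Aᵀ)⁻¹ y^τ`. -/
def collineation (A : Matrix.SpecialLinearGroup (Fin 3) K) (τ : K ≃+* K) :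
    Equiv.Perm (PG2Elements K) :=
  Equiv.sumCongr (projPerm A τ) (projPerm (contra A) τ)

/-- The correlation with matrix `A` and field automorphism `τ`: it maps the point `x` to the
line `A x^τ` and the line `y` to the point `(Aᵀ)⁻¹ y^τ`. -/
def correlation (A : Matrix.SpecialLinearGroup (Fin 3) K) (τ : K ≃+* K) :
    Equiv.Perm (PG2Elements K) :=
  (Equiv.sumCongr (projPerm A τ) (projPerm (contra A) τ)).trans (Equiv.sumComm _ _)

theorem collineation_mul_collineation (A B : Matrix.SpecialLinearGroup (Fin 3) K)
    (τ σ : K ≃+* K) : collineation A τ * collineation B σ =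
      collineation (A * Matrix.SpecialLinearGroup.map (τ : K →+* K) B) (σ.trans τ) := by
  ext (p | p) <;> simp [collineation, projPerm_mul, contra_mul, map_contra]

theorem correlation_mul_collineation (A B : Matrix.SpecialLinearGroup (Fin 3) K)
    (τ σ : K ≃+* K) : correlation A τ * collineation B σ =
      correlation (A * Matrix.SpecialLinearGroup.map (τ : K →+* K) B) (σ.trans τ) := by
  ext (p | p) <;> simp [collineation, correlation, projPerm_mul, contra_mul, map_contra]

theorem collineation_mul_correlation (A B : Matrix.SpecialLinearGroup (Fin 3) K)
    (τ σ : K ≃+* K) : collineation A τ * correlation B σ =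
      correlation (contra A * Matrix.SpecialLinearGroup.map (τ : K →+* K) B) (σ.trans τ) := by
  ext (p | p) <;>
    simp [collineation, correlation, projPerm_mul, contra_mul, map_contra, contra_contra]

theorem correlation_mul_correlation (A B : Matrix.SpecialLinearGroup (Fin 3) K)
    (τ σ : K ≃+* K) : correlation A τ * correlation B σ =
      collineation (contra A * Matrix.SpecialLinearGroup.map (τ : K →+* K) B) (σ.trans τ) := by
  ext (p | p) <;>
    simp [collineation, correlation, projPerm_mul, contra_mul, map_contra, contra_contra]

theorem collineation_one : collineation 1 (RingEquiv.refl K) = 1 := by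
  ext (p | p) <;> simp [collineation, projPerm_one, contra_one]

/-- The group of all collineations and correlations of `PG(2, K)` whose matrix can be chosen of
determinant `1`, as a group of permutations of the points and lines. For `|K| = 4` all matrices
that describe the same element have the same determinant, and this is the group
`L₃(4):2²`. -/
def collineationsAndCorrelations (K : Type*) [Field K] : Subgroup (Equiv.Perm (PG2Elements K)) where
  carrier := {g | ∃ A τ, g = collineation A τ ∨ g = correlation A τ}
  one_mem' := ⟨1, RingEquiv.refl K, Or.inl collineation_one.symm⟩
  mul_mem' := by
    rintro _ _ ⟨A, τ, rfl | rfl⟩ ⟨B, σ, rfl | rfl⟩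
    · exact ⟨_, _, Or.inl (collineation_mul_collineation A B τ σ)⟩
    · exact ⟨_, _, Or.inr (collineation_mul_correlation A B τ σ)⟩
    · exact ⟨_, _, Or.inr (correlation_mul_collineation A B τ σ)⟩
    · exact ⟨_, _, Or.inl (correlation_mul_correlation A B τ σ)⟩
  inv_mem' := by
    rintro _ ⟨A, τ, rfl | rfl⟩
    · refine ⟨Matrix.SpecialLinearGroup.map (τ.symm : K →+* K) A⁻¹, τ.symm, Or.inl ?_⟩
      rw [inv_eq_iff_mul_eq_one, collineation_mul_collineation, map_symm_map, mul_inv_cancel,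
        RingEquiv.symm_trans_self, collineation_one]
    · refine ⟨Matrix.SpecialLinearGroup.map (τ.symm : K →+* K) (contra A)⁻¹, τ.symm, Or.inr ?_⟩
      rw [inv_eq_iff_mul_eq_one, correlation_mul_correlation, map_symm_map, mul_inv_cancel,
        RingEquiv.symm_trans_self, collineation_one]

/-- A nontrivial elation of `PG(2, K)`: a nonidentity collineation (a permutation of the points
and of the lines that preserves incidence) for which there are a line `l` (the axis) all of whose
points are fixed and a point `p` on `l` (the center) all of whose lines are fixed. -/
def IsNontrivialElation (g : Equiv.Perm (PG2Elements K)) : Prop :=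
  g ≠ 1 ∧
  (∃ a b : Equiv.Perm (PG2 K), g = Equiv.sumCongr a b ∧
    ∀ x y, x.orthogonal y ↔ (a x).orthogonal (b y)) ∧
  ∃ p l : PG2 K, p.orthogonal l ∧
    (∀ x : PG2 K, x.orthogonal l → g (Sum.inl x) = Sum.inl x) ∧
    (∀ m : PG2 K, p.orthogonal m → g (Sum.inr m) = Sum.inr m)

/-- The flags (incident point-line pairs) of `PG(2, K)`. -/
abbrev Flag (K : Type*) [Field K] := {f : PG2 K × PG2 K // f.1.orthogonal f.2}

/-- The geometry whose points are the flags of `PG(2, K)` and whose lines are the points and the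
lines of `PG(2, K)`, with reverse containment as incidence. For `|K| = q` this is the
generalized hexagon `H(q, 1)` of order `(q, 1)`. -/
def flagGeometry (K : Type*) [Field K] : PointLineGeometry (Flag K) (PG2Elements K) where
  Inc f e := e = Sum.inl f.1.1 ∨ e = Sum.inr f.1.2

end

end PlaneGroup

/-- The field with four elements. -/
abbrev F4 := GaloisField 2 2

/-- The group `L₃(4):2²`. -/
noncomputable abbrev L34Ext : Subgroup (Equiv.Perm (PlaneGroup.PG2Elements F4)) :=
  PlaneGroup.collineationsAndCorrelations F4

/-- The generalized hexagon `H(4, 1)`. -/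
noncomputable abbrev H41 : PointLineGeometry (PlaneGroup.Flag F4) (PlaneGroup.PG2Elements F4) :=
  PlaneGroup.flagGeometry F4

section

variable {G : Type*} [Group G]

/-- A central involution: an element of order `2` that centralizes some Sylow `2`-subgroup. -/
def IsCentralInvolution (x : G) : Prop :=
  orderOf x = 2 ∧ ∃ H : Sylow 2 G, x ∈ Subgroup.centralizer (H : Set G)

/-- The sets `{x, y, xy}` where `x` and `y` are two distinct commuting central involutions of `G`
such that the index in `G` of the normalizer of `⟨x, y⟩` belongs to `N`. -/
def involutionTriples (G : Type*) [Group G] (N : Set ℕ) : Set (Set G) :=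
  {l | ∃ x y : G, IsCentralInvolution x ∧ IsCentralInvolution y ∧ x ≠ y ∧ Commute x y ∧
    (Subgroup.normalizer (Subgroup.closure {x, y} : Set G)).index ∈ N ∧ l = {x, y, x * y}}

/-- The geometry whose points are the central involutions of `G` and whose lines are the triples
`{x, y, xy}` with `[G : N(⟨x, y⟩)] ∈ {105, 420}`; incidence is containment. -/
def involutionGeometry (G : Type*) [Group G] :
    PointLineGeometry {x : G // IsCentralInvolution x} {l // l ∈ involutionTriples G {105, 420}}
    where
  Inc x l := x.1 ∈ l.1

/-- The lines `{x, y, xy}` of the geometry with `[G : N(⟨x, y⟩)] = 105`. -/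
def involutionSpread (G : Type*) [Group G] : Set {l // l ∈ involutionTriples G {105, 420}} :=
  {l | l.1 ∈ involutionTriples G {105}}

end

/-! In characteristic 2 a nontrivial elation is an involution `1 + p φᵀ`, where the centre `p` lies
on the axis `φ`, and the pair `(p, φ)` is determined up to replacing it by `(c p, c⁻¹ φ)`. A
collineation acts on such pairs by a semilinear map and its contragredient; a correlation also
exchanges `p` and `φ`. Over F₄ there are 21 · 5 · 3 = 315 elations, and they form one conjugacy
class. An element that commutes with the unitriangular 2-group is trivial or an elation, so central
involutions are elations. Conversely 315 is odd, so a Sylow 2-subgroup fixes some elation under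
conjugation, and transitivity gives all of them.

Distinct elations commute exactly when they share the centre or the axis. If only the centre `p` is
shared, then `φ × ψ = c p` with `c ≠ 0`; since nonzero scalars of F₄ have cube 1, this `c` does not
depend on the chosen vectors. Matrices of determinant 1 preserve `c` up to field automorphisms, and
the same holds dually for a common axis. Hence the ordered commuting pairs form three orbits: equal
flags, `c = 1`, and `c ≠ 0, 1`, in which an elation has 2, 8 and 16 partners. The normalizer of `⟨x,
y⟩` permutes the three involutions in all six ways, so its index is 315 n / 6, that is 105, 420 or
840 (`index_normalizer_mul_six`). The index conditions therefore select the pairs with equal flags,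
which give the spread, and the pairs with `c = 1`.

For the near octagon, a function on the points that behaves like a distance on every line and
decreases towards one point is the distance to that point (`IsLevel.dist_eq`). An explicit such
function for one base elation is verified on all lines by computation over a concrete F₄.
Conjugation carries every elation to the base (`exists_coordinates_base`), so nothing else has to be
computed.

The elations with a given centre, or with a given axis, form a convex subspace of diameter at most
2, which is a quad. A quad contains a line outside the spread; on it only the centre or only the
axis is constant, and `IsFlagMarking.not_mem_quad` forbids lines of both kinds through one point of
a quad. So there are no other quads (`IsFlagMarking.quad_eq`). Spread lines thus correspond to flags
and quads to points and lines of the plane, and the hexagon axioms become elementary facts on flags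
of a projective plane (`isHexagon_flagGeometry`). -/

namespace PlaneGroup

open Matrix

section

variable {K : Type*} [Field K]

/-! ### Elations as matrices `1 + p φᵀ`, and their conjugates -/

theorem sl_ext {A B : SpecialLinearGroup (Fin 3) K} (h : A.1 = B.1) : A = B := Subtype.ext h

theorem sl_mul (A B : SpecialLinearGroup (Fin 3) K) : (A * B).1 = A.1 * B.1 := rfl

theorem sl_one : (1 : SpecialLinearGroup (Fin 3) K).1 = 1 := rfl

theorem sl_inv_mul (A : SpecialLinearGroup (Fin 3) K) : A⁻¹.1 * A.1 = 1 := by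
  rw [← sl_mul, inv_mul_cancel, sl_one]

open Classical in
/-- The matrix `1 + p φᵀ` (if `φ` vanishes at `p`). -/
noncomputable def elationMatrix (p φ : Fin 3 → K) : SpecialLinearGroup (Fin 3) K :=
  if h : p ⬝ᵥ φ = 0 then ⟨1 + vecMulVec p φ, by
    -- The determinant of `1 + p φᵀ` is `1 + p · φ`.
    simp [dotProduct, Fin.sum_univ_three] at h
    simp [det_fin_three, vecMulVec_apply]
    linear_combination h⟩ else 1

theorem coe_elationMatrix {p φ : Fin 3 → K} (h : p ⬝ᵥ φ = 0) :
    (elationMatrix p φ).1 = 1 + vecMulVec p φ := by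
  simp [elationMatrix, h]

/-- No orthogonality is needed: as `c ≠ 0`, both sides lie in the same branch of the definition, and
the default value 1 agrees as well. -/
theorem elationMatrix_smul_left {c : K} (hc : c ≠ 0) (p φ : Fin 3 → K) :
    elationMatrix (c • p) φ = elationMatrix p (c • φ) := by
  by_cases h : p ⬝ᵥ φ = 0
  · apply sl_ext
    rw [coe_elationMatrix (by simp [h]), coe_elationMatrix (by simp [h]), smul_vecMulVec,
      vecMulVec_smul]
  · simp [elationMatrix, hc, h]

theorem dotProduct_semilin_contra (A : SpecialLinearGroup (Fin 3) K) (τ : K ≃+* K)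
    (p φ : Fin 3 → K) : semilin A τ p ⬝ᵥ semilin (contra A) τ φ = τ (p ⬝ᵥ φ) := by
  rw [semilin, semilin, dotProduct_mulVec, ← mulVec_transpose, mulVec_mulVec]
  have : (contra A).1ᵀ * A.1 = 1 := by
    have h : (contra A).1ᵀ = (A⁻¹).1 := transpose_transpose _
    rw [h, sl_inv_mul]
  rw [this, one_mulVec]
  simp [dotProduct]

/-- Conjugation moves the centre like a point and the axis like a line: the factor `A` on the right
is absorbed by the contragredient because `Aᵀ (Aᵀ)⁻¹ = 1`. Non-orthogonal pairs stay non-orthogonal,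
so the default value causes no exception. -/
theorem mul_elationMatrix (A : SpecialLinearGroup (Fin 3) K) (τ : K ≃+* K) (p φ : Fin 3 → K) :
    A * SpecialLinearGroup.map (τ : K →+* K) (elationMatrix p φ) =
      elationMatrix (semilin A τ p) (semilin (contra A) τ φ) * A := by
  by_cases h : p ⬝ᵥ φ = 0
  · have h' : semilin A τ p ⬝ᵥ semilin (contra A) τ φ = 0 := by
      rw [dotProduct_semilin_contra, h, map_zero]
    apply sl_ext
    have e1 : (SpecialLinearGroup.map (τ : K →+* K) (elationMatrix p φ)).1 =
        1 + vecMulVec (fun i => τ (p i)) (fun i => τ (φ i)) := by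
      rw [SpecialLinearGroup.map_apply_coe, coe_elationMatrix h]
      ext i j
      simp [vecMulVec_apply, one_apply, apply_ite]
    rw [sl_mul, sl_mul, coe_elationMatrix h', e1,
      mul_add, add_mul, mul_one, one_mul, mul_vecMulVec, vecMulVec_mul, semilin, semilin,
      ← mulVec_transpose, mulVec_mulVec]
    have : A.1ᵀ * (contra A).1 = 1 := by
      have h : (contra A).1 = (A⁻¹).1ᵀ := rfl
      rw [h, ← transpose_mul, sl_inv_mul, transpose_one]
    rw [this, one_mulVec]
  · have h' : semilin A τ p ⬝ᵥ semilin (contra A) τ φ ≠ 0 := by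
      rw [dotProduct_semilin_contra]; simpa using h
    simp [elationMatrix, h, h']

theorem elationMatrix_mul_right {p φ ψ : Fin 3 → K} (h : p ⬝ᵥ φ = 0) (h' : p ⬝ᵥ ψ = 0) :
    elationMatrix p φ * elationMatrix p ψ = elationMatrix p (φ + ψ) := by
  apply sl_ext
  rw [sl_mul, coe_elationMatrix h, coe_elationMatrix h',
    coe_elationMatrix (by rw [dotProduct_add, h, h', add_zero]), vecMulVec_add]
  have : vecMulVec p φ * vecMulVec p ψ = 0 := by
    rw [vecMulVec_mul_vecMulVec, dotProduct_comm, h]; simp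
  rw [mul_add, add_mul, add_mul, this]
  simp [add_assoc]

theorem elationMatrix_mul_left {p q φ : Fin 3 → K} (h : p ⬝ᵥ φ = 0) (h' : q ⬝ᵥ φ = 0) :
    elationMatrix p φ * elationMatrix q φ = elationMatrix (p + q) φ := by
  apply sl_ext
  rw [sl_mul, coe_elationMatrix h, coe_elationMatrix h',
    coe_elationMatrix (by rw [add_dotProduct, h, h', add_zero]), add_vecMulVec]
  have : vecMulVec p φ * vecMulVec q φ = 0 := by
    rw [vecMulVec_mul_vecMulVec, dotProduct_comm, h']; simp
  rw [mul_add, add_mul, add_mul, this]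
  simp [add_assoc]

theorem elationMatrix_zero_left (φ : Fin 3 → K) : elationMatrix 0 φ = 1 := by
  apply sl_ext; rw [coe_elationMatrix (by simp)]; simp

theorem elationMatrix_zero_right (p : Fin 3 → K) : elationMatrix p 0 = 1 := by
  apply sl_ext; rw [coe_elationMatrix (by simp)]; simp

/-- In characteristic 2 the matrix is its own inverse, so its contragredient is the transpose. This
is why correlations exchange centre and axis. -/
theorem contra_elationMatrix [CharP K 2] (p φ : Fin 3 → K) :
    contra (elationMatrix p φ) = elationMatrix φ p := by
  by_cases h : p ⬝ᵥ φ = 0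
  · have h1 : (elationMatrix p φ)⁻¹ = elationMatrix p φ := by
      rw [inv_eq_iff_mul_eq_one, elationMatrix_mul_right h h, CharTwo.add_self_eq_zero,
        elationMatrix_zero_right]
    rw [contra, h1]
    apply sl_ext
    rw [coe_elationMatrix (by rwa [dotProduct_comm])]
    change (elationMatrix p φ).1ᵀ = _
    rw [coe_elationMatrix h, transpose_add, transpose_one, transpose_vecMulVec]
  · have h2 : ¬ φ ⬝ᵥ p = 0 := by rwa [dotProduct_comm]
    simp [elationMatrix, h, h2, contra_one]

/-- The elation with centre `p` and axis `φ` and matrix `1 + p φᵀ`. -/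
noncomputable def elation (p φ : Fin 3 → K) : collineationsAndCorrelations K :=
  ⟨collineation (elationMatrix p φ) (RingEquiv.refl K), _, _, Or.inl rfl⟩

/-- The collineation `x ↦ A x^τ` as an element of the group. -/
def col (A : SpecialLinearGroup (Fin 3) K) (τ : K ≃+* K) : collineationsAndCorrelations K :=
  ⟨collineation A τ, _, _, Or.inl rfl⟩

/-- The correlation `x ↦ A x^τ` as an element of the group. -/
def cor (A : SpecialLinearGroup (Fin 3) K) (τ : K ≃+* K) : collineationsAndCorrelations K :=
  ⟨correlation A τ, _, _, Or.inr rfl⟩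

theorem eq_col_or_cor (g : collineationsAndCorrelations K) :
    ∃ A τ, g = col A τ ∨ g = cor A τ := by
  obtain ⟨_, A, τ, rfl | rfl⟩ := g
  exacts [⟨A, τ, Or.inl rfl⟩, ⟨A, τ, Or.inr rfl⟩]

theorem elation_smul_left {c : K} (hc : c ≠ 0) (p φ : Fin 3 → K) :
    elation (c • p) φ = elation p (c • φ) := by
  simp only [elation, elationMatrix_smul_left hc]

theorem map_refl (A : SpecialLinearGroup (Fin 3) K) :
    SpecialLinearGroup.map ((RingEquiv.refl K : K ≃+* K) : K →+* K) A = A := by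
  ext i j; simp

theorem col_mul_col (A B : SpecialLinearGroup (Fin 3) K) :
    col A (RingEquiv.refl K) * col B (RingEquiv.refl K) = col (A * B) (RingEquiv.refl K) := by
  apply Subtype.ext
  change collineation _ _ * collineation _ _ = _
  rw [collineation_mul_collineation, map_refl]
  rfl

theorem elation_mul_right {p φ ψ : Fin 3 → K} (h : p ⬝ᵥ φ = 0) (h' : p ⬝ᵥ ψ = 0) :
    elation p φ * elation p ψ = elation p (φ + ψ) := by
  change col _ _ * col _ _ = _
  rw [col_mul_col, elationMatrix_mul_right h h']; rfl

theorem elation_mul_left {p q φ : Fin 3 → K} (h : p ⬝ᵥ φ = 0) (h' : q ⬝ᵥ φ = 0) :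
    elation p φ * elation q φ = elation (p + q) φ := by
  change col _ _ * col _ _ = _
  rw [col_mul_col, elationMatrix_mul_left h h']; rfl

theorem col_mul_elation (A : SpecialLinearGroup (Fin 3) K) (τ : K ≃+* K) (p φ : Fin 3 → K) :
    col A τ * elation p φ = elation (semilin A τ p) (semilin (contra A) τ φ) * col A τ := by
  apply Subtype.ext
  change collineation _ _ * collineation _ _ = collineation _ _ * collineation _ _
  rw [collineation_mul_collineation, collineation_mul_collineation, mul_elationMatrix, map_refl]
  rfl

theorem cor_mul_elation [CharP K 2] (A : SpecialLinearGroup (Fin 3) K) (τ : K ≃+* K)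
    (p φ : Fin 3 → K) :
    cor A τ * elation p φ = elation (semilin (contra A) τ φ) (semilin A τ p) * cor A τ := by
  apply Subtype.ext
  change correlation _ _ * collineation _ _ = collineation _ _ * correlation _ _
  rw [correlation_mul_collineation, collineation_mul_correlation, mul_elationMatrix, map_refl,
    contra_elationMatrix]
  rfl

theorem elation_eq_one_iff_aux {A : SpecialLinearGroup (Fin 3) K} {τ : K ≃+* K}
    {x : Fin 3 → K} (hx : x ≠ 0)
    (h : projPerm A τ (Projectivization.mk K x hx) = Projectivization.mk K x hx) :
    ∃ c : K, c ≠ 0 ∧ semilin A τ x = c • x := by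
  change Projectivization.mk K (semilin A τ x) _ = _ at h
  rw [Projectivization.mk_eq_mk_iff] at h
  obtain ⟨c, hc⟩ := h
  exact ⟨c, c.ne_zero, hc.symm⟩

/-- A matrix that fixes all points is scalar. -/
theorem exists_scalar_of_projPerm_eq {A B : SpecialLinearGroup (Fin 3) K}
    (h : projPerm A (RingEquiv.refl K) = projPerm B (RingEquiv.refl K)) :
    ∃ c : K, A.1 = c • B.1 := by
  have key : ∀ x : Fin 3 → K, ∃ c : K, ((B⁻¹ * A).1.mulVec x) = c • x := by
    intro x
    by_cases hx : x = 0
    · exact ⟨0, by simp [hx]⟩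
    have h2 := congrArg (fun f => projPerm B⁻¹ (RingEquiv.refl K) (f (Projectivization.mk K x hx))) h
    simp only [projPerm_mul, map_refl, inv_mul_cancel] at h2
    replace h2 := h2.trans (projPerm_one _)
    obtain ⟨c, -, hc⟩ := elation_eq_one_iff_aux hx h2
    exact ⟨c, hc⟩
  -- Every vector is an eigenvector of `B⁻¹ A`, which forces a common eigenvalue.
  obtain ⟨c, hc⟩ := LinearMap.exists_eq_smul_id_of_forall_notLinearIndependent
    (f := Matrix.toLin' (B⁻¹ * A).1) (by
      intro x
      obtain ⟨c, hc⟩ := key x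
      rw [Matrix.toLin'_apply, hc]
      intro hli
      have := LinearIndependent.pair_iff.1 hli c (-1) (by simp)
      simp at this)
  refine ⟨c, ?_⟩
  have h3 : (B⁻¹ * A).1 = c • 1 := by
    have := congrArg LinearMap.toMatrix' hc
    rwa [LinearMap.toMatrix'_toLin', map_smul, LinearMap.toMatrix'_one] at this
  calc A.1 = (B * (B⁻¹ * A)).1 := by rw [mul_inv_cancel_left]
    _ = c • B.1 := by rw [sl_mul, h3]; simp

end
end PlaneGroup

/-! ### Uniqueness of centre and axis; relative position of commuting elations -/

namespace PlaneGroup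

open Matrix

section

variable {K : Type*} [Field K]

theorem projPerm_eq_of_elation_eq {p φ q ψ : Fin 3 → K} (h : elation p φ = elation q ψ) :
    projPerm (elationMatrix p φ) (RingEquiv.refl K) =
      projPerm (elationMatrix q ψ) (RingEquiv.refl K) := by
  ext x
  have := congrArg (fun g : collineationsAndCorrelations K => g.1 (Sum.inl x)) h
  simpa [elation, collineation] using this

theorem exists_smul_of_vecMulVec_eq {p φ q ψ : Fin 3 → K} (hp : p ≠ 0) (hφ : φ ≠ 0)
    (h : vecMulVec p φ = vecMulVec q ψ) : ∃ c : K, c ≠ 0 ∧ q = c • p ∧ φ = c • ψ := by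
  have h' : ∀ i j, p i * φ j = q i * ψ j := fun i j => by
    simpa [vecMulVec_apply] using congrFun (congrFun h i) j
  obtain ⟨i, hi⟩ := Function.ne_iff.1 hp
  obtain ⟨j, hj⟩ := Function.ne_iff.1 hφ
  simp only [Pi.zero_apply] at hi hj
  have hq : q i ≠ 0 := fun h0 => mul_ne_zero hi hj (by rw [h', h0, zero_mul])
  have hs : ψ j ≠ 0 := fun h0 => mul_ne_zero hi hj (by rw [h', h0, mul_zero])
  refine ⟨q i / p i, div_ne_zero hq hi, ?_, ?_⟩
  · ext k
    have h1 := h' k j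
    have h2 := h' i j
    simp only [Pi.smul_apply, smul_eq_mul]
    field_simp
    apply mul_right_cancel₀ hs
    linear_combination (-p i) * h1 + p k * h2
  · ext k
    have h1 := h' i k
    simp only [Pi.smul_apply, smul_eq_mul]
    field_simp
    linear_combination h1

/-- Equal collineations have proportional matrices. Both matrices have trace 3 = 1, so the factor is
1, and a matrix of rank one determines its two vectors up to inverse scalars. -/
theorem elation_injective [CharP K 2] {p φ q ψ : Fin 3 → K} (hp : p ≠ 0) (hφ : φ ≠ 0)
    (h : p ⬝ᵥ φ = 0) (h' : q ⬝ᵥ ψ = 0) (heq : elation p φ = elation q ψ) :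
    ∃ c : K, c ≠ 0 ∧ q = c • p ∧ φ = c • ψ := by
  obtain ⟨c, hc⟩ := exists_scalar_of_projPerm_eq (projPerm_eq_of_elation_eq heq)
  rw [coe_elationMatrix h, coe_elationMatrix h'] at hc
  have ht := congrArg trace hc
  rw [trace_smul, trace_add, trace_add, trace_vecMulVec, trace_vecMulVec, h, h'] at ht
  have h3 : (3 : K) = 1 := by
    have : (2 : K) = 0 := CharTwo.two_eq_zero
    linear_combination this
  have hc1 : c = 1 := by
    simp [h3] at ht
    exact ht.symm
  rw [hc1, one_smul, add_right_inj] at hc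
  exact exists_smul_of_vecMulVec_eq hp hφ hc

theorem elation_zero_right (p : Fin 3 → K) : elation p 0 = 1 := by
  apply Subtype.ext
  change collineation _ _ = 1
  rw [elationMatrix_zero_right, collineation_one]

theorem elation_zero_left (φ : Fin 3 → K) : elation 0 φ = 1 := by
  apply Subtype.ext
  change collineation _ _ = 1
  rw [elationMatrix_zero_left, collineation_one]

theorem elation_ne_one [CharP K 2] {p φ : Fin 3 → K} (hp : p ≠ 0) (hφ : φ ≠ 0)
    (h : p ⬝ᵥ φ = 0) : elation p φ ≠ 1 := by
  intro h1
  rw [← elation_zero_right p] at h1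
  obtain ⟨c, -, -, hc⟩ := elation_injective hp hφ h (dotProduct_zero p) h1
  exact hφ (by simpa using hc)

theorem elation_mul_self [CharP K 2] {p φ : Fin 3 → K} (h : p ⬝ᵥ φ = 0) :
    elation p φ * elation p φ = 1 := by
  rw [elation_mul_right h h, CharTwo.add_self_eq_zero, elation_zero_right]

theorem conj_col_elation (A : SpecialLinearGroup (Fin 3) K) (τ : K ≃+* K) (p φ : Fin 3 → K) :
    MulAut.conj (col A τ) (elation p φ) =
      elation (semilin A τ p) (semilin (contra A) τ φ) := by
  rw [MulAut.conj_apply, mul_inv_eq_iff_eq_mul, col_mul_elation]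

theorem conj_cor_elation [CharP K 2] (A : SpecialLinearGroup (Fin 3) K) (τ : K ≃+* K)
    (p φ : Fin 3 → K) :
    MulAut.conj (cor A τ) (elation p φ) =
      elation (semilin (contra A) τ φ) (semilin A τ p) := by
  rw [MulAut.conj_apply, mul_inv_eq_iff_eq_mul, cor_mul_elation]

theorem semilin_smul (A : SpecialLinearGroup (Fin 3) K) (τ : K ≃+* K) (c : K) (x : Fin 3 → K) :
    semilin A τ (c • x) = τ c • semilin A τ x := by
  simp only [semilin, ← mulVec_smul]
  congr 1
  ext i
  simp

/-- The cofactor matrix of `A` governs cross products, and it is `(Aᵀ)⁻¹` because the determinant is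
1. For other determinants the relative position of two elations would change by a factor. -/
theorem semilin_cross (A : SpecialLinearGroup (Fin 3) K) (τ : K ≃+* K) (x y : Fin 3 → K) :
    crossProduct (semilin A τ x) (semilin A τ y) =
      semilin (contra A) τ (crossProduct x y) := by
  have h : (contra A).1 = (adjugate A.1)ᵀ := rfl
  ext i
  simp only [semilin, h, adjugate_fin_three, cross_apply]
  fin_cases i <;> simp [mulVec, dotProduct, Fin.sum_univ_three] <;> ring

theorem semilin_contra_cross (A : SpecialLinearGroup (Fin 3) K) (τ : K ≃+* K)
    (x y : Fin 3 → K) : crossProduct (semilin (contra A) τ x) (semilin (contra A) τ y) =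
      semilin A τ (crossProduct x y) := by
  rw [semilin_cross, contra_contra]

theorem exists_smul_of_cross_eq_zero {u v : Fin 3 → K} (hv : v ≠ 0)
    (h : crossProduct u v = 0) : ∃ c : K, u = c • v := by
  obtain ⟨i, hi⟩ := Function.ne_iff.1 hv
  refine ⟨u i / v i, ?_⟩
  have h0 := congrFun h 0
  have h1 := congrFun h 1
  have h2 := congrFun h 2
  simp [cross_apply] at h0 h1 h2 hi
  ext k
  simp only [Pi.smul_apply, smul_eq_mul]
  field_simp
  fin_cases i <;> fin_cases k <;> simp <;> grind

theorem exists_smul_cross {p φ ψ : Fin 3 → K} (h : p ⬝ᵥ φ = 0) (h' : p ⬝ᵥ ψ = 0)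
    (hp : p ≠ 0) : ∃ c : K, crossProduct φ ψ = c • p := by
  apply exists_smul_of_cross_eq_zero hp
  simp [dotProduct, Fin.sum_univ_three] at h h'
  ext i
  fin_cases i <;> simp [cross_apply] <;> grind

/-- `x` and `y` are elations with the same centre and different axes; the parameter `c` describes
their relative position. -/
def CentreRel (c : K) (x y : collineationsAndCorrelations K) : Prop :=
  ∃ p φ ψ : Fin 3 → K, p ≠ 0 ∧ p ⬝ᵥ φ = 0 ∧ p ⬝ᵥ ψ = 0 ∧ crossProduct φ ψ = c • p ∧
    x = elation p φ ∧ y = elation p ψ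

/-- `x` and `y` are elations with the same axis and different centres; the parameter `c` describes
their relative position. -/
def AxisRel (c : K) (x y : collineationsAndCorrelations K) : Prop :=
  ∃ p q φ : Fin 3 → K, φ ≠ 0 ∧ p ⬝ᵥ φ = 0 ∧ q ⬝ᵥ φ = 0 ∧ crossProduct p q = c • φ ∧
    x = elation p φ ∧ y = elation q φ

/-- `x` and `y` are elations with the same centre and the same axis, with ratio `c`. -/
def FlagRel (c : K) (x y : collineationsAndCorrelations K) : Prop :=
  ∃ p φ : Fin 3 → K, p ≠ 0 ∧ φ ≠ 0 ∧ p ⬝ᵥ φ = 0 ∧ x = elation p φ ∧ y = elation p (c • φ)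

/-- All data of the relation are built from dot and cross products, which semilinear maps of
determinant 1 respect. Only the field automorphism affects the parameter. -/
theorem CentreRel.conj_col {c : K} {x y : collineationsAndCorrelations K} (h : CentreRel c x y)
    (A : SpecialLinearGroup (Fin 3) K) (τ : K ≃+* K) :
    CentreRel (τ c) (MulAut.conj (col A τ) x) (MulAut.conj (col A τ) y) := by
  obtain ⟨p, φ, ψ, hp, h1, h2, h3, rfl, rfl⟩ := h
  refine ⟨_, _, _, semilin_ne_zero A τ hp, ?_, ?_, ?_, conj_col_elation .., conj_col_elation ..⟩
  · rw [dotProduct_semilin_contra, h1, map_zero]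
  · rw [dotProduct_semilin_contra, h2, map_zero]
  · rw [semilin_contra_cross, h3, semilin_smul]

theorem AxisRel.conj_col {c : K} {x y : collineationsAndCorrelations K} (h : AxisRel c x y)
    (A : SpecialLinearGroup (Fin 3) K) (τ : K ≃+* K) :
    AxisRel (τ c) (MulAut.conj (col A τ) x) (MulAut.conj (col A τ) y) := by
  obtain ⟨p, φ, ψ, hp, h1, h2, h3, rfl, rfl⟩ := h
  refine ⟨_, _, _, semilin_ne_zero _ τ hp, ?_, ?_, ?_, conj_col_elation .., conj_col_elation ..⟩
  · rw [dotProduct_semilin_contra, h1, map_zero]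
  · rw [dotProduct_semilin_contra, h2, map_zero]
  · rw [semilin_cross, h3, semilin_smul]

theorem FlagRel.conj_col {c : K} {x y : collineationsAndCorrelations K} (h : FlagRel c x y)
    (A : SpecialLinearGroup (Fin 3) K) (τ : K ≃+* K) :
    FlagRel (τ c) (MulAut.conj (col A τ) x) (MulAut.conj (col A τ) y) := by
  obtain ⟨p, φ, hp, hφ, h1, rfl, rfl⟩ := h
  refine ⟨_, _, semilin_ne_zero _ τ hp, semilin_ne_zero _ τ hφ, ?_, conj_col_elation .., ?_⟩
  · rw [dotProduct_semilin_contra, h1, map_zero]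
  · rw [conj_col_elation, semilin_smul]

theorem CentreRel.conj_cor [CharP K 2] {c : K} {x y : collineationsAndCorrelations K}
    (h : CentreRel c x y) (A : SpecialLinearGroup (Fin 3) K) (τ : K ≃+* K) :
    AxisRel (τ c) (MulAut.conj (cor A τ) x) (MulAut.conj (cor A τ) y) := by
  obtain ⟨p, φ, ψ, hp, h1, h2, h3, rfl, rfl⟩ := h
  refine ⟨_, _, _, semilin_ne_zero _ τ hp, ?_, ?_, ?_, conj_cor_elation .., conj_cor_elation ..⟩
  · rw [dotProduct_comm, dotProduct_semilin_contra, h1, map_zero]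
  · rw [dotProduct_comm, dotProduct_semilin_contra, h2, map_zero]
  · rw [semilin_contra_cross, h3, semilin_smul]

theorem AxisRel.conj_cor [CharP K 2] {c : K} {x y : collineationsAndCorrelations K}
    (h : AxisRel c x y) (A : SpecialLinearGroup (Fin 3) K) (τ : K ≃+* K) :
    CentreRel (τ c) (MulAut.conj (cor A τ) x) (MulAut.conj (cor A τ) y) := by
  obtain ⟨p, φ, ψ, hp, h1, h2, h3, rfl, rfl⟩ := h
  refine ⟨_, _, _, semilin_ne_zero _ τ hp, ?_, ?_, ?_, conj_cor_elation .., conj_cor_elation ..⟩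
  · rw [dotProduct_comm, dotProduct_semilin_contra, h1, map_zero]
  · rw [dotProduct_comm, dotProduct_semilin_contra, h2, map_zero]
  · rw [semilin_cross, h3, semilin_smul]

theorem FlagRel.conj_cor [CharP K 2] {c : K} {x y : collineationsAndCorrelations K}
    (h : FlagRel c x y) (A : SpecialLinearGroup (Fin 3) K) (τ : K ≃+* K) :
    FlagRel (τ c) (MulAut.conj (cor A τ) x) (MulAut.conj (cor A τ) y) := by
  obtain ⟨p, φ, hp, hφ, h1, rfl, rfl⟩ := h
  -- Exchanging centre and axis leaves the scalar `c` on the wrong vector, and moving it across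
  -- needs `c ≠ 0`. For `c = 0` the second element is the identity.
  by_cases hc : c = 0
  · subst hc
    refine ⟨_, _, semilin_ne_zero _ τ hφ, semilin_ne_zero _ τ hp, ?_, conj_cor_elation .., ?_⟩
    · rw [dotProduct_comm, dotProduct_semilin_contra, h1, map_zero]
    · rw [zero_smul, elation_zero_right, map_one, map_zero, zero_smul, elation_zero_right]
  refine ⟨_, _, semilin_ne_zero _ τ hφ, semilin_ne_zero _ τ hp, ?_, conj_cor_elation .., ?_⟩
  · rw [dotProduct_comm, dotProduct_semilin_contra, h1, map_zero]
  · rw [conj_cor_elation, semilin_smul, elation_smul_left (by simpa using hc)]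

theorem neg_cross' [CharP K 2] (u v : Fin 3 → K) : crossProduct u v = crossProduct v u := by
  rw [← cross_anticomm, CharTwo.neg_eq]

theorem CentreRel.symm [CharP K 2] {c : K} {x y : collineationsAndCorrelations K}
    (h : CentreRel c x y) : CentreRel c y x := by
  obtain ⟨p, φ, ψ, hp, h1, h2, h3, rfl, rfl⟩ := h
  exact ⟨_, _, _, hp, h2, h1, by rw [neg_cross', h3], rfl, rfl⟩

theorem AxisRel.symm [CharP K 2] {c : K} {x y : collineationsAndCorrelations K}
    (h : AxisRel c x y) : AxisRel c y x := by
  obtain ⟨p, φ, ψ, hp, h1, h2, h3, rfl, rfl⟩ := h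
  exact ⟨_, _, _, hp, h2, h1, by rw [neg_cross', h3], rfl, rfl⟩

theorem FlagRel.symm {c : K} {x y : collineationsAndCorrelations K} (hc : c ≠ 0)
    (h : FlagRel c x y) : FlagRel c⁻¹ y x := by
  obtain ⟨p, φ, hp, hφ, h1, rfl, rfl⟩ := h
  exact ⟨p, c • φ, hp, by simp [hc, hφ], by simp [h1], rfl, by rw [inv_smul_smul₀ hc]⟩

/-- The product has axis vector `φ + ψ`, and `φ × (φ + ψ) = φ × ψ`. Together with symmetry this
relates any two elements of the triple. -/
theorem CentreRel.mul_right {c : K} {x y : collineationsAndCorrelations K}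
    (h : CentreRel c x y) : CentreRel c x (x * y) := by
  obtain ⟨p, φ, ψ, hp, h1, h2, h3, rfl, rfl⟩ := h
  exact ⟨_, _, _, hp, h1, by rw [dotProduct_add, h1, h2, add_zero],
    by rw [map_add, cross_self, zero_add, h3], rfl, elation_mul_right h1 h2⟩

theorem AxisRel.mul_right {c : K} {x y : collineationsAndCorrelations K}
    (h : AxisRel c x y) : AxisRel c x (x * y) := by
  obtain ⟨p, φ, ψ, hp, h1, h2, h3, rfl, rfl⟩ := h
  exact ⟨_, _, _, hp, h1, by rw [add_dotProduct, h1, h2, add_zero],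
    by rw [map_add, cross_self, zero_add, h3], rfl, elation_mul_left h1 h2⟩

theorem FlagRel.mul_right {c : K} {x y : collineationsAndCorrelations K}
    (h : FlagRel c x y) : FlagRel (1 + c) x (x * y) := by
  obtain ⟨p, φ, hp, hφ, h1, rfl, rfl⟩ := h
  refine ⟨p, φ, hp, hφ, h1, rfl, ?_⟩
  rw [elation_mul_right h1 (by simp [h1]), add_smul, one_smul]

/-- Being an elation with some centre and axis. -/
def IsElation (x : collineationsAndCorrelations K) : Prop :=
  ∃ p φ : Fin 3 → K, p ≠ 0 ∧ φ ≠ 0 ∧ p ⬝ᵥ φ = 0 ∧ x = elation p φ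

/-- Commuting elations fix each other's centres, whereas the second one sends `p` to `p + (p · ψ)
q`. If `p · ψ` were nonzero, pairing with `ψ` would show that the vector `p` itself is fixed, so `(p
· ψ) q = 0`. -/
theorem dotProduct_eq_zero_of_commute [CharP K 2] {p φ q ψ : Fin 3 → K} (hp : p ≠ 0)
    (hφ : φ ≠ 0) (hq : q ≠ 0) (h : p ⬝ᵥ φ = 0) (h' : q ⬝ᵥ ψ = 0)
    (hc : Commute (elation p φ) (elation q ψ)) : p ⬝ᵥ ψ = 0 := by
  have h1 : elation p φ = MulAut.conj (elation q ψ) (elation p φ) := by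
    rw [MulAut.conj_apply, ← hc.eq, mul_inv_cancel_right]
  change _ = MulAut.conj (col _ _) _ at h1
  rw [conj_col_elation] at h1
  obtain ⟨c, hc0, h2, -⟩ := elation_injective hp hφ h
    (by rw [dotProduct_semilin_contra, h, map_zero]) h1
  have h3 : semilin (elationMatrix q ψ) (RingEquiv.refl K) p = p + (p ⬝ᵥ ψ) • q := by
    simp [semilin, coe_elationMatrix h', add_mulVec, vecMulVec_mulVec, dotProduct_comm]
  rw [h3] at h2
  have h4 := congrArg (· ⬝ᵥ ψ) h2
  simp only [add_dotProduct, smul_dotProduct, h', smul_eq_mul, mul_zero, add_zero] at h4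
  by_contra hne
  have hc1 : c = 1 := by
    apply mul_right_cancel₀ hne
    rw [← h4, one_mul]
  rw [hc1, one_smul, add_eq_left, smul_eq_zero] at h2
  exact h2.elim hne hq

/-- Each centre lies on both axes. Different axes meet in one point only, so the centres agree, and
rescaling gives both elations the same centre vector. If the axes agree, they can be given the same
axis vector, and the centres are either different or equal; the latter case gives `FlagRel`. -/
theorem rel_of_commute [CharP K 2] {x y : collineationsAndCorrelations K} (hx : IsElation x)
    (hy : IsElation y) (hxy : x ≠ y) (hc : Commute x y) :
    ∃ c : K, c ≠ 0 ∧ (CentreRel c x y ∨ AxisRel c x y ∨ (c ≠ 1 ∧ FlagRel c x y)) := by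
  obtain ⟨p, φ, hp, hφ, h, rfl⟩ := hx
  obtain ⟨q, ψ, hq, hψ, h', rfl⟩ := hy
  have h1 := dotProduct_eq_zero_of_commute hp hφ hq h h' hc
  have h2 := dotProduct_eq_zero_of_commute hq hψ hp h' h hc.symm
  have flag : ∀ c : K, elation q ψ = elation p (c • φ) →
      ∃ c : K, c ≠ 0 ∧ (CentreRel c (elation p φ) (elation q ψ) ∨
        AxisRel c (elation p φ) (elation q ψ) ∨
        (c ≠ 1 ∧ FlagRel c (elation p φ) (elation q ψ))) := by
    intro c hcc
    refine ⟨c, ?_, Or.inr (Or.inr ⟨?_, p, φ, hp, hφ, h, rfl, hcc⟩)⟩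
    · rintro rfl
      rw [zero_smul, elation_zero_right] at hcc
      exact elation_ne_one hq hψ h' hcc
    · rintro rfl
      rw [one_smul] at hcc
      exact hxy hcc.symm
  by_cases hcr : crossProduct ψ φ = 0
  · obtain ⟨k, rfl⟩ := exists_smul_of_cross_eq_zero hφ hcr
    have hk : k ≠ 0 := by rintro rfl; simp at hψ
    have h'' : (k • q) ⬝ᵥ φ = 0 := by rw [smul_dotProduct, h2, smul_zero]
    obtain ⟨c, hc'⟩ := exists_smul_cross (p := φ) (φ := p) (ψ := k • q)
      (by rwa [dotProduct_comm]) (by rwa [dotProduct_comm]) hφ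
    by_cases hc0 : c = 0
    · rw [hc0, zero_smul, neg_cross'] at hc'
      obtain ⟨m, hm⟩ := exists_smul_of_cross_eq_zero hp hc'
      have hm0 : m ≠ 0 := by
        rintro rfl
        rw [zero_smul, smul_eq_zero] at hm
        exact hm.elim hk hq
      apply flag m
      rw [← elation_smul_left hk, hm, elation_smul_left hm0]
    · exact ⟨c, hc0, Or.inr (Or.inl ⟨p, k • q, φ, hφ, h, h'', hc', rfl,
        (elation_smul_left hk _ _).symm⟩)⟩
  · obtain ⟨a, ha⟩ := exists_smul_cross h1 h hp
    obtain ⟨b, hb⟩ := exists_smul_cross h' h2 hq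
    have ha0 : a ≠ 0 := by rintro rfl; exact hcr (by rw [ha, zero_smul])
    have hb0 : b ≠ 0 := by rintro rfl; exact hcr (by rw [hb, zero_smul])
    have hqp : q = (b⁻¹ * a) • p := by
      rw [mul_smul, ← ha, hb, inv_smul_smul₀ hb0]
    set k := b⁻¹ * a with hk
    have hk0 : k ≠ 0 := mul_ne_zero (inv_ne_zero hb0) ha0
    refine ⟨k * a, mul_ne_zero hk0 ha0, Or.inl ⟨p, φ, k • ψ, hp, h, by simp [h1], ?_, rfl, ?_⟩⟩
    · rw [map_smul, neg_cross', ha, smul_smul]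
    · rw [← elation_smul_left hk0, ← hqp]

/-- Two vectors `φ`, `ψ` with `φ × ψ = c p` can be mapped to a standard position. -/
theorem exists_standard {c : K} (hc : c ≠ 0) {p φ ψ : Fin 3 → K} (hp : p ≠ 0)
    (h : crossProduct φ ψ = c • p) : ∃ A : SpecialLinearGroup (Fin 3) K,
      semilin A (RingEquiv.refl K) p = ![0, 0, c⁻¹] ∧
      semilin (contra A) (RingEquiv.refl K) φ = ![1, 0, 0] ∧
      semilin (contra A) (RingEquiv.refl K) ψ = ![0, 1, 0] := by
  obtain ⟨i, hi⟩ := Function.ne_iff.1 hp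
  simp only [Pi.zero_apply] at hi
  -- The value `c⁻¹` makes the determinant of the rows `φ, ψ, θ` equal to `θ · (φ × ψ) = c (θ · p) =
  -- 1`.
  obtain ⟨θ, hθ⟩ : ∃ θ : Fin 3 → K, θ ⬝ᵥ p = c⁻¹ :=
    ⟨Pi.single i ((c * p i)⁻¹), by rw [single_dotProduct]; field_simp⟩
  have hdet : (Matrix.of ![φ, ψ, θ]).det = 1 := by
    have h1 : θ ⬝ᵥ crossProduct φ ψ = 1 := by
      rw [h, dotProduct_smul, hθ, smul_eq_mul, mul_inv_cancel₀ hc]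
    rw [← triple_product_permutation, ← triple_product_permutation,
      triple_product_eq_det] at h1
    exact h1
  let A : SpecialLinearGroup (Fin 3) K := ⟨Matrix.of ![φ, ψ, θ], hdet⟩
  have hA : ∀ x, semilin (contra A) (RingEquiv.refl K) (A.1ᵀ.mulVec x) = x := by
    intro x
    change (contra A).1.mulVec (A.1ᵀ.mulVec x) = x
    have h : (contra A).1 = (A⁻¹).1ᵀ := rfl
    rw [mulVec_mulVec, h, ← transpose_mul, ← sl_mul, mul_inv_cancel, sl_one, transpose_one,
      one_mulVec]
  have hpφ : φ ⬝ᵥ p = 0 := by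
    have := dot_self_cross φ ψ
    rw [h, dotProduct_smul, smul_eq_zero] at this
    exact this.resolve_left hc
  have hpψ : ψ ⬝ᵥ p = 0 := by
    have := dot_cross_self φ ψ
    rw [h, dotProduct_smul, smul_eq_zero] at this
    exact this.resolve_left hc
  refine ⟨A, ?_, ?_, ?_⟩
  · change A.1.mulVec p = _
    ext j
    fin_cases j
    · exact hpφ
    · exact hpψ
    · exact hθ
  · convert hA ![1, 0, 0] using 2
    ext j; simp [A, mulVec, dotProduct, Fin.sum_univ_three]
  · convert hA ![0, 1, 0] using 2
    ext j; simp [A, mulVec, dotProduct, Fin.sum_univ_three]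

end
end PlaneGroup

/-! ### The index of the normalizer of a four-group -/

section NormalizerIndex

variable {H : Type*} [Group H]

/-- The relative index of `B` in `A` is the size of the image of a map that separates exactly the
left cosets of `B`. -/
theorem relIndex_eq_ncard_of_image {X : Type*} {A B : Subgroup H} (f : H → X) (s : Set X)
    (hf : ∀ g ∈ A, ∀ h ∈ A, f g = f h ↔ g⁻¹ * h ∈ B) (hs : f '' A = s) :
    B.relIndex A = s.ncard := by
  subst hs
  rw [Subgroup.relIndex, Subgroup.index, ← Nat.card_coe_set_eq]
  refine Nat.card_eq_of_bijective (fun q : A ⧸ B.subgroupOf A =>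
    Quotient.liftOn' q (fun g => (⟨f g, g, g.2, rfl⟩ : f '' (A : Set H))) ?_) ⟨?_, ?_⟩
  · intro a b hab
    rw [QuotientGroup.leftRel_apply] at hab
    exact Subtype.ext ((hf a a.2 b b.2).2 hab)
  · rintro ⟨a⟩ ⟨b⟩ hab
    refine Quotient.sound' ?_
    rw [QuotientGroup.leftRel_apply]
    exact (hf a a.2 b b.2).1 (congrArg Subtype.val hab)
  · rintro ⟨_, a, ha, rfl⟩
    exact ⟨Quotient.mk'' ⟨a, ha⟩, rfl⟩

theorem mem_closure_pair_of_involutions {x y : H} (hx : x * x = 1) (hy : y * y = 1)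
    (hc : Commute x y) {z : H} :
    z ∈ Subgroup.closure {x, y} ↔ z = 1 ∨ z = x ∨ z = y ∨ z = x * y := by
  have hyx : y * x = x * y := hc.eq.symm
  constructor
  · intro hz
    induction hz using Subgroup.closure_induction with
    | mem z hz => rcases hz with rfl | rfl <;> simp
    | one => simp
    | mul a b _ _ ha hb =>
      have h1 : x * (x * y) = y := by rw [← mul_assoc, hx, one_mul]
      have h2 : y * (x * y) = x := by rw [← mul_assoc, hyx, mul_assoc, hy, mul_one]
      have h3 : x * y * x = y := by rw [mul_assoc, hyx, h1]
      have h4 : x * y * y = x := by rw [mul_assoc, hy, mul_one]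
      have h5 : x * y * (x * y) = 1 := by rw [← mul_assoc, h3, hy]
      rcases ha with rfl | rfl | rfl | rfl <;> rcases hb with rfl | rfl | rfl | rfl <;>
        simp [hx, hy, hyx, h1, h2, h3, h4, h5]
    | inv a _ ha =>
      have h1 : x⁻¹ = x := inv_eq_of_mul_eq_one_right hx
      have h2 : y⁻¹ = y := inv_eq_of_mul_eq_one_right hy
      rcases ha with rfl | rfl | rfl | rfl <;> simp [h1, h2, hyx]
  · have h1 : x ∈ Subgroup.closure {x, y} := Subgroup.subset_closure (by simp)
    have h2 : y ∈ Subgroup.closure {x, y} := Subgroup.subset_closure (by simp)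
    rintro (rfl | rfl | rfl | rfl)
    exacts [one_mem _, h1, h2, mul_mem h1 h2]

/-- The centralizer `C` of both elements lies in the centralizer of `x` and in the normalizer `N`.
Its index in the former counts the `z` with `R x z`, by transitivity on related pairs. Its index in
`N` is 6, because all six ordered pairs of distinct involutions of the four-group are related and
hence conjugate to `(x, y)`. The formula compares the two towers. -/
theorem index_normalizer_mul_six (R : H → H → Prop)
    (hconj : ∀ g x y, R x y → R (MulAut.conj g x) (MulAut.conj g y))
    (htrans : ∀ x y x' y', R x y → R x' y' → ∃ g, MulAut.conj g x = x' ∧ MulAut.conj g y = y')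
    (hsymm : ∀ x y, R x y → R y x) (hmul : ∀ x y, R x y → R x (x * y))
    {x y : H} (hR : R x y) (hx : x * x = 1) (hy : y * y = 1) (hc : Commute x y) (hxy : x ≠ y)
    (hx1 : x ≠ 1) (hy1 : y ≠ 1) :
    (Subgroup.normalizer (Subgroup.closure {x, y} : Set H)).index * 6 =
      (Subgroup.centralizer {x}).index * {z | R x z}.ncard := by
  set N := Subgroup.normalizer (Subgroup.closure {x, y} : Set H) with hN
  set C := Subgroup.centralizer ({x, y} : Set H) with hC
  have hmem := fun z => mem_closure_pair_of_involutions hx hy hc (z := z)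
  have conj_eq : ∀ g h z : H, MulAut.conj g z = MulAut.conj h z ↔ Commute z (g⁻¹ * h) := by
    intro g h z
    rw [commute_iff_eq, MulAut.conj_apply, MulAut.conj_apply]
    constructor
    · intro h1
      simpa [mul_assoc] using congrArg (fun t => g⁻¹ * t * h) h1
    · intro h1
      simpa [mul_assoc] using congrArg (fun t => g * t * h⁻¹) h1
  have hCmem : ∀ g, g ∈ C ↔ Commute x g ∧ Commute y g := by
    intro g
    rw [hC, Subgroup.mem_centralizer_iff]
    simp [commute_iff_eq]
  have hC1 : C ≤ Subgroup.centralizer {x} := by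
    intro g hg
    rw [Subgroup.mem_centralizer_singleton_iff]
    exact ((hCmem g).1 hg).1.eq.symm
  have hCN : C ≤ N := by
    intro g hg
    obtain ⟨h1, h2⟩ := (hCmem g).1 hg
    have : Finite (Subgroup.closure {x, y} : Set H) := by
      apply Set.Finite.subset (s := {1, x, y, x * y}) (Set.toFinite _)
      intro z hz
      simpa using (hmem z).1 hz
    apply Subgroup.mem_normalizer_fintype
    intro n hn
    have h3 : Commute n g := by
      rcases (hmem n).1 hn with rfl | rfl | rfl | rfl
      exacts [Commute.one_left _, h1, h2, h1.mul_left h2]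
    rwa [← h3.eq, mul_inv_cancel_right]
  have e1 : C.relIndex (Subgroup.centralizer {x}) = {z | R x z}.ncard := by
    apply relIndex_eq_ncard_of_image (fun g => MulAut.conj g y)
    · intro g hg h hh
      rw [conj_eq, hCmem]
      rw [Subgroup.mem_centralizer_singleton_iff] at hg hh
      have : Commute x (g⁻¹ * h) :=
        Commute.mul_right (Commute.inv_right (Commute.symm hg)) (Commute.symm hh)
      simp [this]
    · ext z
      constructor
      · rintro ⟨g, hg, rfl⟩
        rw [SetLike.mem_coe, Subgroup.mem_centralizer_singleton_iff] at hg
        have := hconj g x y hR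
        rwa [MulAut.conj_apply, hg, mul_inv_cancel_right] at this
      · intro hz
        obtain ⟨g, h1, h2⟩ := htrans x y x z hR hz
        refine ⟨g, ?_, h2⟩
        rw [SetLike.mem_coe, Subgroup.mem_centralizer_singleton_iff]
        rwa [MulAut.conj_apply, mul_inv_eq_iff_eq_mul] at h1
  have hxz : x ≠ x * y := by simpa using hy1
  have hyz : y ≠ x * y := by simpa using hx1
  have hz1 : x * y ≠ 1 := fun h => hxy (by rw [← mul_one x, ← hy, ← mul_assoc, h, one_mul])
  -- The cosets of `C` in `N` correspond to the images of the pair `(x, y)` under conjugation by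
  -- `N`.
  have e2 : C.relIndex N =
      ({(x, y), (y, x), (x, x * y), (x * y, x), (y, x * y), (x * y, y)} : Set (H × H)).ncard := by
    apply relIndex_eq_ncard_of_image (fun g => (MulAut.conj g x, MulAut.conj g y))
    · intro g hg h hh
      rw [Prod.mk.injEq, conj_eq, conj_eq, hCmem]
    · have hN1 : ∀ g ∈ N, ∀ z, (z = 1 ∨ z = x ∨ z = y ∨ z = x * y) →
          (MulAut.conj g z = 1 ∨ MulAut.conj g z = x ∨ MulAut.conj g z = y ∨
            MulAut.conj g z = x * y) := by
        intro g hg z hz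
        rw [← hmem] at hz ⊢
        exact (Subgroup.mem_normalizer_iff.1 hg z).1 hz
      ext ⟨u, v⟩
      constructor
      · rintro ⟨g, hg, h⟩
        rw [Prod.mk.injEq] at h
        obtain ⟨rfl, rfl⟩ := h
        have h1 := hN1 g hg x (by simp)
        have h2 := hN1 g hg y (by simp)
        have h3 : MulAut.conj g x ≠ 1 := by simpa using hx1
        have h4 : MulAut.conj g y ≠ 1 := by simpa using hy1
        have h5 : MulAut.conj g x ≠ MulAut.conj g y := fun h =>
          hxy ((MulAut.conj g).injective h)
        generalize MulAut.conj g x = u at *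
        generalize MulAut.conj g y = v at *
        rcases h1 with rfl | rfl | rfl | rfl <;> rcases h2 with rfl | rfl | rfl | rfl <;>
          first | exact absurd rfl h3 | exact absurd rfl h4 | exact absurd rfl h5 | simp
      · intro h
        have hRu : R u v := by
          have hz := hmul x y hR
          have hy' := hsymm x y hR
          have hz2 := hmul y x hy'
          rw [← hc.eq] at hz2
          simp only [Set.mem_insert_iff, Set.mem_singleton_iff, Prod.mk.injEq] at h
          rcases h with ⟨rfl, rfl⟩ | ⟨rfl, rfl⟩ | ⟨rfl, rfl⟩ | ⟨rfl, rfl⟩ | ⟨rfl, rfl⟩ | ⟨rfl, rfl⟩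
          exacts [hR, hy', hz, hsymm _ _ hz, hz2, hsymm _ _ hz2]
        obtain ⟨g, h1, h2⟩ := htrans x y u v hR hRu
        refine ⟨g, ?_, by rw [Prod.mk.injEq]; exact ⟨h1, h2⟩⟩
        have : Finite (Subgroup.closure {x, y} : Set H) := by
          apply Set.Finite.subset (s := {1, x, y, x * y}) (Set.toFinite _)
          intro z hz
          simpa using (hmem z).1 hz
        have hu : u ∈ Subgroup.closure {x, y} := by
          rw [hmem]
          simp only [Set.mem_insert_iff, Set.mem_singleton_iff, Prod.mk.injEq] at h
          tauto
        have hv : v ∈ Subgroup.closure {x, y} := by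
          rw [hmem]
          simp only [Set.mem_insert_iff, Set.mem_singleton_iff, Prod.mk.injEq] at h
          tauto
        apply Subgroup.mem_normalizer_fintype
        intro n hn
        change MulAut.conj g n ∈ _
        rcases (hmem n).1 hn with rfl | rfl | rfl | rfl
        · rw [map_one]; exact one_mem _
        · rw [h1]; exact hu
        · rw [h2]; exact hv
        · rw [map_mul, h1, h2]; exact mul_mem hu hv
  have e3 : ({(x, y), (y, x), (x, x * y), (x * y, x), (y, x * y), (x * y, y)} :
      Set (H × H)).ncard = 6 := by
    classical
    have : ({(x, y), (y, x), (x, x * y), (x * y, x), (y, x * y), (x * y, y)} : Set (H × H)) =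
        (({(x, y), (y, x), (x, x * y), (x * y, x), (y, x * y), (x * y, y)} :
          Finset (H × H)) : Set (H × H)) := by simp
    rw [this, Set.ncard_coe_finset]
    rw [Finset.card_insert_of_notMem, Finset.card_insert_of_notMem, Finset.card_insert_of_notMem,
      Finset.card_insert_of_notMem, Finset.card_insert_of_notMem, Finset.card_singleton] <;>
      simp [hxy, hxy.symm, hxz, hxz.symm, hyz, hyz.symm]
  have := Subgroup.relIndex_mul_index hC1
  rw [← Subgroup.relIndex_mul_index hCN, e1, e2, e3] at this
  rw [mul_comm, ← this, mul_comm]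

end NormalizerIndex

/-! ### A computable copy of F₄ and its coordinate vectors -/

/-- A computable field with four elements `0`, `1`, `w`, `v`. -/
inductive Quart
  | z | u | w | v
  deriving DecidableEq

namespace Quart

instance : Fintype Quart := ⟨{z, u, w, v}, fun x => by cases x <;> decide⟩

/-- Addition. -/
def add : Quart → Quart → Quart
  | .z, b => b
  | u, z => u | u, u => z | u, w => v | u, v => w
  | w, z => w | w, u => v | w, w => z | w, v => u
  | v, z => v | v, u => w | v, w => u | v, v => z

/-- Multiplication. -/
def mul : Quart → Quart → Quart
  | z, _ => z
  | u, b => b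
  | w, z => z | w, u => w | w, w => v | w, v => u
  | v, z => z | v, u => v | v, w => u | v, v => w

/-- Inversion. -/
def inv : Quart → Quart
  | z => z | u => u | w => v | v => w

/-- Boolean equality. -/
def beq : Quart → Quart → Bool
  | z, z => true | u, u => true | w, w => true | v, v => true | _, _ => false

theorem beq_iff {a b : Quart} : a.beq b = true ↔ a = b := by
  revert a b; decide

instance : Zero Quart := ⟨z⟩
instance : One Quart := ⟨u⟩
instance : Add Quart := ⟨add⟩
instance : Mul Quart := ⟨mul⟩
instance : Neg Quart := ⟨id⟩
instance : Inv Quart := ⟨inv⟩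

instance : Field Quart where
  add_assoc := by decide
  zero_add := by decide
  add_zero := by decide
  add_comm := by decide
  left_distrib := by decide
  right_distrib := by decide
  zero_mul := by decide
  mul_zero := by decide
  mul_assoc := by decide
  one_mul := by decide
  mul_one := by decide
  mul_comm := by decide
  neg_add_cancel := by decide
  exists_pair_ne := ⟨z, u, by decide⟩
  mul_inv_cancel := by decide
  inv_zero := by decide
  nsmul := nsmulRec
  zsmul := zsmulRec
  nnqsmul := _
  nnqsmul_def := fun _ _ => rfl
  qsmul := _
  qsmul_def := fun _ _ => rfl

theorem card_eq : Nat.card Quart = Nat.card F4 := by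
  rw [GaloisField.card 2 2 two_ne_zero, Nat.card_eq_fintype_card]
  decide

/-- The isomorphism with the abstract field of order four. -/
noncomputable def toF4 : Quart ≃+* F4 :=
  letI : Fintype F4 := Fintype.ofFinite _
  FiniteField.ringEquivOfCardEq (by simpa only [Nat.card_eq_fintype_card] using card_eq)

theorem toF4_z : toF4 z = 0 := map_zero toF4
theorem toF4_u : toF4 u = 1 := map_one toF4
theorem toF4_add (a b : Quart) : toF4 (a.add b) = toF4 a + toF4 b := map_add toF4 a b
theorem toF4_mul (a b : Quart) : toF4 (a.mul b) = toF4 a * toF4 b := map_mul toF4 a b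
theorem toF4_inv (a : Quart) : toF4 a.inv = (toF4 a)⁻¹ := map_inv₀ toF4 a
theorem toF4_eq_zero {a : Quart} : toF4 a = 0 ↔ a = z := map_eq_zero toF4

end Quart

/-- Coordinate vectors of length three. -/
inductive QVec
  | mk (a b c : Quart)
  deriving DecidableEq

namespace QVec

/-- The dot product. -/
def dot : QVec → QVec → Quart
  | mk a b c, mk d e f => ((a.mul d).add (b.mul e)).add (c.mul f)

/-- The cross product. -/
def cross : QVec → QVec → QVec
  | mk a b c, mk d e f => mk ((b.mul f).add (c.mul e)) ((c.mul d).add (a.mul f))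
      ((a.mul e).add (b.mul d))

/-- Scalar multiplication. -/
def scale (s : Quart) : QVec → QVec
  | mk a b c => mk (s.mul a) (s.mul b) (s.mul c)

/-- Addition. -/
def add : QVec → QVec → QVec
  | mk a b c, mk d e f => mk (a.add d) (b.add e) (c.add f)

/-- The first nonzero coordinate. -/
def lead : QVec → Quart
  | mk .z .z a => a
  | mk .z a _ => a
  | mk a _ _ => a

/-- Boolean equality. -/
def beq : QVec → QVec → Bool
  | mk a b c, mk d e f => a.beq d && (b.beq e && c.beq f)

theorem beq_iff {a b : QVec} : a.beq b = true ↔ a = b := by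
  cases a; cases b
  simp [beq, Quart.beq_iff]

/-- The zero vector. -/
def zero : QVec := mk .z .z .z

theorem lead_eq_z {a : QVec} : lead a = .z ↔ a = zero := by
  rcases a with ⟨a, b, c⟩
  cases a <;> cases b <;> cases c <;> decide

theorem lead_scale (s : Quart) (a : QVec) : lead (scale s a) = s.mul (lead a) := by
  rcases a with ⟨a, b, c⟩
  cases s <;> cases a <;> cases b <;> cases c <;> rfl

/-- The list of all vectors. -/
def all : List QVec :=
  [Quart.z, .u, .w, .v].flatMap fun x => [Quart.z, .u, .w, .v].flatMap fun y =>
    [Quart.z, .u, .w, .v].map fun t => mk x y t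

theorem mem_all (a : QVec) : a ∈ all := by
  rcases a with ⟨a, b, c⟩
  simp only [all, List.mem_flatMap, List.mem_map]
  exact ⟨a, by cases a <;> simp, b, by cases b <;> simp, c, by cases c <;> simp, rfl⟩

theorem nodup_all : all.Nodup := by decide +kernel

open Quart

/-- The coordinate vector over the abstract field of order four. -/
noncomputable def toVec : QVec → Fin 3 → F4
  | mk a b c => ![toF4 a, toF4 b, toF4 c]

theorem toVec_injective : Function.Injective toVec := by
  rintro ⟨a, b, c⟩ ⟨d, e, f⟩ h
  have h0 := congrFun h 0
  have h1 := congrFun h 1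
  have h2 := congrFun h 2
  simp [toVec] at h0 h1 h2
  rw [h0, h1, h2]

theorem toVec_surjective : Function.Surjective toVec := by
  intro x
  refine ⟨mk (toF4.symm (x 0)) (toF4.symm (x 1)) (toF4.symm (x 2)), ?_⟩
  ext i
  fin_cases i <;> simp [toVec]

theorem toVec_zero : toVec zero = 0 := by
  ext i
  fin_cases i <;> simp [zero, toVec, toF4_z]

theorem toVec_eq_zero {a : QVec} : toVec a = 0 ↔ a = zero := by
  rw [← toVec_zero, toVec_injective.eq_iff]

theorem toVec_ne_zero {a : QVec} : toVec a ≠ 0 ↔ lead a ≠ .z := by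
  rw [Ne, Ne, toVec_eq_zero, lead_eq_z]

theorem toVec_add (a b : QVec) : toVec (add a b) = toVec a + toVec b := by
  rcases a with ⟨a₁, a₂, a₃⟩
  rcases b with ⟨b₁, b₂, b₃⟩
  simp [add, toVec, toF4_add]

theorem toVec_scale (s : Quart) (a : QVec) : toVec (scale s a) = toF4 s • toVec a := by
  rcases a with ⟨a, b, c⟩
  simp [scale, toVec, toF4_mul]

theorem toF4_dot (a b : QVec) : toF4 (dot a b) = toVec a ⬝ᵥ toVec b := by
  rcases a with ⟨a₁, a₂, a₃⟩
  rcases b with ⟨b₁, b₂, b₃⟩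
  simp [dot, toVec, toF4_mul, toF4_add, dotProduct, Fin.sum_univ_three]

instance : CharP F4 2 := by infer_instance

theorem toVec_cross (a b : QVec) : toVec (cross a b) = crossProduct (toVec a) (toVec b) := by
  rcases a with ⟨a₁, a₂, a₃⟩
  rcases b with ⟨b₁, b₂, b₃⟩
  rw [cross_apply]
  simp [cross, toVec, toF4_mul, toF4_add, CharTwo.sub_eq_add]

theorem dot_eq_z {a b : QVec} : dot a b = .z ↔ toVec a ⬝ᵥ toVec b = 0 := by
  rw [← toF4_dot, toF4_eq_zero]

theorem eq_of_toVec_eq_smul {a b : QVec} {c : F4} (h : toVec a = c • toVec b)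
    (ha : lead a = .u) (hb : lead b = .u) : a = b := by
  obtain ⟨s, rfl⟩ := toF4.surjective c
  rw [← toVec_scale] at h
  have h' := toVec_injective h
  have h2 := congrArg lead h'
  rw [lead_scale, ha, hb] at h2
  have hs : s = .u := by
    revert h2; cases s <;> decide
  rw [h', hs]
  cases b
  rfl

end QVec

/-! ### Labels of elations in normal form, and counting with them -/

/-- A pair of coordinate vectors, for the centre and the axis of an elation. -/
abbrev ElationLabel := QVec × QVec

namespace ElationLabel

open QVec Quart PlaneGroup

/-- The pair consists of orthogonal nonzero vectors, the first one in normal form. -/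
def valid : ElationLabel → Bool
  | (p, f) => (lead p).beq .u && (!((lead f).beq .z) && (dot p f).beq .z)

theorem valid_iff {p f : QVec} :
    valid (p, f) = true ↔ lead p = .u ∧ lead f ≠ .z ∧ dot p f = .z := by
  simp only [valid, Bool.and_eq_true, Quart.beq_iff, Bool.not_eq_true', ← Bool.not_eq_true]

/-- Rescaling such that the first vector is in normal form. -/
def norm : ElationLabel → ElationLabel
  | (p, f) => (scale (lead p).inv p, scale (lead p) f)

/-- The elation described by a label. -/
noncomputable def toElation (a : ElationLabel) : L34Ext := elation (toVec a.1) (toVec a.2)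

theorem toElation_norm {p f : QVec} (hp : lead p ≠ .z) :
    toElation (norm (p, f)) = toElation (p, f) := by
  have h : toF4 (lead p) ≠ 0 := by rwa [Ne, toF4_eq_zero]
  simp only [toElation, norm, toVec_scale, toF4_inv]
  rw [elation_smul_left (inv_ne_zero h), inv_smul_smul₀ h]

theorem valid_norm {p f : QVec} (hp : lead p ≠ .z) (hf : lead f ≠ .z) (h : dot p f = .z) :
    valid (norm (p, f)) = true := by
  rw [norm, valid_iff]
  refine ⟨?_, ?_, ?_⟩
  · rw [lead_scale]
    revert hp; cases lead p <;> decide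
  · rw [lead_scale]
    revert hp hf; cases lead p <;> cases lead f <;> decide
  · rw [dot_eq_z] at h ⊢
    rw [toVec_scale, toVec_scale, smul_dotProduct, dotProduct_smul, h]
    simp

theorem isElation_toElation {a : ElationLabel} (ha : valid a = true) :
    IsElation (toElation a) := by
  obtain ⟨p, f⟩ := a
  rw [valid_iff] at ha
  refine ⟨_, _, ?_, ?_, dot_eq_z.1 ha.2.2, rfl⟩
  · rw [toVec_ne_zero, ha.1]; decide
  · rw [toVec_ne_zero]; exact ha.2.1

theorem exists_label_of_isElation {x : L34Ext} (hx : IsElation x) :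
    ∃ a, valid a = true ∧ toElation a = x := by
  obtain ⟨p, f, hp, hf, h, rfl⟩ := hx
  obtain ⟨p, rfl⟩ := toVec_surjective p
  obtain ⟨f, rfl⟩ := toVec_surjective f
  rw [toVec_ne_zero] at hp hf
  exact ⟨norm (p, f), valid_norm hp hf (dot_eq_z.2 h), toElation_norm hp⟩

/-- The only freedom in `(p, f)` is an inverse pair of scalars, and the leading coefficient 1 of the
centre removes it. -/
theorem toElation_injOn {a b : ElationLabel} (ha : valid a = true) (hb : valid b = true)
    (h : toElation a = toElation b) : a = b := by
  obtain ⟨p, f⟩ := a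
  obtain ⟨q, g⟩ := b
  rw [valid_iff] at ha hb
  obtain ⟨c, hc, h1, h2⟩ := elation_injective (toVec_ne_zero.2 (by rw [ha.1]; decide))
    (toVec_ne_zero.2 ha.2.1) (dot_eq_z.1 ha.2.2) (dot_eq_z.1 hb.2.2) h
  have h3 := eq_of_toVec_eq_smul h1 hb.1 ha.1
  subst h3
  have hc1 : c = 1 := by
    have h4 : (1 - c) • toVec q = 0 := by rw [sub_smul, ← h1, one_smul, sub_self]
    rw [smul_eq_zero] at h4
    rcases h4 with h4 | h4
    · exact (sub_eq_zero.1 h4).symm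
    · rw [toVec_eq_zero, ← lead_eq_z, ha.1] at h4
      cases h4
  rw [hc1, one_smul] at h2
  rw [toVec_injective h2]

/-- The list of all valid labels. -/
def all : List ElationLabel := (QVec.all.product QVec.all).filter valid

theorem mem_all {a : ElationLabel} : a ∈ all ↔ valid a = true := by
  obtain ⟨p, f⟩ := a
  rw [all, List.mem_filter, List.pair_mem_product]
  simp [QVec.mem_all]

theorem nodup_all : all.Nodup := (QVec.nodup_all.product QVec.nodup_all).filter _

/-- This turns the size of a set of elations into the length of a list that the kernel can evaluate.
-/
theorem ncard_of_label_iff {X : Set L34Ext} {f : ElationLabel → Bool}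
    (hX : ∀ x ∈ X, IsElation x)
    (h : ∀ a, valid a = true → (toElation a ∈ X ↔ f a = true)) :
    X.ncard = (all.filter f).length := by
  have h1 : X = toElation '' ((⟨all.filter f, nodup_all.filter _⟩ : Finset ElationLabel) :
      Set ElationLabel) := by
    ext x
    constructor
    · intro hx
      obtain ⟨a, ha, rfl⟩ := exists_label_of_isElation (hX x hx)
      refine ⟨a, ?_, rfl⟩
      change a ∈ all.filter f
      rw [List.mem_filter, mem_all]
      exact ⟨ha, (h a ha).1 hx⟩
    · rintro ⟨a, ha, rfl⟩
      change a ∈ all.filter f at ha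
      rw [List.mem_filter, mem_all] at ha
      exact (h a ha.1).2 ha.2
  rw [h1, Set.InjOn.ncard_image, Set.ncard_coe_finset]
  · rfl
  · intro a ha b hb hab
    change a ∈ all.filter f at ha
    change b ∈ all.filter f at hb
    rw [List.mem_filter, mem_all] at ha hb
    exact toElation_injOn ha.1 hb.1 hab

/-- There are 21 centres, 5 axes through each of them and 3 nonzero multiples of each axis vector.
-/
theorem ncard_isElation : {x : L34Ext | IsElation x}.ncard = 315 := by
  rw [ncard_of_label_iff (X := {x : L34Ext | IsElation x}) (f := fun _ => true) (fun x hx => hx)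
    (fun a ha => by simpa using isElation_toElation ha)]
  decide +kernel

/-- The elations have the same centre and relative position `c`. -/
def centre (c : Quart) : ElationLabel → ElationLabel → Bool
  | (p, f), (q, g) => beq p q && beq (cross f g) (scale c p)

/-- The elations have the same axis and relative position `c`. -/
def axis (c : Quart) : ElationLabel → ElationLabel → Bool
  | (p, f), (q, g) =>
    beq g (scale ((lead g).mul (lead f).inv) f) &&
      beq (cross p (scale ((lead g).mul (lead f).inv) q)) (scale c f)

/-- The relative position is well defined over F₄ for this reason: passing from `(p, φ, ψ)` to `(k
p, k⁻¹ φ, k⁻¹ ψ)` divides the parameter by `k ^ 3`. -/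
theorem cube_eq_one {c : F4} (hc : c ≠ 0) : c ^ 3 = 1 := by
  obtain ⟨s, rfl⟩ := toF4.surjective c
  rw [← map_pow, ← map_one toF4, toF4.injective.eq_iff]
  have : s ≠ z := by rwa [Ne, ← toF4_eq_zero]
  revert this
  cases s <;> decide

theorem centreRel_toElation_iff {c : Quart} {a b : ElationLabel}
    (ha : valid a = true) (hb : valid b = true) :
    CentreRel (toF4 c) (toElation a) (toElation b) ↔ centre c a b = true := by
  obtain ⟨p, f⟩ := a
  obtain ⟨q, g⟩ := b
  rw [valid_iff] at ha hb
  have hp : toVec p ≠ 0 := toVec_ne_zero.2 (by rw [ha.1]; decide)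
  have hq : toVec q ≠ 0 := toVec_ne_zero.2 (by rw [hb.1]; decide)
  have hf := toVec_ne_zero.2 ha.2.1
  have hg := toVec_ne_zero.2 hb.2.1
  simp only [centre, Bool.and_eq_true, QVec.beq_iff]
  rw [← toVec_injective.eq_iff (b := scale c p), toVec_cross, toVec_scale]
  constructor
  · rintro ⟨r, φ, ψ, hr, h1, h2, h3, h4, h5⟩
    obtain ⟨k, hk, rfl, h8⟩ := elation_injective hp hf (dot_eq_z.1 ha.2.2) h1 h4
    obtain ⟨m, hm, h6, h9⟩ := elation_injective hq hg (dot_eq_z.1 hb.2.2) h2 h5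
    have hpq : p = q := by
      refine eq_of_toVec_eq_smul (c := k⁻¹ * m) ?_ ha.1 hb.1
      rw [mul_smul, ← h6, inv_smul_smul₀ hk]
    subst hpq
    have hkm : k = m := by
      have : (k - m) • toVec p = 0 := by rw [sub_smul, h6, sub_self]
      exact sub_eq_zero.1 ((smul_eq_zero.1 this).resolve_right hp)
    subst hkm
    refine ⟨rfl, ?_⟩
    rw [h8, h9, map_smul, map_smul, LinearMap.smul_apply, h3, smul_smul, smul_smul, smul_smul]
    congr 1
    linear_combination toF4 c * cube_eq_one hk
  · rintro ⟨rfl, h⟩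
    exact ⟨_, _, _, hp, dot_eq_z.1 ha.2.2, dot_eq_z.1 hb.2.2, h, rfl, rfl⟩

theorem lead_ratio {f g : QVec} {k : F4} (h : toVec g = k • toVec f)
    (hf : lead f ≠ .z) : toF4 ((lead g).mul (lead f).inv) = k := by
  obtain ⟨s, rfl⟩ := toF4.surjective k
  rw [← toVec_scale, toVec_injective.eq_iff] at h
  rw [h, lead_scale]
  congr 1
  revert hf
  cases s <;> cases lead f <;> decide

/-- Labels normalise the centre, so the axis vectors of elations with a common axis may differ by a
factor. If `g = l f`, the second elation is first rewritten with centre vector `l q` and axis vector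
`f`; then the cross product of the centres can be compared with `f`. -/
theorem axisRel_toElation_iff {c : Quart} {a b : ElationLabel}
    (ha : valid a = true) (hb : valid b = true) :
    AxisRel (toF4 c) (toElation a) (toElation b) ↔ axis c a b = true := by
  obtain ⟨p, f⟩ := a
  obtain ⟨q, g⟩ := b
  rw [valid_iff] at ha hb
  have hp : toVec p ≠ 0 := toVec_ne_zero.2 (by rw [ha.1]; decide)
  have hq : toVec q ≠ 0 := toVec_ne_zero.2 (by rw [hb.1]; decide)
  have hf := toVec_ne_zero.2 ha.2.1
  have hg := toVec_ne_zero.2 hb.2.1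
  simp only [axis, Bool.and_eq_true, QVec.beq_iff]
  rw [← toVec_injective.eq_iff (b := scale c f), ← toVec_injective.eq_iff (a := g), toVec_cross,
    toVec_scale, toVec_scale, toVec_scale]
  constructor
  · rintro ⟨r, t, φ, hφ, h1, h2, h3, h4, h5⟩
    obtain ⟨k, hk, rfl, h8⟩ := elation_injective hp hf (dot_eq_z.1 ha.2.2) h1 h4
    obtain ⟨m, hm, rfl, h9⟩ := elation_injective hq hg (dot_eq_z.1 hb.2.2) h2 h5
    have h6 : toVec g = (m * k⁻¹) • toVec f := by
      rw [mul_smul, h8, inv_smul_smul₀ hk, h9]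
    rw [lead_ratio h6 ha.2.1]
    refine ⟨h6, ?_⟩
    rw [map_smul, map_smul, LinearMap.smul_apply] at h3
    rw [map_smul, h8, mul_comm, mul_smul, smul_comm (toF4 c), ← h3, smul_smul, smul_smul, smul_smul]
    congr 1
    field_simp
    linear_combination -cube_eq_one hk
  · rintro ⟨h, h'⟩
    set l := toF4 ((lead g).mul (lead f).inv) with hl
    have hl0 : l ≠ 0 := by
      intro h0
      rw [h0, zero_smul] at h
      exact hg h
    refine ⟨toVec p, l • toVec q, toVec f, hf, dot_eq_z.1 ha.2.2, ?_, h', rfl, ?_⟩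
    · have := dot_eq_z.1 hb.2.2
      rw [h, dotProduct_smul, smul_eq_zero] at this
      rw [smul_dotProduct, this.resolve_left hl0, smul_zero]
    · rw [elation_smul_left hl0, ← h]
      rfl

end ElationLabel

/-! ### The central involutions are the elations -/

namespace PlaneGroup

open Matrix ElationLabel QVec

section

variable {K : Type*} [Field K]

theorem projPerm_eq_of_smul {A B : SpecialLinearGroup (Fin 3) K} {c : K}
    (h : A.1 = c • B.1) (τ : K ≃+* K) : projPerm A τ = projPerm B τ := by
  ext x
  induction x using Projectivization.ind with
  | h x hx =>
    change Projectivization.mk K (semilin A τ x) _ = Projectivization.mk K (semilin B τ x) _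
    rw [Projectivization.mk_eq_mk_iff']
    exact ⟨c, by rw [semilin, semilin, h, smul_mulVec]⟩

theorem collineation_eq_of_smul {A B : SpecialLinearGroup (Fin 3) K} {c : K}
    (h : A.1 = c • B.1) (τ : K ≃+* K) : collineation A τ = collineation B τ := by
  have h2 : (contra A).1 = (c ^ 2) • (contra B).1 := by
    have hA : (contra A).1 = (adjugate A.1)ᵀ := rfl
    have hB : (contra B).1 = (adjugate B.1)ᵀ := rfl
    rw [hA, hB, h, adjugate_smul, transpose_smul]
    rfl
  rw [collineation, collineation, projPerm_eq_of_smul h,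
    projPerm_eq_of_smul h2]

/-- The lower unitriangular matrix with the given entries. -/
def unitriangular (x y t : K) : SpecialLinearGroup (Fin 3) K :=
  ⟨!![1, 0, 0; x, 1, 0; t, y, 1], by simp [det_fin_three]⟩

theorem unitriangular_mul (x y t x' y' t' : K) :
    unitriangular x y t * unitriangular x' y' t' =
      unitriangular (x + x') (y + y') (t + t' + y * x') := by
  apply sl_ext
  rw [sl_mul]
  ext i j
  fin_cases i <;> fin_cases j <;>
    (simp [unitriangular, Matrix.mul_apply, Fin.sum_univ_three]; try ring)

theorem unitriangular_zero : unitriangular (0 : K) 0 0 = 1 := by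
  apply sl_ext
  rw [sl_one]
  ext i j
  fin_cases i <;> fin_cases j <;> simp [unitriangular]

/-- The collineations with a lower unitriangular matrix. -/
def unitriangularSubgroup (K : Type*) [Field K] : Subgroup (collineationsAndCorrelations K) where
  carrier := {g | ∃ x y t, g = col (unitriangular x y t) (RingEquiv.refl K)}
  one_mem' := ⟨0, 0, 0, by
    rw [unitriangular_zero]; exact Subtype.ext collineation_one.symm⟩
  mul_mem' := by
    rintro _ _ ⟨x, y, t, rfl⟩ ⟨x', y', t', rfl⟩
    exact ⟨_, _, _, by rw [col_mul_col, unitriangular_mul]⟩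
  inv_mem' := by
    rintro _ ⟨x, y, t, rfl⟩
    refine ⟨-x, -y, x * y - t, ?_⟩
    rw [inv_eq_iff_mul_eq_one, col_mul_col, unitriangular_mul]
    have : t + (x * y - t) + y * -x = 0 := by ring
    rw [add_neg_cancel, add_neg_cancel, this, unitriangular_zero]
    exact Subtype.ext collineation_one

/-- In characteristic 2 squaring leaves only the corner entry, and squaring again removes it. -/
theorem isPGroup_unitriangularSubgroup [CharP K 2] : IsPGroup 2 (unitriangularSubgroup K) := by
  rintro ⟨_, x, y, t, rfl⟩
  refine ⟨2, Subtype.ext ?_⟩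
  change col _ _ ^ 4 = 1
  rw [show 4 = 2 * 2 from rfl, pow_mul, sq, sq, col_mul_col, col_mul_col, unitriangular_mul,
    unitriangular_mul]
  simp only [CharTwo.add_self_eq_zero, mul_zero, unitriangular_zero]
  exact Subtype.ext collineation_one

theorem elation_mem_unitriangularSubgroup_left (a b : K) :
    elation ![0, 0, 1] ![a, b, 0] ∈ unitriangularSubgroup K := by
  refine ⟨0, b, a, ?_⟩
  change col _ _ = _
  congr 1
  apply sl_ext
  rw [coe_elationMatrix (by simp)]
  ext i j
  fin_cases i <;> fin_cases j <;> simp [unitriangular]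

theorem elation_mem_unitriangularSubgroup_right (b c : K) :
    elation ![0, b, c] ![1, 0, 0] ∈ unitriangularSubgroup K := by
  refine ⟨b, 0, c, ?_⟩
  change col _ _ = _
  congr 1
  apply sl_ext
  rw [coe_elationMatrix (by simp)]
  ext i j
  fin_cases i <;> fin_cases j <;> simp [unitriangular]

/-- An element that centralizes the unitriangular group is trivial or an elation. -/
theorem eq_one_or_isElation_of_centralizes [CharP K 2] {g : collineationsAndCorrelations K}
    (hg : ∀ u ∈ unitriangularSubgroup K, Commute g u) : g = 1 ∨ IsElation g := by
  have hconj : ∀ u ∈ unitriangularSubgroup K, MulAut.conj g u = u := fun u hu => by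
    rw [MulAut.conj_apply, (hg u hu).eq, mul_inv_cancel_right]
  have hv3 : (![0, 0, 1] : Fin 3 → K) ≠ 0 := fun h => by simpa using congrFun h 2
  have hv2 : (![0, 1, 0] : Fin 3 → K) ≠ 0 := fun h => by simpa using congrFun h 1
  have hv1 : (![1, 0, 0] : Fin 3 → K) ≠ 0 := fun h => by simpa using congrFun h 0
  obtain ⟨A, τ, rfl | rfl⟩ := eq_col_or_cor g
  -- The unitriangular group contains all elations with centre `(0, 0, 1)` and all elations with
  -- axis `(1, 0, 0)`. A collineation that commutes with them fixes every line through this point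
  -- and every point on this line; comparing the scalars determines its matrix up to one entry.
  · have hl : ∀ a b : K, (![a, b, 0] : Fin 3 → K) ≠ 0 → ∃ c : K, c ≠ 0 ∧
        semilin A τ ![0, 0, 1] = c • ![0, 0, 1] ∧
        ![a, b, 0] = c • semilin (contra A) τ ![a, b, 0] := by
      intro a b hab
      have h := hconj _ (elation_mem_unitriangularSubgroup_left a b)
      rw [conj_col_elation] at h
      exact elation_injective hv3 hab (by simp)
        (by rw [dotProduct_semilin_contra]; simp) h.symm
    have hr : ∀ b c : K, (![0, b, c] : Fin 3 → K) ≠ 0 → ∃ d : K, d ≠ 0 ∧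
        semilin A τ ![0, b, c] = d • ![0, b, c] ∧
        ![1, 0, 0] = d • semilin (contra A) τ ![1, 0, 0] := by
      intro b c hbc
      have h := hconj _ (elation_mem_unitriangularSubgroup_right b c)
      rw [conj_col_elation] at h
      exact elation_injective hbc hv1 (by simp)
        (by rw [dotProduct_semilin_contra]; simp) h.symm
    obtain ⟨d, hd0, hd, hd'⟩ := hr 1 0 hv2
    have hr' : ∀ b c : K, (![0, b, c] : Fin 3 → K) ≠ 0 →
        semilin A τ ![0, b, c] = d • ![0, b, c] := by
      intro b c hbc
      obtain ⟨d', hd0', h1, h2⟩ := hr b c hbc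
      have h3 : (d - d') • semilin (contra A) τ ![1, 0, 0] = 0 := by
        rw [sub_smul, ← hd', ← h2, sub_self]
      rw [smul_eq_zero, sub_eq_zero] at h3
      rw [h1, h3.resolve_right (semilin_ne_zero _ _ hv1)]
    have h3 := hr' 0 1 hv3
    have hA1 : A.1 0 1 = 0 ∧ A.1 1 1 = d ∧ A.1 2 1 = 0 := by
      refine ⟨?_, ?_, ?_⟩
      · simpa [semilin, mulVec, dotProduct, Fin.sum_univ_three] using congrFun hd 0
      · simpa [semilin, mulVec, dotProduct, Fin.sum_univ_three] using congrFun hd 1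
      · simpa [semilin, mulVec, dotProduct, Fin.sum_univ_three] using congrFun hd 2
    have hA2 : A.1 0 2 = 0 ∧ A.1 1 2 = 0 ∧ A.1 2 2 = d := by
      refine ⟨?_, ?_, ?_⟩
      · simpa [semilin, mulVec, dotProduct, Fin.sum_univ_three] using congrFun h3 0
      · simpa [semilin, mulVec, dotProduct, Fin.sum_univ_three] using congrFun h3 1
      · simpa [semilin, mulVec, dotProduct, Fin.sum_univ_three] using congrFun h3 2
    -- The vectors `(0, 1, t)` are all multiplied by the same `d`, so the last coordinate gives `τ t
    -- = t`.
    have hτ : τ = RingEquiv.refl K := by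
      ext t
      have h4 := hr' 1 t (fun h => by simpa using congrFun h 1)
      have h5 := congrFun h4 2
      simp [semilin, mulVec, dotProduct, Fin.sum_univ_three, hA1, hA2] at h5
      exact h5.resolve_right hd0
    subst hτ
    have hrow : ∀ a b : K, (![a, b, 0] : Fin 3 → K) ≠ 0 →
        A.1ᵀ.mulVec ![a, b, 0] = d • ![a, b, 0] := by
      intro a b hab
      obtain ⟨c, hc0, h1, h2⟩ := hl a b hab
      have hcd : c = d := by
        rw [h3] at h1
        simpa using (congrFun h1 2).symm
      rw [hcd] at h2
      nth_rw 1 [h2]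
      rw [mulVec_smul]
      congr 1
      change A.1ᵀ.mulVec ((contra A).1.mulVec _) = _
      have h : (contra A).1 = (A⁻¹).1ᵀ := rfl
      rw [mulVec_mulVec, h, ← transpose_mul, sl_inv_mul, transpose_one, one_mulVec]
      rfl
    have hR1 := hrow 1 0 hv1
    have hR2 := hrow 0 1 hv2
    have hA3 : A.1 0 0 = d := by
      simpa [mulVec, dotProduct, Fin.sum_univ_three] using congrFun hR1 0
    have hA4 : A.1 1 0 = 0 := by
      simpa [mulVec, dotProduct, Fin.sum_univ_three] using congrFun hR2 0
    have key : col A (RingEquiv.refl K) = elation ((A.1 2 0 / d) • ![0, 0, 1]) ![1, 0, 0] := by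
      apply Subtype.ext
      refine collineation_eq_of_smul (c := d) ?_ _
      rw [coe_elationMatrix (by simp)]
      ext i j
      fin_cases i <;> fin_cases j <;>
        simp [hA1, hA2, hA3, hA4, mul_div_cancel₀, hd0]
    rw [key]
    by_cases ht : A.1 2 0 / d = 0
    · left; rw [ht, zero_smul, elation_zero_left]
    · right
      exact ⟨_, _, smul_ne_zero ht hv3, hv1, by simp, rfl⟩
  -- After conjugation by a correlation, all elations with centre `(0, 0, 1)` have the same axis,
  -- the image of this point. They cannot all be fixed, since their axes differ.
  · exfalso
    have hl : ∀ a b : K, (![a, b, 0] : Fin 3 → K) ≠ 0 → ∃ c : K, c ≠ 0 ∧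
        ![a, b, 0] = c • semilin A τ ![0, 0, 1] := by
      intro a b hab
      have h := hconj _ (elation_mem_unitriangularSubgroup_left a b)
      rw [conj_cor_elation] at h
      obtain ⟨c, hc, -, h2⟩ := elation_injective hv3 hab (by simp)
        (by rw [dotProduct_comm, dotProduct_semilin_contra]; simp) h.symm
      exact ⟨c, hc, h2⟩
    obtain ⟨c, hc, h1⟩ := hl 1 0 hv1
    obtain ⟨c', hc', h2⟩ := hl 0 1 hv2
    have h3 := congrFun h1 0
    have h4 := congrFun h2 0
    simp at h3 h4
    rcases h4 with h4 | h4
    · exact hc' h4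
    · rw [h4, mul_zero] at h3
      exact one_ne_zero h3

theorem IsElation.conj [CharP K 2] {x : collineationsAndCorrelations K} (hx : IsElation x)
    (g : collineationsAndCorrelations K) : IsElation (MulAut.conj g x) := by
  obtain ⟨p, φ, hp, hφ, h, rfl⟩ := hx
  obtain ⟨A, τ, rfl | rfl⟩ := eq_col_or_cor g
  · exact ⟨_, _, semilin_ne_zero _ _ hp, semilin_ne_zero _ _ hφ,
      by rw [dotProduct_semilin_contra, h, map_zero], conj_col_elation ..⟩
  · exact ⟨_, _, semilin_ne_zero _ _ hφ, semilin_ne_zero _ _ hp,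
      by rw [dotProduct_comm, dotProduct_semilin_contra, h, map_zero], conj_cor_elation ..⟩

theorem IsElation.ne_one [CharP K 2] {x : collineationsAndCorrelations K} (hx : IsElation x) :
    x ≠ 1 := by
  obtain ⟨p, φ, hp, hφ, h, rfl⟩ := hx
  exact elation_ne_one hp hφ h

theorem IsElation.mul_self [CharP K 2] {x : collineationsAndCorrelations K} (hx : IsElation x) :
    x * x = 1 := by
  obtain ⟨p, φ, hp, hφ, h, rfl⟩ := hx
  exact elation_mul_self h

theorem IsElation.orderOf [CharP K 2] {x : collineationsAndCorrelations K} (hx : IsElation x) :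
    orderOf x = 2 :=
  orderOf_eq_prime (by rw [sq, hx.mul_self]) hx.ne_one

theorem exists_cross_eq {p φ : Fin 3 → K} (hφ : φ ≠ 0) (h : p ⬝ᵥ φ = 0) :
    ∃ ψ : Fin 3 → K, p ⬝ᵥ ψ = 0 ∧ crossProduct φ ψ = p := by
  obtain ⟨i, hi⟩ := Function.ne_iff.1 hφ
  simp only [Pi.zero_apply] at hi
  -- By the expansion of the triple cross product, `φ × (p × eᵢ) = φᵢ p - (φ · p) eᵢ`, and the last
  -- term vanishes.
  refine ⟨(φ i)⁻¹ • crossProduct p (Pi.single i 1), ?_, ?_⟩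
  · rw [dotProduct_smul, dot_self_cross, smul_zero]
  · simp [dotProduct, Fin.sum_univ_three] at h
    rw [map_smul]
    ext k
    simp only [Pi.smul_apply, smul_eq_mul]
    rw [inv_mul_eq_iff_eq_mul₀ hi]
    fin_cases i <;> fin_cases k <;> simp [cross_apply] <;> grind

/-- The elation with centre `(0, 0, 1)` and axis `(1, 0, 0)`. -/
noncomputable def baseElation (K : Type*) [Field K] : collineationsAndCorrelations K :=
  elation ![0, 0, 1] ![1, 0, 0]

theorem IsElation.exists_conj_eq_base {x : collineationsAndCorrelations K} (hx : IsElation x) :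
    ∃ g, MulAut.conj g x = baseElation K := by
  obtain ⟨p, φ, hp, hφ, h, rfl⟩ := hx
  obtain ⟨ψ, -, h2⟩ := exists_cross_eq hφ h
  obtain ⟨A, h3, h4, -⟩ := exists_standard one_ne_zero hp (by rw [h2, one_smul])
  refine ⟨col A (RingEquiv.refl K), ?_⟩
  rw [conj_col_elation, h3, h4, inv_one]
  rfl

theorem IsElation.exists_conj_eq {x y : collineationsAndCorrelations K} (hx : IsElation x)
    (hy : IsElation y) : ∃ g, MulAut.conj g x = y := by
  obtain ⟨g, hg⟩ := hx.exists_conj_eq_base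
  obtain ⟨h, hh⟩ := hy.exists_conj_eq_base
  refine ⟨h⁻¹ * g, ?_⟩
  rw [map_mul, MulAut.mul_apply, hg, ← hh, map_inv, MulAut.inv_apply_self]

end

instance : Finite (PG2 F4) := by unfold PG2; infer_instance

theorem index_centralizer_of_isElation {x : L34Ext} (hx : IsElation x) :
    (Subgroup.centralizer {x}).index = 315 := by
  rw [← ncard_isElation, ← Subgroup.relIndex_top_right]
  apply relIndex_eq_ncard_of_image (fun g => MulAut.conj g x)
  · intro g _ h _
    rw [Subgroup.mem_centralizer_singleton_iff, MulAut.conj_apply, MulAut.conj_apply]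
    constructor
    · intro h1
      simpa [mul_assoc] using congrArg (fun t => g⁻¹ * t * h) h1.symm
    · intro h1
      simpa [mul_assoc] using congrArg (fun t => g * t * h⁻¹) h1.symm
  · ext y
    constructor
    · rintro ⟨g, -, rfl⟩
      exact hx.conj g
    · intro hy
      obtain ⟨g, hg⟩ := hx.exists_conj_eq hy
      exact ⟨g, trivial, hg⟩

open Pointwise in
theorem mem_centralizer_conj {G : Type*} [Group G] {x : G} {H : Subgroup G}
    (hx : x ∈ Subgroup.centralizer (H : Set G)) (g : G) :
    MulAut.conj g x ∈ Subgroup.centralizer ((MulAut.conj g • H : Subgroup G) : Set G) := by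
  rw [Subgroup.mem_centralizer_iff] at hx ⊢
  rintro _ ⟨h, hh, rfl⟩
  have := hx h hh
  change MulAut.conj g h * MulAut.conj g x = MulAut.conj g x * MulAut.conj g h
  rw [← map_mul, this, map_mul]

open Pointwise in
-- A Sylow 2-subgroup acts by conjugation on the 315 elations. As 315 is odd, it fixes one of them,
-- which means that it centralizes it. Conjugating the Sylow subgroup then serves every other
-- elation.
theorem IsElation.isCentralInvolution {x : L34Ext} (hx : IsElation x) :
    IsCentralInvolution x := by
  refine ⟨hx.orderOf, ?_⟩
  obtain ⟨H⟩ : Nonempty (Sylow 2 L34Ext) := inferInstance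
  let _ : MulAction H {x : L34Ext // IsElation x} :=
    { smul := fun h x => ⟨MulAut.conj h.1 x.1, x.2.conj _⟩
      one_smul := fun x => Subtype.ext (by change MulAut.conj 1 x.1 = _; simp)
      mul_smul := fun g h x => Subtype.ext (by
        change MulAut.conj (g.1 * h.1) x.1 = MulAut.conj g.1 (MulAut.conj h.1 x.1)
        rw [map_mul, MulAut.mul_apply]) }
  obtain ⟨y, hy⟩ := H.isPGroup'.nonempty_fixed_point_of_prime_not_dvd_card
    {x : L34Ext // IsElation x} (by
      have : Nat.card {x : L34Ext // IsElation x} = 315 := ncard_isElation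
      rw [this]; norm_num)
  have hyH : y.1 ∈ Subgroup.centralizer ((H : Subgroup L34Ext) : Set L34Ext) := by
    rw [Subgroup.mem_centralizer_iff]
    intro h hh
    have : MulAut.conj h y.1 = y.1 := congrArg Subtype.val (hy ⟨h, hh⟩)
    rwa [MulAut.conj_apply, mul_inv_eq_iff_eq_mul] at this
  obtain ⟨g, hg⟩ := y.2.exists_conj_eq hx
  refine ⟨g • H, ?_⟩
  rw [← hg]
  exact mem_centralizer_conj hyH g

open Pointwise in
-- Sylow subgroups are conjugate, so the centralized one may be assumed to contain the unitriangular
-- group.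
theorem isElation_of_isCentralInvolution {x : L34Ext} (hx : IsCentralInvolution x) :
    IsElation x := by
  obtain ⟨hx2, H, hH⟩ := hx
  obtain ⟨H', hH'⟩ := (isPGroup_unitriangularSubgroup (K := F4)).exists_le_sylow
  obtain ⟨g, rfl⟩ := MulAction.exists_smul_eq L34Ext H H'
  have h1 := mem_centralizer_conj hH g
  rw [Subgroup.mem_centralizer_iff] at h1
  have h2 : MulAut.conj g x = 1 ∨ IsElation (MulAut.conj g x) :=
    eq_one_or_isElation_of_centralizes fun u hu => (h1 u (hH' hu)).symm
  rcases h2 with h2 | h2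
  · rw [map_eq_one_iff _ (MulAut.conj g).injective] at h2
    rw [h2, orderOf_one] at hx2
    omega
  · have := h2.conj g⁻¹
    rwa [map_inv, MulAut.inv_apply_self] at this

theorem isCentralInvolution_iff {x : L34Ext} : IsCentralInvolution x ↔ IsElation x :=
  ⟨isElation_of_isCentralInvolution, IsElation.isCentralInvolution⟩

end PlaneGroup

/-! ### The three orbits of commuting pairs and their normalizer indices -/

namespace PlaneGroup

open Matrix ElationLabel QVec

section

variable {K : Type*} [Field K]

theorem CentreRel.isElation {c : K} {x y : collineationsAndCorrelations K} (hc : c ≠ 0)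
    (h : CentreRel c x y) : IsElation x ∧ IsElation y := by
  obtain ⟨p, φ, ψ, hp, h1, h2, h3, rfl, rfl⟩ := h
  have h4 : crossProduct φ ψ ≠ 0 := by rw [h3]; exact smul_ne_zero hc hp
  refine ⟨⟨p, φ, hp, ?_, h1, rfl⟩, ⟨p, ψ, hp, ?_, h2, rfl⟩⟩
  · rintro rfl; simp at h4
  · rintro rfl; simp at h4

theorem AxisRel.isElation {c : K} {x y : collineationsAndCorrelations K} (hc : c ≠ 0)
    (h : AxisRel c x y) : IsElation x ∧ IsElation y := by
  obtain ⟨p, q, φ, hφ, h1, h2, h3, rfl, rfl⟩ := h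
  have h4 : crossProduct p q ≠ 0 := by rw [h3]; exact smul_ne_zero hc hφ
  refine ⟨⟨p, φ, ?_, hφ, h1, rfl⟩, ⟨q, φ, ?_, hφ, h2, rfl⟩⟩
  · rintro rfl; simp at h4
  · rintro rfl; simp at h4

theorem FlagRel.isElation {c : K} {x y : collineationsAndCorrelations K} (hc : c ≠ 0)
    (h : FlagRel c x y) : IsElation x ∧ IsElation y := by
  obtain ⟨p, φ, hp, hφ, h1, rfl, rfl⟩ := h
  exact ⟨⟨p, φ, hp, hφ, h1, rfl⟩, ⟨p, c • φ, hp, smul_ne_zero hc hφ, by simp [h1], rfl⟩⟩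

theorem CentreRel.commute {c : K} {x y : collineationsAndCorrelations K}
    (h : CentreRel c x y) : Commute x y := by
  obtain ⟨p, φ, ψ, hp, h1, h2, h3, rfl, rfl⟩ := h
  rw [commute_iff_eq, elation_mul_right h1 h2, elation_mul_right h2 h1, add_comm]

theorem AxisRel.commute {c : K} {x y : collineationsAndCorrelations K}
    (h : AxisRel c x y) : Commute x y := by
  obtain ⟨p, φ, ψ, hp, h1, h2, h3, rfl, rfl⟩ := h
  rw [commute_iff_eq, elation_mul_left h1 h2, elation_mul_left h2 h1, add_comm]

theorem FlagRel.commute {c : K} {x y : collineationsAndCorrelations K}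
    (h : FlagRel c x y) : Commute x y := by
  obtain ⟨p, φ, hp, hφ, h1, rfl, rfl⟩ := h
  have h2 : p ⬝ᵥ (c • φ) = 0 := by simp [h1]
  rw [commute_iff_eq, elation_mul_right h1 h2, elation_mul_right h2 h1, add_comm]

end

/-- Distinct elations with the same centre and the same axis. -/
def SpreadRel (x y : L34Ext) : Prop := ∃ c : F4, c ≠ 0 ∧ c ≠ 1 ∧ FlagRel c x y

/-- Elations with either the same centre or the same axis, in relative position `1`. -/
def LineRel (x y : L34Ext) : Prop := CentreRel 1 x y ∨ AxisRel 1 x y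

/-- Elations with either the same centre or the same axis, in relative position different
from `1`. -/
def SkewRel (x y : L34Ext) : Prop :=
  ∃ c : F4, c ≠ 0 ∧ c ≠ 1 ∧ (CentreRel c x y ∨ AxisRel c x y)

/-- A conjugation-invariant relation between commuting elations, whose related pairs are all
conjugate, and that relates any two elements of a triple `x, y, xy` if it relates `x` and `y`. -/
structure IsOrbital (R : L34Ext → L34Ext → Prop) : Prop where
  conj : ∀ g x y, R x y → R (MulAut.conj g x) (MulAut.conj g y)
  trans : ∀ x y x' y', R x y → R x' y' → ∃ g, MulAut.conj g x = x' ∧ MulAut.conj g y = y'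
  symm : ∀ x y, R x y → R y x
  mul : ∀ x y, R x y → R x (x * y)
  elation : ∀ x y, R x y → IsElation x ∧ IsElation y
  commute : ∀ x y, R x y → Commute x y

theorem IsOrbital.ne {R : L34Ext → L34Ext → Prop} (hR : IsOrbital R) {x y : L34Ext}
    (h : R x y) : x ≠ y := by
  rintro rfl
  have h1 := hR.mul x x h
  rw [(hR.elation x x h).1.mul_self] at h1
  exact (hR.elation _ _ h1).2.ne_one rfl

theorem IsOrbital.index_mul_six {R : L34Ext → L34Ext → Prop} (hR : IsOrbital R)
    {x y : L34Ext} (h : R x y) :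
    (Subgroup.normalizer (Subgroup.closure {x, y} : Set L34Ext)).index * 6 =
      315 * {z | R (baseElation F4) z}.ncard := by
  obtain ⟨hx, hy⟩ := hR.elation x y h
  rw [index_normalizer_mul_six R hR.conj hR.trans hR.symm hR.mul h hx.mul_self hy.mul_self
    (hR.commute x y h) (hR.ne h) hx.ne_one hy.ne_one, index_centralizer_of_isElation hx]
  obtain ⟨g, hg⟩ := hx.exists_conj_eq_base
  congr 1
  rw [← Set.ncard_image_of_injective _ (MulAut.conj g).injective]
  congr 1
  ext z
  constructor
  · rintro ⟨z, hz, rfl⟩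
    have := hR.conj g _ _ hz
    rwa [hg] at this
  · intro hz
    have := hR.conj g⁻¹ _ _ hz
    rw [← hg] at this
    simp only [map_inv, MulAut.inv_apply_self] at this
    exact ⟨_, this, MulAut.apply_inv_self _ _ _⟩

/-- The Frobenius map interchanges the two elements outside the prime field. It merges the
parameters different from 0 and 1 into a single orbit. -/
theorem exists_ringEquiv {c d : F4} (hc : c ≠ 0) (hc1 : c ≠ 1) (hd : d ≠ 0) (hd1 : d ≠ 1) :
    ∃ τ : F4 ≃+* F4, τ c = d := by
  have h : d = c ∨ d = c ^ 2 := by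
    obtain ⟨c, rfl⟩ := Quart.toF4.surjective c
    obtain ⟨d, rfl⟩ := Quart.toF4.surjective d
    rw [← map_pow, Quart.toF4.injective.eq_iff, Quart.toF4.injective.eq_iff]
    rw [Ne, Quart.toF4_eq_zero] at hc hd
    rw [Ne, ← Quart.toF4_u, Quart.toF4.injective.eq_iff] at hc1 hd1
    revert hc hd hc1 hd1
    cases c <;> cases d <;> decide
  rcases h with rfl | rfl
  · exact ⟨RingEquiv.refl _, rfl⟩
  · exact ⟨frobeniusEquiv F4 2, rfl⟩

theorem isOrbital_of_exists_conj {R : L34Ext → L34Ext → Prop} {x₀ y₀ : L34Ext}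
    (conj : ∀ g x y, R x y → R (MulAut.conj g x) (MulAut.conj g y))
    (std : ∀ x y, R x y → ∃ g, MulAut.conj g x = x₀ ∧ MulAut.conj g y = y₀)
    (symm : ∀ x y, R x y → R y x) (mul : ∀ x y, R x y → R x (x * y))
    (elation : ∀ x y, R x y → IsElation x) (commute : ∀ x y, R x y → Commute x y) :
    IsOrbital R where
  conj := conj
  trans x y x' y' h h' := by
    obtain ⟨g, h1, h2⟩ := std x y h
    obtain ⟨g', h3, h4⟩ := std x' y' h'
    refine ⟨g'⁻¹ * g, ?_, ?_⟩
    · rw [map_mul, MulAut.mul_apply, h1, ← h3, map_inv, MulAut.inv_apply_self]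
    · rw [map_mul, MulAut.mul_apply, h2, ← h4, map_inv, MulAut.inv_apply_self]
  symm := symm
  mul := mul
  elation x y h := ⟨elation x y h, elation y x (symm x y h)⟩
  commute := commute

/-- The composition of two conjugations. -/
theorem exists_conj_of_conj {G : Type*} [Group G] {x y x₀ y₀ : G} (h : G)
    (H : ∃ g, MulAut.conj g (MulAut.conj h x) = x₀ ∧ MulAut.conj g (MulAut.conj h y) = y₀) :
    ∃ g, MulAut.conj g x = x₀ ∧ MulAut.conj g y = y₀ := by
  obtain ⟨g, h1, h2⟩ := H
  exact ⟨g * h, by rw [map_mul, MulAut.mul_apply, h1], by rw [map_mul, MulAut.mul_apply, h2]⟩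

theorem CentreRel.exists_conj {c : F4} (hc : c ≠ 0) {x y : L34Ext} (h : CentreRel c x y) :
    ∃ g, MulAut.conj g x = elation ![0, 0, c⁻¹] ![1, 0, 0] ∧
      MulAut.conj g y = elation ![0, 0, c⁻¹] ![0, 1, 0] := by
  obtain ⟨p, φ, ψ, hp, h1, h2, h3, rfl, rfl⟩ := h
  obtain ⟨A, hA, h4, h5⟩ := exists_standard hc hp h3
  refine ⟨col A (RingEquiv.refl F4), ?_, ?_⟩
  · rw [conj_col_elation, hA, h4]
  · rw [conj_col_elation, hA, h5]

/-- A correlation turns a common axis into a common centre, so both kinds of pairs share one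
standard form and belong to one orbit. -/
theorem AxisRel.exists_conj {c : F4} (hc : c ≠ 0) {x y : L34Ext} (h : AxisRel c x y) :
    ∃ g, MulAut.conj g x = elation ![0, 0, c⁻¹] ![1, 0, 0] ∧
      MulAut.conj g y = elation ![0, 0, c⁻¹] ![0, 1, 0] :=
  exists_conj_of_conj _ (CentreRel.exists_conj hc (h.conj_cor 1 (RingEquiv.refl F4)))

theorem FlagRel.exists_conj {c : F4} {x y : L34Ext} (h : FlagRel c x y) :
    ∃ g, MulAut.conj g x = baseElation F4 ∧
      MulAut.conj g y = elation ![0, 0, 1] (c • ![1, 0, 0]) := by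
  obtain ⟨p, φ, hp, hφ, h1, rfl, rfl⟩ := h
  obtain ⟨ψ, -, h2⟩ := exists_cross_eq hφ h1
  obtain ⟨A, h3, h4, -⟩ := exists_standard one_ne_zero hp (by rw [h2, one_smul])
  refine ⟨col A (RingEquiv.refl F4), ?_, ?_⟩
  · rw [conj_col_elation, h3, h4, inv_one]; rfl
  · rw [conj_col_elation, semilin_smul, h3, h4, inv_one]; rfl

theorem isOrbital_lineRel : IsOrbital LineRel := by
  apply isOrbital_of_exists_conj
  · intro g x y h
    obtain ⟨A, τ, rfl | rfl⟩ := eq_col_or_cor g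
    · rw [LineRel, ← map_one τ]
      exact h.imp (fun h => h.conj_col A τ) fun h => h.conj_col A τ
    · rw [LineRel, ← map_one τ, or_comm]
      exact h.imp (fun h => h.conj_cor A τ) fun h => h.conj_cor A τ
  · exact fun x y h => h.elim (CentreRel.exists_conj one_ne_zero) (AxisRel.exists_conj one_ne_zero)
  · exact fun x y h => h.imp CentreRel.symm AxisRel.symm
  · exact fun x y h => h.imp CentreRel.mul_right AxisRel.mul_right
  · exact fun x y h => h.elim (fun h => (h.isElation one_ne_zero).1)
      fun h => (h.isElation one_ne_zero).1
  · exact fun x y h => h.elim CentreRel.commute AxisRel.commute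

theorem toF4_w_ne_zero : Quart.toF4 .w ≠ 0 := by rw [Ne, Quart.toF4_eq_zero]; decide

theorem toF4_w_ne_one : Quart.toF4 .w ≠ 1 := by
  rw [← Quart.toF4_u, Ne, Quart.toF4.injective.eq_iff]; decide

theorem isOrbital_skewRel : IsOrbital SkewRel := by
  apply isOrbital_of_exists_conj
  · rintro g x y ⟨c, hc0, hc1, h⟩
    obtain ⟨A, τ, rfl | rfl⟩ := eq_col_or_cor g
    · exact ⟨τ c, by simpa using hc0, by simpa using hc1,
        h.imp (fun h => h.conj_col A τ) fun h => h.conj_col A τ⟩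
    · refine ⟨τ c, by simpa using hc0, by simpa using hc1, ?_⟩
      rw [or_comm]
      exact h.imp (fun h => h.conj_cor A τ) fun h => h.conj_cor A τ
  · rintro x y ⟨c, hc0, hc1, h⟩
    obtain ⟨τ, rfl⟩ := exists_ringEquiv toF4_w_ne_zero toF4_w_ne_one hc0 hc1
    apply exists_conj_of_conj (col 1 τ.symm)
    have h' := h.imp (fun h => h.conj_col 1 τ.symm) (fun h => h.conj_col 1 τ.symm)
    rw [RingEquiv.symm_apply_apply] at h'
    exact h'.elim (CentreRel.exists_conj toF4_w_ne_zero) (AxisRel.exists_conj toF4_w_ne_zero)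
  · exact fun x y ⟨c, hc0, hc1, h⟩ => ⟨c, hc0, hc1, h.imp CentreRel.symm AxisRel.symm⟩
  · exact fun x y ⟨c, hc0, hc1, h⟩ => ⟨c, hc0, hc1, h.imp CentreRel.mul_right AxisRel.mul_right⟩
  · exact fun x y ⟨c, hc0, hc1, h⟩ => h.elim (fun h => (h.isElation hc0).1)
      fun h => (h.isElation hc0).1
  · exact fun x y ⟨c, hc0, hc1, h⟩ => h.elim CentreRel.commute AxisRel.commute

theorem isOrbital_spreadRel : IsOrbital SpreadRel := by
  apply isOrbital_of_exists_conj
  · rintro g x y ⟨c, hc0, hc1, h⟩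
    obtain ⟨A, τ, rfl | rfl⟩ := eq_col_or_cor g
    · exact ⟨τ c, by simpa using hc0, by simpa using hc1, h.conj_col A τ⟩
    · exact ⟨τ c, by simpa using hc0, by simpa using hc1, h.conj_cor A τ⟩
  · rintro x y ⟨c, hc0, hc1, h⟩
    obtain ⟨τ, rfl⟩ := exists_ringEquiv toF4_w_ne_zero toF4_w_ne_one hc0 hc1
    apply exists_conj_of_conj (col 1 τ.symm)
    have h' := h.conj_col 1 τ.symm
    rw [RingEquiv.symm_apply_apply] at h'
    exact h'.exists_conj
  · exact fun x y ⟨c, hc0, hc1, h⟩ => ⟨c⁻¹, inv_ne_zero hc0, by simpa using hc1, h.symm hc0⟩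
  · refine fun x y ⟨c, hc0, hc1, h⟩ => ⟨1 + c, ?_, by simpa using hc0, h.mul_right⟩
    rwa [Ne, CharTwo.add_eq_zero, eq_comm]
  · exact fun x y ⟨c, hc0, hc1, h⟩ => (h.isElation hc0).1
  · exact fun x y ⟨c, hc0, hc1, h⟩ => h.commute

end PlaneGroup

namespace ElationLabel

open QVec Quart PlaneGroup

/-- The Boolean version of `SpreadRel`. -/
def spread : ElationLabel → ElationLabel → Bool
  | (p, f), (q, g) => beq p q && (beq g (scale .w f) || beq g (scale .v f))

/-- The Boolean version of `LineRel`. -/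
def line (a b : ElationLabel) : Bool := centre .u a b || axis .u a b

/-- The Boolean version of `SkewRel`. -/
def skew (a b : ElationLabel) : Bool :=
  (centre .w a b || axis .w a b) || (centre .v a b || axis .v a b)

theorem exists_F4_iff {P : F4 → Prop} :
    (∃ c : F4, c ≠ 0 ∧ c ≠ 1 ∧ P c) ↔ P (toF4 .w) ∨ P (toF4 .v) := by
  constructor
  · rintro ⟨c, hc0, hc1, h⟩
    obtain ⟨c, rfl⟩ := toF4.surjective c
    cases c
    · exact absurd toF4_z hc0
    · exact absurd toF4_u hc1
    · exact Or.inl h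
    · exact Or.inr h
  · rintro (h | h)
    · exact ⟨_, toF4_w_ne_zero, toF4_w_ne_one, h⟩
    · refine ⟨_, ?_, ?_, h⟩
      · rw [Ne, toF4_eq_zero]; decide
      · rw [← toF4_u, Ne, toF4.injective.eq_iff]; decide

theorem flagRel_toElation_iff {c : Quart} {a b : ElationLabel} (ha : valid a = true)
    (hb : valid b = true) :
    FlagRel (toF4 c) (toElation a) (toElation b) ↔ a.1 = b.1 ∧ b.2 = scale c a.2 := by
  obtain ⟨p, f⟩ := a
  obtain ⟨q, g⟩ := b
  rw [valid_iff] at ha hb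
  have hp : toVec p ≠ 0 := toVec_ne_zero.2 (by rw [ha.1]; decide)
  have hq : toVec q ≠ 0 := toVec_ne_zero.2 (by rw [hb.1]; decide)
  have hf := toVec_ne_zero.2 ha.2.1
  have hg := toVec_ne_zero.2 hb.2.1
  rw [← toVec_injective.eq_iff (b := scale c _), toVec_scale]
  constructor
  · rintro ⟨r, φ, hr, hφ, h1, h4, h5⟩
    obtain ⟨k, hk, rfl, h8⟩ := elation_injective hp hf (dot_eq_z.1 ha.2.2) h1 h4
    obtain ⟨m, hm, h6, h9⟩ := elation_injective hq hg (dot_eq_z.1 hb.2.2) (by simp [h1]) h5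
    have hpq : p = q := by
      refine eq_of_toVec_eq_smul (c := k⁻¹ * m) ?_ ha.1 hb.1
      rw [mul_smul, ← h6, inv_smul_smul₀ hk]
    subst hpq
    have hkm : k = m := by
      have : (k - m) • toVec p = 0 := by rw [sub_smul, h6, sub_self]
      exact sub_eq_zero.1 ((smul_eq_zero.1 this).resolve_right hp)
    subst hkm
    exact ⟨rfl, by rw [h9, h8, smul_comm]⟩
  · rintro ⟨rfl, h⟩
    refine ⟨_, _, hp, hf, dot_eq_z.1 ha.2.2, rfl, ?_⟩
    rw [← h]
    rfl

theorem spreadRel_toElation_iff {a b : ElationLabel} (ha : valid a = true)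
    (hb : valid b = true) : SpreadRel (toElation a) (toElation b) ↔ spread a b = true := by
  rw [SpreadRel, exists_F4_iff, flagRel_toElation_iff ha hb, flagRel_toElation_iff ha hb]
  obtain ⟨p, f⟩ := a
  obtain ⟨q, g⟩ := b
  simp only [spread, Bool.and_eq_true, Bool.or_eq_true, QVec.beq_iff]
  tauto

theorem lineRel_toElation_iff {a b : ElationLabel} (ha : valid a = true)
    (hb : valid b = true) : LineRel (toElation a) (toElation b) ↔ line a b = true := by
  rw [LineRel, ← toF4_u, centreRel_toElation_iff ha hb, axisRel_toElation_iff ha hb, line,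
    Bool.or_eq_true]

theorem skewRel_toElation_iff {a b : ElationLabel} (ha : valid a = true)
    (hb : valid b = true) : SkewRel (toElation a) (toElation b) ↔ skew a b = true := by
  simp only [SkewRel, exists_F4_iff, centreRel_toElation_iff ha hb, axisRel_toElation_iff ha hb,
    skew, Bool.or_eq_true]

/-- The label of the base elation. -/
def base : ElationLabel := (.mk .z .z .u, .mk .u .z .z)

theorem valid_base : valid base = true := by decide

theorem toElation_base : toElation base = baseElation F4 := by
  simp only [toElation, base, toVec, toF4_z, toF4_u]
  rfl

theorem ncard_of_orbital {R : L34Ext → L34Ext → Prop} (hR : IsOrbital R)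
    {f : ElationLabel → ElationLabel → Bool}
    (h : ∀ {a b}, valid a = true → valid b = true → (R (toElation a) (toElation b) ↔ f a b = true)) :
    {z | R (baseElation F4) z}.ncard = (all.filter (f base)).length := by
  apply ncard_of_label_iff
  · exact fun x hx => (hR.elation _ _ hx).2
  · intro a ha
    rw [← h valid_base ha, toElation_base]
    rfl

end ElationLabel

namespace PlaneGroup

open ElationLabel

/-- The three indices are 315 · 2 / 6, 315 · 8 / 6 and 315 · 16 / 6. The partners of an elation are
its two other multiples with the same flag, and, for each nonzero `c`, four elations with the same
centre and four with the same axis. -/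
theorem index_of_spreadRel {x y : L34Ext} (h : SpreadRel x y) :
    (Subgroup.normalizer (Subgroup.closure {x, y} : Set L34Ext)).index = 105 := by
  have h1 := isOrbital_spreadRel.index_mul_six h
  rw [ncard_of_orbital isOrbital_spreadRel spreadRel_toElation_iff] at h1
  have h2 : (all.filter (spread base)).length = 2 := by decide +kernel
  omega

theorem index_of_lineRel {x y : L34Ext} (h : LineRel x y) :
    (Subgroup.normalizer (Subgroup.closure {x, y} : Set L34Ext)).index = 420 := by
  have h1 := isOrbital_lineRel.index_mul_six h
  rw [ncard_of_orbital isOrbital_lineRel lineRel_toElation_iff] at h1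
  have h2 : (all.filter (line base)).length = 8 := by decide +kernel
  omega

theorem index_of_skewRel {x y : L34Ext} (h : SkewRel x y) :
    (Subgroup.normalizer (Subgroup.closure {x, y} : Set L34Ext)).index = 840 := by
  have h1 := isOrbital_skewRel.index_mul_six h
  rw [ncard_of_orbital isOrbital_skewRel skewRel_toElation_iff] at h1
  have h2 : (all.filter (skew base)).length = 16 := by decide +kernel
  omega

theorem trichotomy_of_commute {x y : L34Ext} (hx : IsElation x) (hy : IsElation y) (hxy : x ≠ y)
    (hc : Commute x y) : SpreadRel x y ∨ LineRel x y ∨ SkewRel x y := by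
  obtain ⟨c, hc0, h⟩ := rel_of_commute hx hy hxy hc
  by_cases hc1 : c = 1
  · subst hc1
    rcases h with h | h | h
    · exact Or.inr (Or.inl (Or.inl h))
    · exact Or.inr (Or.inl (Or.inr h))
    · exact absurd rfl h.1
  · rcases h with h | h | h
    · exact Or.inr (Or.inr ⟨c, hc0, hc1, Or.inl h⟩)
    · exact Or.inr (Or.inr ⟨c, hc0, hc1, Or.inr h⟩)
    · exact Or.inl ⟨c, hc0, hc1, h.2⟩

/-- The indices 105, 420 and 840 differ, so among commuting pairs the index identifies the orbit. -/
theorem spreadRel_iff {x y : L34Ext} : SpreadRel x y ↔ IsElation x ∧ IsElation y ∧ x ≠ y ∧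
    Commute x y ∧ (Subgroup.normalizer (Subgroup.closure {x, y} : Set L34Ext)).index = 105 := by
  constructor
  · intro h
    exact ⟨(isOrbital_spreadRel.elation _ _ h).1, (isOrbital_spreadRel.elation _ _ h).2,
      isOrbital_spreadRel.ne h, isOrbital_spreadRel.commute _ _ h, index_of_spreadRel h⟩
  · rintro ⟨hx, hy, hxy, hc, hi⟩
    rcases trichotomy_of_commute hx hy hxy hc with h | h | h
    · exact h
    · have := index_of_lineRel h; omega
    · have := index_of_skewRel h; omega

theorem lineRel_iff {x y : L34Ext} : LineRel x y ↔ IsElation x ∧ IsElation y ∧ x ≠ y ∧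
    Commute x y ∧ (Subgroup.normalizer (Subgroup.closure {x, y} : Set L34Ext)).index = 420 := by
  constructor
  · intro h
    exact ⟨(isOrbital_lineRel.elation _ _ h).1, (isOrbital_lineRel.elation _ _ h).2,
      isOrbital_lineRel.ne h, isOrbital_lineRel.commute _ _ h, index_of_lineRel h⟩
  · rintro ⟨hx, hy, hxy, hc, hi⟩
    rcases trichotomy_of_commute hx hy hxy hc with h | h | h
    · have := index_of_spreadRel h; omega
    · exact h
    · have := index_of_skewRel h; omega

end PlaneGroup

/-! ### Elations in the geometric sense are elations given by matrices -/

namespace PlaneGroup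

open Matrix ElationLabel QVec Projectivization Configuration.ofField

section

variable {K : Type*} [Field K]

theorem orthogonal_projPerm (A : SpecialLinearGroup (Fin 3) K) (τ : K ≃+* K) (x y : PG2 K) :
    (projPerm A τ x).orthogonal (projPerm (contra A) τ y) ↔ x.orthogonal y := by
  induction x using Projectivization.ind with
  | h x hx =>
    induction y using Projectivization.ind with
    | h y hy =>
      change (Projectivization.mk K (semilin A τ x) _).orthogonal
        (Projectivization.mk K (semilin (contra A) τ y) _) ↔ _
      rw [orthogonal_mk, orthogonal_mk, dotProduct_semilin_contra]
      simp

theorem exists_not_orthogonal_both (l m : PG2 K) :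
    ∃ x : PG2 K, ¬ x.orthogonal l ∧ ¬ x.orthogonal m := by
  obtain ⟨x, hx⟩ := exists_not_orthogonal_self l
  obtain ⟨y, hy⟩ := exists_not_orthogonal_self m
  by_cases hxm : x.orthogonal m
  · by_cases hyl : y.orthogonal l
    · induction x using Projectivization.ind with
      | h x hx0 =>
      induction y using Projectivization.ind with
      | h y hy0 =>
      induction l using Projectivization.ind with
      | h l hl0 =>
      induction m using Projectivization.ind with
      | h m hm0 =>
      rw [orthogonal_mk hx0 hl0] at hx
      rw [orthogonal_mk hy0 hm0] at hy
      rw [orthogonal_mk hx0 hm0] at hxm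
      rw [orthogonal_mk hy0 hl0] at hyl
      have h1 : (x + y) ⬝ᵥ l ≠ 0 := by rwa [add_dotProduct, hyl, add_zero]
      have h0 : x + y ≠ 0 := by rintro h; rw [h, zero_dotProduct] at h1; exact h1 rfl
      refine ⟨Projectivization.mk K (x + y) h0, ?_, ?_⟩
      · rwa [orthogonal_mk]
      · rwa [orthogonal_mk, add_dotProduct, hxm, zero_add]
    · exact ⟨y, hyl, hy⟩
  · exact ⟨x, hx, hxm⟩

theorem projPerm_elationMatrix_eq {p φ : Fin 3 → K} (h : p ⬝ᵥ φ = 0) {x : PG2 K} (hφ : φ ≠ 0)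
    (hx : x.orthogonal (Projectivization.mk K φ hφ)) :
    projPerm (elationMatrix p φ) (RingEquiv.refl K) x = x := by
  induction x using Projectivization.ind with
  | h x hx0 =>
  rw [orthogonal_mk] at hx
  change Projectivization.mk K (semilin _ _ x) _ = _
  congr 1
  change (elationMatrix p φ).1.mulVec x = x
  rw [coe_elationMatrix h, add_mulVec, one_mulVec, vecMulVec_mulVec, dotProduct_comm, hx]
  simp

theorem isNontrivialElation_of_isElation [CharP K 2] {x : collineationsAndCorrelations K}
    (hx : IsElation x) : IsNontrivialElation x.1 := by
  refine ⟨fun h => hx.ne_one (Subtype.ext h), ?_⟩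
  obtain ⟨p, φ, hp, hφ, h, rfl⟩ := hx
  refine ⟨⟨_, _, rfl, fun x y => (orthogonal_projPerm _ _ x y).symm⟩,
    Projectivization.mk K p hp, Projectivization.mk K φ hφ, (orthogonal_mk hp hφ).2 h, ?_, ?_⟩
  · intro x hx
    exact congrArg Sum.inl (projPerm_elationMatrix_eq h hφ hx)
  · intro m hm
    refine congrArg Sum.inr ?_
    rw [contra_elationMatrix]
    exact projPerm_elationMatrix_eq (by rwa [dotProduct_comm]) hp (orthogonal_comm.1 hm)

variable [DecidableEq K]

theorem exists_two_points_of_mem {z m : PG2 K} (h : z.orthogonal m) :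
    ∃ y, y ≠ z ∧ y.orthogonal m := by
  obtain ⟨k, hk⟩ := exists_not_self_orthogonal z
  have hmk : m ≠ k := by rintro rfl; exact hk h
  refine ⟨cross m k, ?_, cross_orthogonal_left hmk⟩
  rintro rfl
  exact hk (cross_orthogonal_right hmk)

theorem exists_point_on (m : PG2 K) : ∃ z : PG2 K, z.orthogonal m := by
  have h1 : (![1, 0, 0] : Fin 3 → K) ≠ 0 := fun h => by simpa using congrFun h 0
  have h2 : (![0, 1, 0] : Fin 3 → K) ≠ 0 := fun h => by simpa using congrFun h 1
  by_cases h : m = Projectivization.mk K _ h1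
  · refine ⟨Projectivization.mk K _ h2, ?_⟩
    rw [h, orthogonal_mk]
    simp
  · exact ⟨_, cross_orthogonal_left h⟩

/-- A pair of maps of the points and lines that preserves incidence, fixes all points of a line,
all lines through a point of this line, and some further point, is the identity. -/
theorem eq_one_of_fixes {a b : Equiv.Perm (PG2 K)}
    (hab : ∀ x y, x.orthogonal y ↔ (a x).orthogonal (b y)) {p l x : PG2 K}
    (hpl : p.orthogonal l) (hl : ∀ y : PG2 K, y.orthogonal l → a y = y)
    (hp : ∀ m : PG2 K, p.orthogonal m → b m = m) (hx : ¬ x.orthogonal l) (hax : a x = x) :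
    a = 1 ∧ b = 1 := by
  have line_fixed : ∀ u v m : PG2 K, u ≠ v → u.orthogonal m → v.orthogonal m → a u = u →
      a v = v → b m = m := by
    intro u v m huv hum hvm hu hv
    have h1 := (hab u m).1 hum
    have h2 := (hab v m).1 hvm
    rw [hu] at h1
    rw [hv] at h2
    exact ((eq_or_eq_of_orthogonal hum hvm h1 h2).resolve_left huv).symm
  have point_fixed : ∀ u m n : PG2 K, m ≠ n → u.orthogonal m → u.orthogonal n → b m = m →
      b n = n → a u = u := by
    intro u m n hmn hum hun hm hn
    have h1 := (hab u m).1 hum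
    have h2 := (hab u n).1 hun
    rw [hm] at h1
    rw [hn] at h2
    exact ((eq_or_eq_of_orthogonal hum h1 hun h2).resolve_right hmn).symm
  have ne_p : ∀ {x : PG2 K}, ¬ x.orthogonal l → p ≠ x := by
    rintro x hx rfl
    exact hx hpl
  -- Every line through the fixed point `x` is fixed, since it also meets the axis in a fixed point.
  -- A point `y` off the axis and off the line `px` is the intersection of the fixed lines `py` and
  -- `xy`.
  have off : ∀ x : PG2 K, ¬ x.orthogonal l → a x = x → ∀ y : PG2 K, ¬ y.orthogonal l →
      ¬ y.orthogonal (cross p x) → a y = y := by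
    intro x hx hax y hy hyx
    have hyx' : y ≠ x := by
      rintro rfl
      exact hyx (orthogonal_cross_right (ne_p hx))
    have lines_x : ∀ m : PG2 K, x.orthogonal m → b m = m := by
      intro m hm
      have hml : m ≠ l := by rintro rfl; exact hx hm
      refine line_fixed x (cross m l) m ?_ hm (cross_orthogonal_left hml) hax
        (hl _ (cross_orthogonal_right hml))
      intro h
      rw [h] at hx
      exact hx (cross_orthogonal_right hml)
    refine point_fixed y (cross p y) (cross x y) ?_ (orthogonal_cross_right (ne_p hy))
      (orthogonal_cross_right hyx'.symm) (hp _ (orthogonal_cross_left (ne_p hy)))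
      (lines_x _ (orthogonal_cross_left hyx'.symm))
    intro h
    have h1 : x.orthogonal (cross p y) := by rw [h]; exact orthogonal_cross_left hyx'.symm
    have h2 := (eq_or_eq_of_orthogonal (orthogonal_cross_left (ne_p hy)) h1
      (orthogonal_cross_left (ne_p hx)) (orthogonal_cross_right (ne_p hx))).resolve_left (ne_p hx)
    rw [← h2] at hyx
    exact hyx (orthogonal_cross_right (ne_p hy))
  have all_points : ∀ y, a y = y := by
    intro y
    by_cases hy : y.orthogonal l
    · exact hl y hy
    by_cases hyx : y.orthogonal (cross p x)
    -- For points on the line `px` the same argument is run from a point `z` outside this line,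
    -- already known to be fixed.
    · obtain ⟨z, hz1, hz2⟩ := exists_not_orthogonal_both l (cross p x)
      refine off z hz1 (off x hx hax z hz1 hz2) y hy fun h => ?_
      have h2 := (eq_or_eq_of_orthogonal (orthogonal_cross_left (ne_p hz1)) h
        (orthogonal_cross_left (ne_p hx)) hyx).resolve_left (ne_p hy)
      rw [← h2] at hz2
      exact hz2 (orthogonal_cross_right (ne_p hz1))
    · exact off x hx hax y hy hyx
  refine ⟨Equiv.ext all_points, Equiv.ext fun m => ?_⟩
  obtain ⟨z, hz⟩ := exists_point_on m
  obtain ⟨y, hy, hym⟩ := exists_two_points_of_mem hz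
  exact line_fixed y z m hy hym hz (all_points y) (all_points z)

/-- The image of `x` lies on the line `px`, which is fixed, and off the axis. So it has the form `β
x + α p` with `β ≠ 0`, and the elations with centre `p` and axis `l` reach all such points. -/
theorem exists_elationMatrix_eq {a b : Equiv.Perm (PG2 K)}
    (hab : ∀ x y, x.orthogonal y ↔ (a x).orthogonal (b y)) {p l : Fin 3 → K} (hp0 : p ≠ 0)
    (hl0 : l ≠ 0) (hpl : p ⬝ᵥ l = 0)
    (hp : ∀ m : PG2 K, (Projectivization.mk K p hp0).orthogonal m → b m = m) {x : PG2 K}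
    (hx : ¬ x.orthogonal (Projectivization.mk K l hl0)) :
    ∃ k : K, projPerm (elationMatrix (k • p) l) (RingEquiv.refl K) x = a x := by
  have hpl' : (Projectivization.mk K p hp0).orthogonal (Projectivization.mk K l hl0) :=
    (orthogonal_mk hp0 hl0).2 hpl
  have hpx : Projectivization.mk K p hp0 ≠ x := by rintro rfl; exact hx hpl'
  have h1 : ¬ (a x).orthogonal (Projectivization.mk K l hl0) := by
    rw [← hp _ hpl', ← hab]; exact hx
  have h2 : (a x).orthogonal (cross (Projectivization.mk K p hp0) x) := by
    rw [← hp _ (orthogonal_cross_left hpx), ← hab]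
    exact orthogonal_cross_right hpx
  generalize a x = y at h1 h2
  induction x using Projectivization.ind with
  | h x hx0 =>
  induction y using Projectivization.ind with
  | h y hy0 =>
  have hcr : crossProduct p x ≠ 0 := by
    rwa [Ne, ← mk_eq_mk_iff_crossProduct_eq_zero hp0 hx0]
  rw [orthogonal_mk] at hx h1
  rw [cross_mk_of_cross_ne_zero hp0 hx0 hcr, orthogonal_mk] at h2
  set β := (y ⬝ᵥ l) / (x ⬝ᵥ l) with hβ
  have hβ0 : β ≠ 0 := div_ne_zero h1 hx
  have h3 : (y - β • x) ⬝ᵥ l = 0 := by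
    rw [sub_dotProduct, smul_dotProduct, smul_eq_mul, hβ, div_mul_cancel₀ _ hx, sub_self]
  have h4 : (y - β • x) ⬝ᵥ crossProduct p x = 0 := by
    rw [sub_dotProduct, smul_dotProduct, h2, dot_cross_self, smul_zero, sub_zero]
  -- Both `y - β x` and `p` are orthogonal to `l` and to `p × x`. Unless they are proportional, `l`
  -- and `p × x` are, and then `x` would lie on the axis.
  obtain ⟨α, hα⟩ : ∃ α : K, y - β • x = α • p := by
    rcases crossProduct_eq_zero_of_dotProduct_eq_zero h3 hpl h4 (dot_self_cross p x) with h | h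
    · exact exists_smul_of_cross_eq_zero hp0 h
    · obtain ⟨c, hc⟩ := exists_smul_of_cross_eq_zero hcr h
      rw [hc, dotProduct_smul, dot_cross_self, smul_zero] at hx
      exact absurd rfl hx
  -- The elation sends `x` to `x + k (x · l) p`, which has to be `β⁻¹ y = x + (α / β) p`.
  refine ⟨α / (β * (x ⬝ᵥ l)), ?_⟩
  change Projectivization.mk K (semilin _ _ x) _ = _
  rw [Projectivization.mk_eq_mk_iff']
  refine ⟨β⁻¹, ?_⟩
  change _ = (elationMatrix _ l).1.mulVec x
  rw [coe_elationMatrix (by rw [smul_dotProduct, hpl, smul_zero]), add_mulVec, one_mulVec,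
    vecMulVec_mulVec, dotProduct_comm l x]
  have h5 : y = β • x + α • p := by rw [← hα]; abel
  rw [h5, smul_add, inv_smul_smul₀ hβ0, op_smul_eq_smul, smul_smul, smul_smul]
  congr 2
  field_simp

/-- A matrix elation with the same centre and axis can be chosen to agree with `g` at one point off
the axis. The quotient then satisfies the hypotheses of `eq_one_of_fixes`. The scalar `k` is nonzero
because `g` is not the identity. -/
theorem exists_isElation_of_isNontrivialElation [CharP K 2] {g : Equiv.Perm (PG2Elements K)}
    (hg : IsNontrivialElation g) : ∃ x : collineationsAndCorrelations K, IsElation x ∧ x.1 = g := by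
  obtain ⟨hg1, ⟨a, b, rfl, hab⟩, p, l, hpl, hl, hp⟩ := hg
  replace hl : ∀ x : PG2 K, x.orthogonal l → a x = x := fun x hx =>
    Sum.inl_injective (hl x hx)
  replace hp : ∀ m : PG2 K, p.orthogonal m → b m = m := fun m hm =>
    Sum.inr_injective (hp m hm)
  obtain ⟨x, hx⟩ := exists_not_orthogonal_self l
  induction p using Projectivization.ind with
  | h p hp0 =>
  induction l using Projectivization.ind with
  | h l hl0 =>
  have hpl' := (orthogonal_mk hp0 hl0).1 hpl
  obtain ⟨k, hk⟩ := exists_elationMatrix_eq hab hp0 hl0 hpl' hp hx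
  have hkpl : (k • p) ⬝ᵥ l = 0 := by rw [smul_dotProduct, hpl', smul_zero]
  set A := elationMatrix (k • p) l with hA
  have key := eq_one_of_fixes (a := (projPerm A (RingEquiv.refl K))⁻¹ * a)
    (b := (projPerm (contra A) (RingEquiv.refl K))⁻¹ * b) (p := Projectivization.mk K p hp0)
    (l := Projectivization.mk K l hl0) (x := x) ?_ hpl ?_ ?_ hx ?_
  · rw [inv_mul_eq_one, inv_mul_eq_one] at key
    refine ⟨elation (k • p) l, ⟨k • p, l, ?_, hl0, hkpl, rfl⟩, ?_⟩
    · intro h0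
      apply hg1
      rw [← key.1, ← key.2, hA, h0, elationMatrix_zero_left]
      exact collineation_one
    · rw [← key.1, ← key.2]
      rfl
  · intro y m
    have h := orthogonal_projPerm A (RingEquiv.refl K)
      ((projPerm A (RingEquiv.refl K)).symm (a y))
      ((projPerm (contra A) (RingEquiv.refl K)).symm (b m))
    rw [Equiv.apply_symm_apply, Equiv.apply_symm_apply] at h
    rw [hab]
    exact h
  · intro y hy
    rw [Equiv.Perm.mul_apply, hl y hy, Equiv.Perm.inv_eq_iff_eq,
      projPerm_elationMatrix_eq hkpl hl0 hy]
  · intro m hm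
    rw [Equiv.Perm.mul_apply, hp m hm, Equiv.Perm.inv_eq_iff_eq]
    rw [hA, contra_elationMatrix]
    by_cases hk0 : k = 0
    · rw [hk0, zero_smul, elationMatrix_zero_right, projPerm_one]
    · rw [← elationMatrix_smul_left hk0,
        projPerm_elationMatrix_eq _ hp0 (orthogonal_comm.1 hm)]
      rw [smul_dotProduct, dotProduct_comm, hpl', smul_zero]
  · rw [Equiv.Perm.mul_apply, Equiv.Perm.inv_eq_iff_eq, hk]

end
end PlaneGroup

/-! ### Transport along an isomorphism with the group of collineations and correlations -/

section Transfer

variable {G G' : Type*} [Group G] [Group G']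

theorem IsCentralInvolution.map [Finite G] {x : G} (hx : IsCentralInvolution x) (e : G ≃* G') :
    IsCentralInvolution (e x) := by
  obtain ⟨h, H, hH⟩ := hx
  refine ⟨by rw [← h]; exact MulEquiv.orderOf_eq e x,
    H.mapSurjective (f := e.toMonoidHom) e.surjective, ?_⟩
  rw [Subgroup.mem_centralizer_iff] at hH ⊢
  rintro _ ⟨h, hh, rfl⟩
  change e h * e x = e x * e h
  rw [← map_mul, hH h hh, map_mul]

theorem isCentralInvolution_map_iff [Finite G] (e : G ≃* G') {x : G} :
    IsCentralInvolution (e x) ↔ IsCentralInvolution x := by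
  have : Finite G' := Finite.of_equiv G e.toEquiv
  refine ⟨fun h => ?_, fun h => h.map e⟩
  have := h.map e.symm
  rwa [e.symm_apply_apply] at this

theorem index_normalizer_closure_map (e : G ≃* G') (x y : G) :
    (Subgroup.normalizer (Subgroup.closure {e x, e y} : Set G')).index =
      (Subgroup.normalizer (Subgroup.closure {x, y} : Set G)).index := by
  have h1 : Subgroup.closure {e x, e y} = (Subgroup.closure {x, y}).map e.toMonoidHom := by
    rw [MonoidHom.map_closure, Set.image_pair]
    rfl
  rw [h1, ← Subgroup.map_equiv_normalizer_eq]
  exact Subgroup.index_map_equiv _ e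

end Transfer

namespace PlaneGroup

open ElationLabel QVec Quart Matrix

section

variable {G : Type*} [Group G] (e : G ≃* L34Ext)

theorem mem_involutionTriples_iff (l : Set G) :
    l ∈ involutionTriples G {105, 420} ↔
      ∃ x y, (SpreadRel (e x) (e y) ∨ LineRel (e x) (e y)) ∧ l = {x, y, x * y} := by
  have : Finite G := Finite.of_equiv _ e.symm.toEquiv
  refine exists_congr fun x => exists_congr fun y => ?_
  rw [spreadRel_iff, lineRel_iff, ← isCentralInvolution_iff, ← isCentralInvolution_iff,
    isCentralInvolution_map_iff, isCentralInvolution_map_iff, e.injective.ne_iff,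
    index_normalizer_closure_map, commute_iff_eq, commute_iff_eq, ← map_mul, ← map_mul,
    e.injective.eq_iff]
  simp only [Set.mem_insert_iff, Set.mem_singleton_iff]
  tauto

theorem mem_involutionTriples_spread_iff (l : Set G) :
    l ∈ involutionTriples G {105} ↔ ∃ x y, SpreadRel (e x) (e y) ∧ l = {x, y, x * y} := by
  have : Finite G := Finite.of_equiv _ e.symm.toEquiv
  refine exists_congr fun x => exists_congr fun y => ?_
  rw [spreadRel_iff, ← isCentralInvolution_iff, ← isCentralInvolution_iff,
    isCentralInvolution_map_iff, isCentralInvolution_map_iff, e.injective.ne_iff,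
    index_normalizer_closure_map, commute_iff_eq, commute_iff_eq, ← map_mul, ← map_mul,
    e.injective.eq_iff]
  simp only [Set.mem_singleton_iff]
  tauto

/-- In a triple of commuting involutions the product of any two is the third, so any two of them can
take the roles of `x` and `y`. -/
theorem IsOrbital.of_mem {R : L34Ext → L34Ext → Prop} (hR : IsOrbital R) {x y z w : G}
    (h : R (e x) (e y)) (hz : z ∈ ({x, y, x * y} : Set G)) (hw : w ∈ ({x, y, x * y} : Set G))
    (hzw : z ≠ w) : R (e z) (e w) ∧ ({x, y, x * y} : Set G) = {z, w, z * w} := by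
  have hx : x * x = 1 := e.injective (by
    rw [map_mul, (hR.elation _ _ h).1.mul_self, map_one])
  have hy : y * y = 1 := e.injective (by
    rw [map_mul, (hR.elation _ _ h).2.mul_self, map_one])
  have hyx : y * x = x * y := e.injective (by
    rw [map_mul, map_mul, (hR.commute _ _ h).eq])
  have h1 : x * (x * y) = y := by rw [← mul_assoc, hx, one_mul]
  have h2 : y * (x * y) = x := by rw [← mul_assoc, hyx, mul_assoc, hy, mul_one]
  have h3 : x * y * x = y := by rw [mul_assoc, hyx, h1]
  have h4 : x * y * y = x := by rw [mul_assoc, hy, mul_one]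
  have r1 := hR.symm _ _ h
  have r2 := hR.mul _ _ h
  have r3 := hR.mul _ _ r1
  rw [← map_mul] at r2 r3
  rw [hyx] at r3
  have r4 := hR.symm _ _ r2
  have r5 := hR.symm _ _ r3
  simp only [Set.mem_insert_iff, Set.mem_singleton_iff] at hz hw
  rcases hz with rfl | rfl | rfl <;> rcases hw with rfl | rfl | rfl
  · exact absurd rfl hzw
  · exact ⟨h, rfl⟩
  · refine ⟨r2, ?_⟩
    rw [h1]; ext; simp; tauto
  · refine ⟨r1, ?_⟩
    rw [hyx]; ext; simp; tauto
  · exact absurd rfl hzw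
  · refine ⟨r3, ?_⟩
    rw [h2]; ext; simp; tauto
  · refine ⟨r4, ?_⟩
    rw [h3]; ext; simp; tauto
  · refine ⟨r5, ?_⟩
    rw [h4]; ext; simp; tauto
  · exact absurd rfl hzw

/-- A line is determined by any two of its points. -/
theorem isLine_cases {z w : G} {l : Set G} (hl : l ∈ involutionTriples G {105, 420}) (hz : z ∈ l)
    (hw : w ∈ l) (hzw : z ≠ w) :
    (SpreadRel (e z) (e w) ∨ LineRel (e z) (e w)) ∧ l = {z, w, z * w} := by
  obtain ⟨x, y, h | h, rfl⟩ := (mem_involutionTriples_iff e l).1 hl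
  · exact ⟨Or.inl (isOrbital_spreadRel.of_mem e h hz hw hzw).1,
      (isOrbital_spreadRel.of_mem e h hz hw hzw).2⟩
  · exact ⟨Or.inr (isOrbital_lineRel.of_mem e h hz hw hzw).1,
      (isOrbital_lineRel.of_mem e h hz hw hzw).2⟩

end

end PlaneGroup

/-! ### Lines, flags and commutation in terms of labels -/

namespace ElationLabel

open QVec Quart PlaneGroup Matrix

/-- The three labels describe the points of a line of the geometry. -/
def IsLine (a b c : ElationLabel) : Prop :=
  (∃ p f g, valid (p, f) = true ∧ valid (p, g) = true ∧
    ((f ≠ g ∧ cross f g = zero) ∨ cross f g = p) ∧ a = (p, f) ∧ b = (p, g) ∧ c = (p, add f g)) ∨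
  (∃ f p q, lead f = .u ∧ lead p ≠ .z ∧ lead q ≠ .z ∧ dot p f = .z ∧ dot q f = .z ∧
    cross p q = f ∧ a = norm (p, f) ∧ b = norm (q, f) ∧ c = norm (add p q, f))

theorem add_eq_zero {a b : QVec} : add a b = zero ↔ a = b := by
  rw [← toVec_eq_zero, toVec_add, CharTwo.add_eq_zero, toVec_injective.eq_iff]

theorem cross_self_eq_zero (a : QVec) : cross a a = zero := by
  rw [← toVec_eq_zero, toVec_cross, cross_self]

theorem lead_add_ne {a b : QVec} (h : a ≠ b) : lead (add a b) ≠ .z := by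
  rwa [Ne, lead_eq_z, add_eq_zero]

theorem dot_add_right {p f g : QVec} (h : dot p f = .z) (h' : dot p g = .z) :
    dot p (add f g) = .z := by
  rw [dot_eq_z] at *
  rw [toVec_add, dotProduct_add, h, h', add_zero]

theorem dot_add_left {p q f : QVec} (h : dot p f = .z) (h' : dot q f = .z) :
    dot (add p q) f = .z := by
  rw [dot_eq_z] at *
  rw [toVec_add, add_dotProduct, h, h', add_zero]

theorem isLine_of_rel {a b c : ElationLabel} (ha : valid a = true) (hb : valid b = true)
    (hc : valid c = true) (h : SpreadRel (toElation a) (toElation b) ∨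
      LineRel (toElation a) (toElation b)) (habc : toElation c = toElation a * toElation b) :
    IsLine a b c := by
  have centre_case : ∀ p f g, a = (p, f) → b = (p, g) →
      ((f ≠ g ∧ cross f g = zero) ∨ cross f g = p) → IsLine a b c := by
    rintro p f g rfl rfl h
    refine Or.inl ⟨p, f, g, ha, hb, h, rfl, rfl, ?_⟩
    rw [valid_iff] at ha hb
    apply toElation_injOn hc
    · rw [valid_iff]
      refine ⟨ha.1, ?_, dot_add_right ha.2.2 hb.2.2⟩
      rcases h with h | h
      · exact lead_add_ne h.1
      · apply lead_add_ne
        rintro rfl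
        rw [cross_self_eq_zero] at h
        rw [← h] at ha
        exact absurd ha.1 (by decide)
    · rw [habc]
      simp only [toElation, toVec_add]
      exact elation_mul_right (dot_eq_z.1 ha.2.2) (dot_eq_z.1 hb.2.2)
  rcases h with h | h | h
  · rw [spreadRel_toElation_iff ha hb] at h
    obtain ⟨p, f⟩ := a
    obtain ⟨q, g⟩ := b
    simp only [spread, Bool.and_eq_true, Bool.or_eq_true, QVec.beq_iff] at h
    obtain ⟨rfl, h⟩ := h
    apply centre_case p f g rfl rfl
    left
    rw [valid_iff] at ha
    have hf := ha.2.1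
    rcases f with ⟨f₁, f₂, f₃⟩
    rcases h with rfl | rfl <;> revert hf <;> clear * - <;>
      cases f₁ <;> cases f₂ <;> cases f₃ <;> decide
  · rw [← toF4_u, centreRel_toElation_iff ha hb] at h
    obtain ⟨p, f⟩ := a
    obtain ⟨q, g⟩ := b
    simp only [centre, Bool.and_eq_true, QVec.beq_iff] at h
    obtain ⟨rfl, h⟩ := h
    apply centre_case p f g rfl rfl
    right
    rw [h]
    cases p
    rfl
  · obtain ⟨p, q, φ, hφ, h1, h2, h3, h4, h5⟩ := h
    obtain ⟨p, rfl⟩ := toVec_surjective p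
    obtain ⟨q, rfl⟩ := toVec_surjective q
    obtain ⟨f, rfl⟩ := toVec_surjective φ
    rw [one_smul] at h3
    rw [toVec_ne_zero] at hφ
    -- Labels of type `IsLine` with a common axis need an axis vector with leading coefficient 1.
    -- Scaling the centres by `s` and the axis by `s⁻¹` achieves this and keeps the cross product
    -- relation, because `s² = s⁻¹`.
    set s := lead f with hs
    have hs0 : toF4 s ≠ 0 := by rwa [Ne, toF4_eq_zero]
    have hsc : ∀ t : QVec, elation (toVec t) (toVec f) =
        toElation (scale s t, scale s.inv f) := by
      intro t
      simp only [toElation, toVec_scale, toF4_inv]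
      rw [elation_smul_left hs0, smul_inv_smul₀ hs0]
    have hdot : ∀ t : QVec, toVec t ⬝ᵥ toVec f = 0 → dot (scale s t) (scale s.inv f) = .z := by
      intro t ht
      rw [dot_eq_z, toVec_scale, toVec_scale, smul_dotProduct, dotProduct_smul, ht]
      simp
    have hcr : cross (scale s p) (scale s q) = scale s.inv f := by
      apply toVec_injective
      rw [toVec_cross, toVec_scale, toVec_scale, toVec_scale, map_smul, map_smul,
        LinearMap.smul_apply, h3, smul_smul, toF4_inv]
      congr 1
      apply eq_inv_of_mul_eq_one_left
      linear_combination cube_eq_one hs0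
    have hlf : lead (scale s.inv f) = .u := by
      rw [lead_scale, ← hs]
      revert hφ
      cases s <;> decide
    have hlf' : lead (scale s.inv f) ≠ .z := by rw [hlf]; decide
    have hpq : scale s p ≠ scale s q := by
      intro h
      rw [h, cross_self_eq_zero] at hcr
      rw [← hcr] at hlf
      exact absurd hlf (by decide)
    have hp0 : lead (scale s p) ≠ .z := by
      intro h
      rw [lead_eq_z] at h
      rw [← toVec_injective.eq_iff, toVec_cross, h, toVec_zero, map_zero,
        LinearMap.zero_apply, eq_comm, toVec_eq_zero] at hcr
      rw [hcr] at hlf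
      exact absurd hlf (by decide)
    have hq0 : lead (scale s q) ≠ .z := by
      intro h
      rw [lead_eq_z] at h
      rw [← toVec_injective.eq_iff, toVec_cross, h, toVec_zero, map_zero, eq_comm,
        toVec_eq_zero] at hcr
      rw [hcr] at hlf
      exact absurd hlf (by decide)
    refine Or.inr ⟨scale s.inv f, scale s p, scale s q, hlf, hp0, hq0, hdot p h1, hdot q h2, hcr,
      toElation_injOn ha (valid_norm hp0 hlf' (hdot p h1)) ?_,
      toElation_injOn hb (valid_norm hq0 hlf' (hdot q h2)) ?_,
      toElation_injOn hc (valid_norm (lead_add_ne hpq) hlf'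
        (dot_add_left (hdot p h1) (hdot q h2))) ?_⟩
    · rw [toElation_norm hp0, h4, hsc]
    · rw [toElation_norm hq0, h5, hsc]
    · rw [toElation_norm (lead_add_ne hpq), habc, h4, h5, elation_mul_left h1 h2, ← toVec_add, hsc]
      simp only [toElation, toVec_scale, toVec_add, smul_add]

theorem rel_of_isLine {a b c : ElationLabel} (h : IsLine a b c) :
    (SpreadRel (toElation a) (toElation b) ∨ LineRel (toElation a) (toElation b)) ∧
      toElation c = toElation a * toElation b := by
  rcases h with ⟨p, f, g, ha, hb, h, rfl, rfl, rfl⟩ |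
    ⟨f, p, q, hf, hp, hq, h1, h2, h3, rfl, rfl, rfl⟩
  · rw [valid_iff] at ha hb
    have hp : toVec p ≠ 0 := toVec_ne_zero.2 (by rw [ha.1]; decide)
    have hf := toVec_ne_zero.2 ha.2.1
    have hg := toVec_ne_zero.2 hb.2.1
    have h1 := dot_eq_z.1 ha.2.2
    have h2 := dot_eq_z.1 hb.2.2
    constructor
    · rcases h with ⟨h, h'⟩ | h
      · left
        rw [← toVec_eq_zero, toVec_cross, neg_cross'] at h'
        obtain ⟨c, hc⟩ := exists_smul_of_cross_eq_zero hf h'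
        refine ⟨c, ?_, ?_, _, _, hp, hf, h1, rfl, ?_⟩
        · rintro rfl
          rw [zero_smul] at hc
          exact hg hc
        · rintro rfl
          rw [one_smul, toVec_injective.eq_iff] at hc
          exact h hc.symm
        · rw [← hc]; rfl
      · right; left
        exact ⟨_, _, _, hp, h1, h2, by rw [← toVec_cross, h, one_smul], rfl, rfl⟩
    · simp only [toElation, toVec_add]
      exact (elation_mul_right h1 h2).symm
  · have hpq : p ≠ q := by
      rintro rfl
      rw [cross_self_eq_zero] at h3
      rw [← h3] at hf
      exact absurd hf (by decide)
    rw [toElation_norm hp, toElation_norm hq, toElation_norm (lead_add_ne hpq)]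
    rw [dot_eq_z] at h1 h2
    constructor
    · right; right
      exact ⟨_, _, _, toVec_ne_zero.2 (by rw [hf]; decide), h1, h2,
        by rw [← toVec_cross, h3, one_smul], rfl, rfl⟩
    · simp only [toElation, toVec_add]
      exact (elation_mul_left h1 h2).symm

theorem toVec_fst_ne_zero {a : ElationLabel} (ha : valid a = true) : toVec a.1 ≠ 0 := by
  rw [toVec_ne_zero, (valid_iff.1 ha).1]; decide

theorem toVec_snd_ne_zero {a : ElationLabel} (ha : valid a = true) : toVec a.2 ≠ 0 :=
  toVec_ne_zero.2 (valid_iff.1 ha).2.1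

/-- The centre. -/
noncomputable def centrePt (a : ElationLabel) (ha : valid a = true) : PG2 F4 :=
  Projectivization.mk F4 (toVec a.1) (toVec_fst_ne_zero ha)

/-- The axis. -/
noncomputable def axisPt (a : ElationLabel) (ha : valid a = true) : PG2 F4 :=
  Projectivization.mk F4 (toVec a.2) (toVec_snd_ne_zero ha)

theorem centrePt_orthogonal_axisPt {a : ElationLabel} (ha : valid a = true) :
    (centrePt a ha).orthogonal (axisPt a ha) := by
  rw [centrePt, axisPt, Projectivization.orthogonal_mk]
  exact dot_eq_z.1 (valid_iff.1 ha).2.2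

theorem centrePt_eq_iff {a b : ElationLabel} (ha : valid a = true) (hb : valid b = true) :
    centrePt a ha = centrePt b hb ↔ a.1 = b.1 := by
  rw [centrePt, centrePt, Projectivization.mk_eq_mk_iff']
  constructor
  · rintro ⟨c, hc⟩
    exact eq_of_toVec_eq_smul hc.symm (valid_iff.1 ha).1 (valid_iff.1 hb).1
  · intro h
    exact ⟨1, by rw [one_smul, h]⟩

theorem axisPt_eq_iff {a b : ElationLabel} (ha : valid a = true) (hb : valid b = true) :
    axisPt a ha = axisPt b hb ↔ ∃ c, b.2 = scale c a.2 := by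
  rw [eq_comm, axisPt, axisPt, Projectivization.mk_eq_mk_iff']
  constructor
  · rintro ⟨c, hc⟩
    obtain ⟨c, rfl⟩ := toF4.surjective c
    exact ⟨c, toVec_injective (by rw [toVec_scale, hc])⟩
  · rintro ⟨c, hc⟩
    exact ⟨toF4 c, by rw [hc, toVec_scale]⟩

theorem exists_label {p l : PG2 F4} (h : p.orthogonal l) :
    ∃ a, ∃ ha : valid a = true, centrePt a ha = p ∧ axisPt a ha = l := by
  induction p using Projectivization.ind with
  | h p hp =>
  induction l using Projectivization.ind with
  | h l hl =>
  rw [Projectivization.orthogonal_mk] at h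
  obtain ⟨p, rfl⟩ := toVec_surjective p
  obtain ⟨f, rfl⟩ := toVec_surjective l
  have hp' := toVec_ne_zero.1 hp
  refine ⟨norm (p, f), valid_norm hp' (toVec_ne_zero.1 hl) (dot_eq_z.2 h), ?_, ?_⟩
  · rw [centrePt, Projectivization.mk_eq_mk_iff']
    exact ⟨toF4 (lead p).inv, by rw [← toVec_scale]; rfl⟩
  · rw [axisPt, Projectivization.mk_eq_mk_iff']
    exact ⟨toF4 (lead p), by rw [← toVec_scale]; rfl⟩

/-- Commutation expresses "same centre or same axis" without labels. It allows this condition to be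
carried from one labelling to another, where a correlation may have exchanged the two alternatives.
-/
theorem commute_toElation_iff {a b : ElationLabel} (ha : valid a = true) (hb : valid b = true) :
    Commute (toElation a) (toElation b) ↔
      centrePt a ha = centrePt b hb ∨ axisPt a ha = axisPt b hb := by
  rw [centrePt_eq_iff, axisPt_eq_iff]
  have hda := dot_eq_z.1 (valid_iff.1 ha).2.2
  have hdb := dot_eq_z.1 (valid_iff.1 hb).2.2
  constructor
  · intro h
    by_cases hab : toElation a = toElation b
    · left; rw [toElation_injOn ha hb hab]
    obtain ⟨c, hc, h⟩ := rel_of_commute (isElation_toElation ha) (isElation_toElation hb) hab h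
    obtain ⟨c, rfl⟩ := toF4.surjective c
    rw [centreRel_toElation_iff ha hb, axisRel_toElation_iff ha hb,
      flagRel_toElation_iff ha hb] at h
    rcases h with h | h | h
    · simp only [centre, Bool.and_eq_true, QVec.beq_iff] at h
      exact Or.inl h.1
    · simp only [axis, Bool.and_eq_true, QVec.beq_iff] at h
      exact Or.inr ⟨_, h.1⟩
    · exact Or.inl h.2.1
  · rintro (h | ⟨c, h⟩)
    · rw [← h] at hdb
      rw [commute_iff_eq, toElation, toElation, ← h, elation_mul_right hda hdb,
        elation_mul_right hdb hda, add_comm]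
    · have hc : toF4 c ≠ 0 := by
        intro h0
        apply toVec_snd_ne_zero hb
        rw [h, toVec_scale, h0, zero_smul]
      have h1 : toElation b = elation (toF4 c • toVec b.1) (toVec a.2) := by
        rw [elation_smul_left hc, ← toVec_scale, ← h]
        rfl
      have h2 : (toF4 c • toVec b.1) ⬝ᵥ toVec a.2 = 0 := by
        rw [smul_dotProduct, ← dotProduct_smul, ← toVec_scale, ← h, hdb]
      rw [commute_iff_eq, h1, toElation, elation_mul_left hda h2,
        elation_mul_left h2 hda, add_comm]

theorem spreadRel_iff_same_flag {a b : ElationLabel} (ha : valid a = true)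
    (hb : valid b = true) (hab : a ≠ b) : SpreadRel (toElation a) (toElation b) ↔
      centrePt a ha = centrePt b hb ∧ axisPt a ha = axisPt b hb := by
  rw [centrePt_eq_iff, axisPt_eq_iff, spreadRel_toElation_iff ha hb]
  obtain ⟨p, f⟩ := a
  obtain ⟨q, g⟩ := b
  simp only [spread, Bool.and_eq_true, Bool.or_eq_true, QVec.beq_iff]
  constructor
  · rintro ⟨rfl, h | h⟩
    exacts [⟨rfl, _, h⟩, ⟨rfl, _, h⟩]
  · rintro ⟨rfl, c, h⟩
    refine ⟨rfl, ?_⟩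
    cases c
    · exfalso
      apply (valid_iff.1 hb).2.1
      rw [h, lead_scale]
      rfl
    · exfalso
      apply hab
      rw [h]
      cases f
      rfl
    · exact Or.inl h
    · exact Or.inr h

end ElationLabel

/-! ### Labelled geometries, and the labels of the central involutions -/

open ElationLabel in
/-- Labels for the points of a geometry with a distinguished set `T` of lines and a relation `C`
between its points, which turn the geometry into the geometry of the elations of `PG(2, 4)`. -/
structure Coordinates {P L : Type*} (S : PointLineGeometry P L) (T : Set L) (C : P → P → Prop)
    (lab : P → ElationLabel) : Prop where
  valid : ∀ x, valid (lab x) = true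
  injective : Function.Injective lab
  surjective : ∀ a, ElationLabel.valid a = true → ∃ x, lab x = a
  partialLinear : S.IsPartialLinearSpace
  line : ∀ l, ∃ x y z, IsLine (lab x) (lab y) (lab z) ∧ ∀ t, S.Inc t l ↔ t = x ∨ t = y ∨ t = z
  exists_line : ∀ x y z, IsLine (lab x) (lab y) (lab z) →
    ∃ l, ∀ t, S.Inc t l ↔ t = x ∨ t = y ∨ t = z
  spread : ∀ l x y, S.Inc x l → S.Inc y l → x ≠ y → (l ∈ T ↔
    centrePt _ (valid x) = centrePt _ (valid y) ∧ axisPt _ (valid x) = axisPt _ (valid y))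
  commute : ∀ x y, C x y ↔
    centrePt _ (valid x) = centrePt _ (valid y) ∨ axisPt _ (valid x) = axisPt _ (valid y)

namespace PlaneGroup

open ElationLabel

variable {G : Type*} [Group G]

theorem isElation_apply (e : G ≃* L34Ext) (x : {x : G // IsCentralInvolution x}) :
    IsElation (e x.1) := by
  have : Finite G := Finite.of_equiv _ e.symm.toEquiv
  exact isElation_of_isCentralInvolution (x.2.map e)

/-- The label of a central involution. -/
noncomputable def label (e : G ≃* L34Ext) (x : {x : G // IsCentralInvolution x}) : ElationLabel :=
  (exists_label_of_isElation (isElation_apply e x)).choose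

theorem valid_label (e : G ≃* L34Ext) (x : {x : G // IsCentralInvolution x}) :
    valid (label e x) = true :=
  (exists_label_of_isElation (isElation_apply e x)).choose_spec.1

theorem toElation_label (e : G ≃* L34Ext) (x : {x : G // IsCentralInvolution x}) :
    toElation (label e x) = e x.1 :=
  (exists_label_of_isElation (isElation_apply e x)).choose_spec.2

theorem label_injective (e : G ≃* L34Ext) : Function.Injective (label e) := by
  intro x y h
  apply Subtype.ext
  apply e.injective
  rw [← toElation_label, ← toElation_label, h]

theorem exists_point (e : G ≃* L34Ext) {x : L34Ext} (hx : IsElation x) :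
    ∃ y : {y : G // IsCentralInvolution y}, e y.1 = x := by
  have : Finite G := Finite.of_equiv _ e.symm.toEquiv
  refine ⟨⟨e.symm x, ?_⟩, e.apply_symm_apply x⟩
  rw [← isCentralInvolution_map_iff e, e.apply_symm_apply]
  exact hx.isCentralInvolution

theorem label_eq (e : G ≃* L34Ext) {x : {x : G // IsCentralInvolution x}} {a : ElationLabel}
    (ha : valid a = true) (h : e x.1 = toElation a) : label e x = a :=
  toElation_injOn (valid_label e x) ha (by rw [toElation_label, h])

theorem mul_isElation {x y : L34Ext} (h : SpreadRel x y ∨ LineRel x y) : IsElation (x * y) := by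
  rcases h with h | h
  · exact (isOrbital_spreadRel.elation _ _ (isOrbital_spreadRel.mul _ _ h)).2
  · exact (isOrbital_lineRel.elation _ _ (isOrbital_lineRel.mul _ _ h)).2

theorem ne_of_rel {x y : L34Ext} (h : SpreadRel x y ∨ LineRel x y) : x ≠ y :=
  h.elim isOrbital_spreadRel.ne isOrbital_lineRel.ne

theorem elation_of_rel {x y : L34Ext} (h : SpreadRel x y ∨ LineRel x y) :
    IsElation x ∧ IsElation y :=
  h.elim (isOrbital_spreadRel.elation _ _) (isOrbital_lineRel.elation _ _)

theorem isPartialLinearSpace_involutionGeometry (e : G ≃* L34Ext) :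
    (involutionGeometry G).IsPartialLinearSpace := by
  constructor
  · rintro ⟨l, hl⟩
    obtain ⟨x, y, h, rfl⟩ := (mem_involutionTriples_iff e l).1 hl
    obtain ⟨x', hx⟩ := exists_point e (elation_of_rel h).1
    obtain ⟨y', hy⟩ := exists_point e (elation_of_rel h).2
    rw [e.injective.eq_iff] at hx hy
    refine ⟨x', y', ?_, ?_, ?_⟩
    · rintro rfl
      rw [← hx, ← hy] at h
      exact ne_of_rel h rfl
    · change x'.1 ∈ ({x, y, x * y} : Set G)
      simp [hx]
    · change y'.1 ∈ ({x, y, x * y} : Set G)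
      simp [hy]
  · rintro x y hxy ⟨l, hl⟩ ⟨m, hm⟩ hxl hyl hxm hym
    have hxy' : x.1 ≠ y.1 := fun h => hxy (Subtype.ext h)
    apply Subtype.ext
    change l = m
    rw [(isLine_cases e hl hxl hyl hxy').2, (isLine_cases e hm hxm hym hxy').2]

theorem coordinates_involutionGeometry (e : G ≃* L34Ext) :
    Coordinates (involutionGeometry G) (involutionSpread G) (fun x y => Commute x.1 y.1)
      (label e) where
  valid := valid_label e
  injective := label_injective e
  surjective a ha := by
    obtain ⟨x, hx⟩ := exists_point e (isElation_toElation ha)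
    exact ⟨x, label_eq e ha hx⟩
  partialLinear := isPartialLinearSpace_involutionGeometry e
  line := by
    rintro ⟨l, hl⟩
    obtain ⟨x, y, h, rfl⟩ := (mem_involutionTriples_iff e l).1 hl
    obtain ⟨x', hx⟩ := exists_point e (elation_of_rel h).1
    obtain ⟨y', hy⟩ := exists_point e (elation_of_rel h).2
    obtain ⟨z', hz⟩ := exists_point e (mul_isElation h)
    rw [← map_mul, e.injective.eq_iff] at hz
    rw [e.injective.eq_iff] at hx hy
    subst hx hy
    refine ⟨x', y', z', ?_, ?_⟩
    · apply isLine_of_rel (valid_label e _) (valid_label e _) (valid_label e _)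
      · rwa [toElation_label, toElation_label]
      · rw [toElation_label, toElation_label, toElation_label, hz, map_mul]
    · intro t
      change t.1 ∈ ({x'.1, y'.1, x'.1 * y'.1} : Set G) ↔ _
      rw [← hz, Subtype.ext_iff, Subtype.ext_iff, Subtype.ext_iff]
      simp
  exists_line x y z h := by
    have h1 := rel_of_isLine h
    simp only [toElation_label] at h1
    rw [← map_mul, e.injective.eq_iff] at h1
    refine ⟨⟨{x.1, y.1, x.1 * y.1}, (mem_involutionTriples_iff e _).2 ⟨_, _, h1.1, rfl⟩⟩, ?_⟩
    intro t
    change t.1 ∈ ({x.1, y.1, x.1 * y.1} : Set G) ↔ _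
    rw [← h1.2, Subtype.ext_iff, Subtype.ext_iff, Subtype.ext_iff]
    simp
  spread := by
    rintro ⟨l, hl⟩ x y hxl hyl hxy
    have hxy' : x.1 ≠ y.1 := fun h => hxy (Subtype.ext h)
    rw [← spreadRel_iff_same_flag _ _ ((label_injective e).ne hxy), toElation_label,
      toElation_label]
    change l ∈ involutionTriples G {105} ↔ _
    rw [mem_involutionTriples_spread_iff e]
    constructor
    · rintro ⟨u, v, h, rfl⟩
      exact (isOrbital_spreadRel.of_mem e h hxl hyl hxy').1
    · intro h
      exact ⟨x, y, h, (isLine_cases e hl hxl hyl hxy').2⟩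
  commute x y := by
    rw [← commute_toElation_iff, toElation_label, toElation_label, commute_iff_eq, commute_iff_eq,
      ← map_mul, ← map_mul, e.injective.eq_iff]

/-- Composing the isomorphism with an inner automorphism relabels the geometry so that any given
involution becomes the base elation. Facts computed at the base thereby hold at every point. -/
theorem exists_coordinates_base (e : G ≃* L34Ext) (x : {x : G // IsCentralInvolution x}) :
    ∃ lab, Coordinates (involutionGeometry G) (involutionSpread G)
      (fun x y => Commute x.1 y.1) lab ∧ lab x = base := by
  obtain ⟨g, hg⟩ := (isElation_apply e x).exists_conj_eq_base
  refine ⟨label (e.trans (MulAut.conj g)), coordinates_involutionGeometry _, ?_⟩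
  apply label_eq _ valid_base
  rw [toElation_base, ← hg]
  rfl

end PlaneGroup

/-! ### Near polygons from functions that behave like distances -/

namespace PointLineGeometry

section Level

variable {P L : Type*} {S : PointLineGeometry P L}

/-- A function on the points that has the properties of the distance to `x` in a near polygon. -/
structure IsLevel (S : PointLineGeometry P L) (x : P) (d : P → ℕ) : Prop where
  zero : d x = 0
  line : ∀ l, ∃ y, S.Inc y l ∧ ∀ z, S.Inc z l → z ≠ y → d z = d y + 1
  descent : ∀ y, y ≠ x → ∃ z, S.collinearityGraph.Adj y z ∧ d z < d y

variable {x : P} {d : P → ℕ}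

theorem IsLevel.le_add_one (h : S.IsLevel x d) {y z : P} (hyz : S.collinearityGraph.Adj y z) :
    d y ≤ d z + 1 := by
  obtain ⟨hne, l, hy, hz⟩ := hyz
  obtain ⟨w, -, hw⟩ := h.line l
  by_cases h1 : y = w
  · subst h1
    have := hw z hz hne.symm
    omega
  · have h2 := hw y hy h1
    by_cases h3 : z = w
    · subst h3; omega
    · have := hw z hz h3; omega

theorem IsLevel.exists_walk (h : S.IsLevel x d) (y : P) :
    ∃ w : S.collinearityGraph.Walk y x, w.length = d y := by
  induction hn : d y using Nat.strong_induction_on generalizing y with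
  | _ n ih =>
    by_cases hyx : y = x
    · subst hyx
      exact ⟨SimpleGraph.Walk.nil, by rw [← hn, h.zero]; rfl⟩
    · obtain ⟨z, hz, hlt⟩ := h.descent y hyx
      obtain ⟨w, hw⟩ := ih (d z) (hn ▸ hlt) z rfl
      refine ⟨SimpleGraph.Walk.cons hz w, ?_⟩
      have := h.le_add_one hz
      rw [SimpleGraph.Walk.length_cons, hw]
      omega

theorem IsLevel.le_length (h : S.IsLevel x d) {y : P} (w : S.collinearityGraph.Walk y x) :
    d y ≤ w.length := by
  induction w with
  | nil => rw [h.zero]; exact Nat.zero_le _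
  | cons hadj w ih =>
    have h1 := h.le_add_one hadj
    have h2 := ih h
    rw [SimpleGraph.Walk.length_cons]
    omega

theorem IsLevel.reachable (h : S.IsLevel x d) (y : P) : S.collinearityGraph.Reachable x y := by
  obtain ⟨w, -⟩ := h.exists_walk y
  exact w.reachable.symm

/-- Adjacent points have levels differing by at most 1, so no walk to `x` is shorter than the level.
Descending repeatedly gives a walk of exactly this length. -/
theorem IsLevel.dist_eq (h : S.IsLevel x d) (y : P) : S.collinearityGraph.dist x y = d y := by
  rw [SimpleGraph.dist_comm]
  apply le_antisymm
  · obtain ⟨w, hw⟩ := h.exists_walk y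
    rw [← hw]
    exact SimpleGraph.dist_le w
  · obtain ⟨w, hw⟩ := (h.reachable y).symm.exists_walk_length_eq_dist
    rw [← hw]
    exact h.le_length w

theorem IsLevel.existsUnique_isNearest (h : S.IsLevel x d) (l : L) : ∃! y, S.IsNearest x l y := by
  obtain ⟨y, hy, hl⟩ := h.line l
  refine ⟨y, ⟨hy, fun z hz => ?_⟩, fun z hz => ?_⟩
  · rw [h.dist_eq, h.dist_eq]
    by_cases hzy : z = y
    · rw [hzy]
    · rw [hl z hz hzy]; omega
  · by_contra hzy
    have h1 := hz.2 y hy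
    rw [h.dist_eq, h.dist_eq, hl z hz.1 hzy] at h1
    omega

theorem isNearPolygon_of_isLevel {n : ℕ} (hS : S.IsPartialLinearSpace)
    (h : ∀ x, ∃ d, S.IsLevel x d ∧ ∀ y, d y ≤ n)
    (h' : ∃ x d y, S.IsLevel x d ∧ d y = n) : S.IsNearPolygon n := by
  have hconn : S.collinearityGraph.Connected := by
    obtain ⟨x, -⟩ := h'
    obtain ⟨d, hd, -⟩ := h x
    have : Nonempty P := ⟨x⟩
    exact ⟨fun y z => (hd.reachable y).symm.trans (hd.reachable z)⟩
  refine ⟨hS, hconn, le_antisymm ?_ ?_, fun x l => ?_⟩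
  · apply SimpleGraph.ediam_le_of_edist_le
    intro x y
    obtain ⟨d, hd, hn⟩ := h x
    rw [← (hconn x y).coe_dist_eq_edist, hd.dist_eq]
    exact_mod_cast hn y
  · obtain ⟨x, d, y, hd, hy⟩ := h'
    rw [← hy, ← hd.dist_eq, (hconn x y).coe_dist_eq_edist]
    exact SimpleGraph.edist_le_ediam
  · obtain ⟨d, hd, -⟩ := h x
    exact hd.existsUnique_isNearest l

end Level

/-! ### Quads in near polygons -/

section Quad

variable {P L : Type*} {S : PointLineGeometry P L}

theorem IsNearPolygon.lt_dist {n : ℕ} (hS : S.IsNearPolygon n) {x y z : P} {l : L}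
    (hy : S.IsNearest x l y) (hz : S.Inc z l) (hzy : z ≠ y) :
    S.collinearityGraph.dist x y < S.collinearityGraph.dist x z := by
  refine lt_of_le_of_ne (hy.2 z hz) fun h => hzy ?_
  exact (hS.2.2.2 x l).unique ⟨hz, fun w hw => h ▸ hy.2 w hw⟩ hy

theorem dist_eq_one {x y : P} (h : S.collinearityGraph.Adj x y) :
    S.collinearityGraph.dist x y = 1 := SimpleGraph.dist_eq_one_iff_adj.2 h

/-- There are no triangles in a near polygon. -/
theorem IsNearPolygon.inc_of_adj {n : ℕ} (hS : S.IsNearPolygon n) {x y z : P} {l : L}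
    (hy : S.Inc y l) (hz : S.Inc z l) (hyz : y ≠ z) (hxy : S.collinearityGraph.Adj x y)
    (hxz : S.collinearityGraph.Adj x z) : S.Inc x l := by
  obtain ⟨w, hw, -⟩ := hS.2.2.2 x l
  have h1 := dist_eq_one hxy
  have h2 := dist_eq_one hxz
  have h3 : S.collinearityGraph.dist x w = 0 := by
    by_cases hyw : y = w
    · subst hyw
      have := hS.lt_dist hw hz hyz.symm
      omega
    · have := hS.lt_dist hw hy hyw
      omega
  rw [(hS.2.1 x w).dist_eq_zero_iff] at h3
  rw [h3]
  exact hw.1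

theorem induced_adj {Q : Set P} (hQ : S.IsSubspace Q) {x y : {x // x ∈ Q}} :
    (S.induced Q).collinearityGraph.Adj x y ↔ S.collinearityGraph.Adj x.1 y.1 := by
  constructor
  · rintro ⟨h, l, hx, hy⟩
    exact ⟨fun h' => h (Subtype.ext h'), l.1, hx, hy⟩
  · rintro ⟨h, l, hx, hy⟩
    exact ⟨fun h' => h (congrArg Subtype.val h'),
      ⟨l, fun z hz => hQ x.1 x.2 y.1 y.2 h l hx hy z hz⟩, hx, hy⟩

theorem IsQuad.existsUnique_adj {Q : Set P} (hQ : S.IsQuad Q) {x : P} (hx : x ∈ Q) {l : L}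
    (hl : S.LineIn Q l) (hxl : ¬ S.Inc x l) :
    ∃! y, S.Inc y l ∧ S.collinearityGraph.Adj x y := by
  obtain ⟨y, ⟨h1, h2⟩, h3⟩ := hQ.2.2.2.2 ⟨x, hx⟩ ⟨l, hl⟩ hxl
  refine ⟨y.1, ⟨h1, (induced_adj hQ.1.1).1 h2⟩, ?_⟩
  rintro z ⟨hz1, hz2⟩
  exact congrArg Subtype.val (h3 ⟨z, hl z hz1⟩ ⟨hz1, (induced_adj hQ.1.1).2 hz2⟩)

theorem IsQuad.exists_two_lines {Q : Set P} (hQ : S.IsQuad Q) {x : P} (hx : x ∈ Q) :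
    ∃ l m, l ≠ m ∧ S.LineIn Q l ∧ S.LineIn Q m ∧ S.Inc x l ∧ S.Inc x m := by
  obtain ⟨l, m, hlm, h1, h2⟩ := hQ.2.2.2.1 ⟨x, hx⟩
  exact ⟨l.1, m.1, fun h => hlm (Subtype.ext h), l.2, m.2, h1, h2⟩

theorem IsQuad.lineIn {Q : Set P} (hQ : S.IsQuad Q) {x y : P} (hx : x ∈ Q) (hy : y ∈ Q)
    (hxy : x ≠ y) {l : L} (hxl : S.Inc x l) (hyl : S.Inc y l) : S.LineIn Q l :=
  fun z hz => hQ.1.1 x hx y hy hxy l hxl hyl z hz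

theorem IsQuad.mem_of_adj_adj {Q : Set P} (hQ : S.IsQuad Q) {x y z : P} (hx : x ∈ Q)
    (hy : y ∈ Q) (hxz : S.collinearityGraph.Adj x z) (hzy : S.collinearityGraph.Adj z y)
    (hxy : ¬ S.collinearityGraph.Adj x y) (hne : x ≠ y) : z ∈ Q := by
  let w : S.collinearityGraph.Walk x y := .cons hxz (.cons hzy .nil)
  refine hQ.1.2 x hx y hy w ?_ z (by simp [w])
  have h1 : w.length = 2 := rfl
  have h2 := SimpleGraph.dist_le w
  have h3 : S.collinearityGraph.dist x y ≠ 0 := by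
    rwa [Ne, w.reachable.dist_eq_zero_iff]
  have h4 : S.collinearityGraph.dist x y ≠ 1 := by
    rwa [Ne, SimpleGraph.dist_eq_one_iff_adj]
  omega

theorem exists_other_point (hS : S.IsPartialLinearSpace) (x : P) (l : L) :
    ∃ y, y ≠ x ∧ S.Inc y l := by
  obtain ⟨y, z, hyz, hy, hz⟩ := hS.1 l
  by_cases h : y = x
  · exact ⟨z, fun h' => hyz (h.trans h'.symm), hz⟩
  · exact ⟨y, h, hy⟩

/-- A quad that is contained in another one is equal to it. -/
theorem IsQuad.eq_of_subset (hS : S.IsPartialLinearSpace) {Q Q' : Set P} (hQ : S.IsQuad Q)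
    (hQ' : S.IsQuad Q') (hsub : Q ⊆ Q') : Q = Q' := by
  apply Set.Subset.antisymm hsub
  intro w hw
  obtain ⟨⟨x, hx⟩⟩ := hQ.2.1
  obtain ⟨l, m, hlm, hl, hm, hxl, hxm⟩ := hQ.exists_two_lines hx
  have lineIn' : ∀ {k}, S.LineIn Q k → S.LineIn Q' k := fun hk z hz => hsub (hk z hz)
  -- Suppose `w` is in the larger quad only. On every line of the smaller quad `w` has one
  -- neighbour, and by convexity any two of these neighbours are collinear. Choosing a neighbour `u`
  -- and a line of the smaller quad that misses `u` yields a second neighbour `t`; the line joining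
  -- `u` and `t` then contains two neighbours of `w`, which is impossible.
  by_contra hwQ
  have not_inc : ∀ {k}, S.LineIn Q k → ¬ S.Inc w k := fun hk h => hwQ (hk w h)
  -- a point collinear with two noncollinear points of the smaller quad is in this quad
  have key : ∀ u v, u ∈ Q → v ∈ Q → u ≠ v → S.collinearityGraph.Adj w u →
      S.collinearityGraph.Adj w v → S.collinearityGraph.Adj u v := by
    intro u v hu hv huv h1 h2
    by_contra h3
    exact hwQ (hQ.mem_of_adj_adj hu hv h1.symm h2 h3 huv)
  obtain ⟨u, ⟨hul, hwu⟩, -⟩ := hQ'.existsUnique_adj hw (lineIn' hl) (not_inc hl)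
  -- another line through `u`
  obtain ⟨k, hk, hku, hkl⟩ : ∃ k, S.LineIn Q k ∧ S.Inc u k ∧ k ≠ l := by
    obtain ⟨k, k', hkk, hk, hk', huk, huk'⟩ := hQ.exists_two_lines (hl u hul)
    by_cases h : k = l
    · exact ⟨k', hk', huk', fun h' => hkk (h.trans h'.symm)⟩
    · exact ⟨k, hk, huk, h⟩
  obtain ⟨v, hvu, hvk⟩ := exists_other_point hS u k
  have hvQ := hk v hvk
  have hvl : ¬ S.Inc v l := fun h => hkl (hS.2 v u hvu k l hvk hku h hul)
  -- another line through `v`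
  obtain ⟨n, hn, hvn, hnk⟩ : ∃ n, S.LineIn Q n ∧ S.Inc v n ∧ n ≠ k := by
    obtain ⟨n, n', hnn, hn, hn', hvn, hvn'⟩ := hQ.exists_two_lines hvQ
    by_cases h : n = k
    · exact ⟨n', hn', hvn', fun h' => hnn (h.trans h'.symm)⟩
    · exact ⟨n, hn, hvn, h⟩
  have hun : ¬ S.Inc u n := fun h => hnk (hS.2 v u hvu n k hvn h hvk hku)
  obtain ⟨t, ⟨htn, hwt⟩, -⟩ := hQ'.existsUnique_adj hw (lineIn' hn) (not_inc hn)
  have htQ := hn t htn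
  have hut : u ≠ t := by rintro rfl; exact hun htn
  have hadj := key u t (hl u hul) htQ hut hwu hwt
  obtain ⟨-, j, huj, htj⟩ := hadj
  have hj := hQ.lineIn (hl u hul) htQ hut huj htj
  exact hut ((hQ'.existsUnique_adj hw (lineIn' hj) (not_inc hj)).unique ⟨huj, hwu⟩ ⟨htj, hwt⟩)

end Quad

/-! ### Points marked by flags: the spread and the classification of quads -/

/-- A near polygon with a flag (a centre and an axis) attached to every point. -/
structure IsFlagMarking {P L X : Type*} (S : PointLineGeometry P L) (T : Set L) (κ κ' : P → X) :
    Prop where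
  line : ∀ l, (∀ x y, S.Inc x l → S.Inc y l → κ x = κ y) ∨
    (∀ x y, S.Inc x l → S.Inc y l → κ' x = κ' y)
  adj : ∀ x y, x ≠ y → κ x = κ y → κ' x = κ' y → S.collinearityGraph.Adj x y
  dist_le : ∀ x y, κ x = κ y → S.collinearityGraph.dist x y ≤ 2
  dist_le' : ∀ x y, κ' x = κ' y → S.collinearityGraph.dist x y ≤ 2
  exists_adj : ∀ x, ∃ y, S.collinearityGraph.Adj x y ∧ κ y = κ x ∧ κ' y ≠ κ' x
  exists_adj' : ∀ x, ∃ y, S.collinearityGraph.Adj x y ∧ κ' y = κ' x ∧ κ y ≠ κ x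
  exists_flag : ∀ x, ∃ y, y ≠ x ∧ κ y = κ x ∧ κ' y = κ' x
  rectangle : ∀ x y z w, κ x = κ y → κ' x = κ' z → κ w = κ z → κ' w = κ' y →
    κ x = κ z ∨ κ' x = κ' y
  spread : ∀ l x y, S.Inc x l → S.Inc y l → x ≠ y → (l ∈ T ↔ κ x = κ y ∧ κ' x = κ' y)

namespace IsFlagMarking

variable {P L X : Type*} {S : PointLineGeometry P L} {T : Set L} {κ κ' : P → X} {n : ℕ}

theorem swap (h : S.IsFlagMarking T κ κ') : S.IsFlagMarking T κ' κ where
  line l := (h.line l).symm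
  adj x y hxy h1 h2 := h.adj x y hxy h2 h1
  dist_le := h.dist_le'
  dist_le' := h.dist_le
  exists_adj := h.exists_adj'
  exists_adj' := h.exists_adj
  exists_flag x := (h.exists_flag x).imp fun _ hy => ⟨hy.1, hy.2.2, hy.2.1⟩
  rectangle x y z w h1 h2 h3 h4 := (h.rectangle x z y w h2 h1 h4 h3).symm
  spread l x y hx hy hxy := by rw [h.spread l x y hx hy hxy, and_comm]

theorem eq_or_eq_of_adj (h : S.IsFlagMarking T κ κ') {x y : P}
    (hxy : S.collinearityGraph.Adj x y) : κ x = κ y ∨ κ' x = κ' y := by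
  obtain ⟨-, l, hx, hy⟩ := hxy
  exact (h.line l).imp (fun h => h x y hx hy) fun h => h x y hx hy

theorem flag_eq_of_mem (h : S.IsFlagMarking T κ κ') {l : L} (hl : l ∈ T) {x y : P}
    (hx : S.Inc x l) (hy : S.Inc y l) : κ x = κ y ∧ κ' x = κ' y := by
  by_cases hxy : x = y
  · subst hxy; exact ⟨rfl, rfl⟩
  · exact (h.spread l x y hx hy hxy).1 hl

theorem isSubspace (h : S.IsFlagMarking T κ κ') (p : X) : S.IsSubspace {x | κ x = p} := by
  intro x hx y hy hxy l hxl hyl z hz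
  rcases h.line l with hl | hl
  · exact (hl z x hz hxl).trans hx
  · have hT : l ∈ T := (h.spread l x y hxl hyl hxy).2 ⟨hx.trans hy.symm, hl x y hxl hyl⟩
    exact (h.flag_eq_of_mem hT hz hxl).1.trans hx

/-- Distances within the set are at most 2, so only the midpoint of a path of length 2 matters. If
both steps left the value of `κ`, both would keep `κ'`; the end points would carry the same flag and
be adjacent or equal. -/
theorem isConvexSubspace (h : S.IsFlagMarking T κ κ') (p : X) :
    S.IsConvexSubspace {x | κ x = p} := by
  refine ⟨h.isSubspace p, ?_⟩
  intro x hx y hy w hw z hz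
  have h2 := h.dist_le x y (hx.trans hy.symm)
  rw [← hw] at h2
  match w with
  | .nil =>
    simp at hz; rw [hz]; exact hx
  | .cons h1 .nil =>
    simp at hz
    rcases hz with rfl | rfl
    exacts [hx, hy]
  | .cons (v := m) h1 (.cons h3 .nil) =>
    simp at hz
    rcases hz with rfl | rfl | rfl
    · exact hx
    · rcases h.eq_or_eq_of_adj h1 with h5 | h5
      · exact h5.symm.trans hx
      rcases h.eq_or_eq_of_adj h3 with h6 | h6
      · exact h6.trans hy
      exfalso
      simp at hw
      by_cases hxy : x = y
      · subst hxy
        simp at hw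
      · have := dist_eq_one (h.adj x y hxy (hx.trans hy.symm) (h5.trans h6))
        omega
    · exact hy
  | .cons h1 (.cons h3 (.cons h4 w)) =>
    simp at h2

theorem exists_mem_spread (h : S.IsFlagMarking T κ κ') (x : P) : ∃ l ∈ T, S.Inc x l := by
  obtain ⟨y, hyx, h1, h2⟩ := h.exists_flag x
  obtain ⟨-, l, hy, hx⟩ := h.adj y x hyx h1 h2
  exact ⟨l, (h.spread l y x hy hx hyx).2 ⟨h1, h2⟩, hx⟩

/-- Points with the same flag are pairwise adjacent, and a near polygon has no triangles outside its
lines, so they all lie on one line. -/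
theorem isLineSpread (h : S.IsFlagMarking T κ κ') (hS : S.IsNearPolygon n) :
    S.IsLineSpread T := by
  intro x
  obtain ⟨l, hl, hx⟩ := h.exists_mem_spread x
  refine ⟨l, ⟨hl, hx⟩, ?_⟩
  rintro m ⟨hm, hxm⟩
  obtain ⟨y, hyx, hy⟩ := exists_other_point hS.1 x l
  obtain ⟨z, hzx, hz⟩ := exists_other_point hS.1 x m
  have h1 := h.flag_eq_of_mem hl hy hx
  have h2 := h.flag_eq_of_mem hm hz hxm
  by_cases hyz : y = z
  · subst hyz
    exact hS.1.2 x y hyx.symm m l hxm hz hx hy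
  · have h3 := hS.inc_of_adj hxm hz hzx.symm ⟨hyx, l, hy, hx⟩
      (h.adj y z hyz (h1.1.trans h2.1.symm) (h1.2.trans h2.2.symm))
    exact hS.1.2 x y hyx.symm m l hxm h3 hx hy

/-- The points of the set are at mutual distance at most 2. Hence the nearest point of a line that
misses `x` is closer than 2, so it is adjacent to `x`, and uniqueness of nearest points gives the
quadrangle axiom. -/
theorem isQuad (h : S.IsFlagMarking T κ κ') (hS : S.IsNearPolygon n) (x₀ : P) :
    S.IsQuad {x | κ x = κ x₀} := by
  have hsub := h.isSubspace (κ x₀)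
  refine ⟨h.isConvexSubspace _, ⟨x₀, rfl⟩, ⟨?_, ?_⟩, ?_, ?_⟩
  · rintro ⟨l, hl⟩
    obtain ⟨x, y, hxy, hx, hy⟩ := hS.1.1 l
    exact ⟨⟨x, hl x hx⟩, ⟨y, hl y hy⟩, fun h => hxy (congrArg Subtype.val h), hx, hy⟩
  · intro x y hxy l m hxl hyl hxm hym
    exact Subtype.ext (hS.1.2 x.1 y.1 (fun h => hxy (Subtype.ext h)) l.1 m.1 hxl hyl hxm hym)
  · rintro ⟨x, hx⟩
    obtain ⟨l, hl, hxl⟩ := h.exists_mem_spread x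
    obtain ⟨y, ⟨hxy, m, hxm, hym⟩, h1, h2⟩ := h.exists_adj x
    refine ⟨⟨l, fun z hz => (h.flag_eq_of_mem hl hz hxl).1.trans hx⟩,
      ⟨m, hsub x hx y (h1.trans hx) hxy m hxm hym⟩, ?_, hxl, hxm⟩
    intro hlm
    have hlm' : l = m := congrArg Subtype.val hlm
    rw [hlm'] at hl
    exact h2 (h.flag_eq_of_mem hl hym hxm).2
  · rintro ⟨x, hx⟩ ⟨l, hl⟩ hxl
    change ¬ S.Inc x l at hxl
    obtain ⟨y, hy, huniq⟩ := hS.2.2.2 x l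
    have hadj : S.collinearityGraph.Adj x y := by
      rw [← SimpleGraph.dist_eq_one_iff_adj]
      obtain ⟨z, hzy, hz⟩ := exists_other_point hS.1 y l
      have h1 := hS.lt_dist hy hz hzy
      have h2 := h.dist_le x z (hx.trans (hl z hz).symm)
      have h3 : S.collinearityGraph.dist x y ≠ 0 := by
        rw [Ne, (hS.2.1 x y).dist_eq_zero_iff]
        rintro rfl
        exact hxl hy.1
      omega
    refine ⟨⟨y, hl y hy.1⟩, ⟨hy.1, (induced_adj hsub).2 hadj⟩, ?_⟩
    rintro ⟨z, hz⟩ ⟨hz1, hz2⟩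
    apply Subtype.ext
    by_contra hzy
    have h1 := hS.lt_dist hy hz1 hzy
    rw [dist_eq_one hadj, dist_eq_one ((induced_adj hsub).1 hz2)] at h1
    omega

/-- Here `y` shares only `κ` with `x`, and `z` shares only `κ'`. A common neighbour `w` of `y` and
`z` could carry the flag of `x`; if it were not `x`, the spread line through `x` and `w` would
contain `y`, as there are no triangles. The other possibility completes a rectangle of flags, which
does not exist. -/
theorem eq_of_adj_adj (h : S.IsFlagMarking T κ κ') (hS : S.IsNearPolygon n) {x y z w : P}
    (hxy : S.collinearityGraph.Adj x y) (h1 : κ y = κ x) (h2 : κ' y ≠ κ' x)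
    (h3 : κ' z = κ' x) (h4 : κ z ≠ κ x)
    (hyw : κ y = κ w ∨ κ' y = κ' w) (hyw' : y ≠ w → S.collinearityGraph.Adj y w)
    (hzw : κ z = κ w ∨ κ' z = κ' w) : w = x := by
  rcases hyw with h5 | h5 <;> rcases hzw with h6 | h6
  · exact absurd (h6.trans (h5.symm.trans h1)) h4
  · by_contra hne
    have h7 : κ w = κ x := h5.symm.trans h1
    have h8 : κ' w = κ' x := h6.symm.trans h3
    obtain ⟨-, l, hw, hx⟩ := h.adj w x hne h7 h8
    have hl : l ∈ T := (h.spread l w x hw hx hne).2 ⟨h7, h8⟩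
    have hyw : y ≠ w := by rintro rfl; exact h2 h8
    have h9 := hS.inc_of_adj hw hx hne (hyw' hyw) hxy.symm
    exact h2 (h.flag_eq_of_mem hl h9 hx).2
  · rcases h.rectangle x y z w h1.symm h3.symm h6.symm h5.symm with h7 | h7
    · exact absurd h7.symm h4
    · exact absurd h7.symm h2
  · exact absurd (h5.trans (h6.symm.trans h3)) h2

/-- In a quad containing `x`, `y` and `z`, take a second line through `z` and the neighbour of `y`
on it. By `eq_of_adj_adj` this neighbour is `x`, so the line joins `x` and `z` after all. -/
theorem not_mem_quad (h : S.IsFlagMarking T κ κ') (hS : S.IsNearPolygon n) {Q : Set P}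
    (hQ : S.IsQuad Q) {x y z : P} (hx : x ∈ Q) (hy : y ∈ Q) (hxy : S.collinearityGraph.Adj x y)
    (h1 : κ y = κ x) (h2 : κ' y ≠ κ' x) (hxz : S.collinearityGraph.Adj x z)
    (h3 : κ' z = κ' x) (h4 : κ z ≠ κ x) : z ∉ Q := by
  intro hz
  have hyz : ¬ S.collinearityGraph.Adj y z := by
    intro hyz
    have := h.eq_of_adj_adj (w := z) hS hxy h1 h2 h3 h4 (h.eq_or_eq_of_adj hyz)
      (fun _ => hyz) (Or.inl rfl)
    exact hxz.1 this.symm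
  obtain ⟨hne, l, hxl, hzl⟩ := hxz
  obtain ⟨m, hm, hzm, hml⟩ : ∃ m, S.LineIn Q m ∧ S.Inc z m ∧ m ≠ l := by
    obtain ⟨m, m', hmm, hm, hm', hzm, hzm'⟩ := hQ.exists_two_lines hz
    by_cases h : m = l
    · exact ⟨m', hm', hzm', fun h' => hmm (h.trans h'.symm)⟩
    · exact ⟨m, hm, hzm, h⟩
  have hyz' : y ≠ z := by rintro rfl; exact h4 h1
  have hym : ¬ S.Inc y m := fun hym => hyz ⟨hyz', m, hym, hzm⟩
  obtain ⟨w, ⟨hwm, hyw⟩, -⟩ := hQ.existsUnique_adj hy hm hym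
  have hzw : z ≠ w := by rintro rfl; exact hyz hyw
  have := h.eq_of_adj_adj (w := w) hS hxy h1 h2 h3 h4 (h.eq_or_eq_of_adj hyw)
    (fun _ => hyw) (h.eq_or_eq_of_adj ⟨hzw, m, hzm, hwm⟩)
  subst this
  exact hml (hS.1.2 w z hne m l hwm hzm hxl hzl)

/-- Outside the line `xy`, a point `w` of the quad has a neighbour `v` on this line. A change of `κ`
from `v` to `w` would produce the configuration excluded by `not_mem_quad`, centred at `v`. -/
theorem quad_subset (h : S.IsFlagMarking T κ κ') (hS : S.IsNearPolygon n) {Q : Set P}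
    (hQ : S.IsQuad Q) {x y : P} (hx : x ∈ Q) (hy : y ∈ Q) (hxy : S.collinearityGraph.Adj x y)
    (h2 : κ' y ≠ κ' x) : Q ⊆ {w | κ w = κ x} := by
  obtain ⟨hne, l, hxl, hyl⟩ := hxy
  have hl := hQ.lineIn hx hy hne hxl hyl
  have hlκ : ∀ u, S.Inc u l → κ u = κ x := by
    rcases h.line l with h3 | h3
    · exact fun u hu => h3 u x hu hxl
    · exact absurd (h3 y x hyl hxl) h2
  have hlT : l ∉ T := fun hT => h2 (h.flag_eq_of_mem hT hyl hxl).2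
  intro w hw
  by_cases hwl : S.Inc w l
  · exact hlκ w hwl
  obtain ⟨v, ⟨hvl, hwv⟩, -⟩ := hQ.existsUnique_adj hw hl hwl
  obtain ⟨u, huv, hul⟩ := exists_other_point hS.1 v l
  have hκ : κ u = κ v := (hlκ u hul).trans (hlκ v hvl).symm
  have hκ' : κ' u ≠ κ' v := fun h5 => hlT ((h.spread l u v hul hvl huv).2 ⟨hκ, h5⟩)
  by_contra hwx
  change ¬ κ w = κ x at hwx
  rw [← hlκ v hvl] at hwx
  exact h.not_mem_quad hS hQ (hl v hvl) (hl u hul) ⟨huv.symm, l, hvl, hul⟩ hκ hκ' hwv.symm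
    ((h.eq_or_eq_of_adj hwv).resolve_left hwx) hwx hw

/-- A point of a quad lies on two of its lines, and at most one of them is in the spread. The other
one keeps exactly one of `κ` and `κ'`, which decides the type; a quad properly inside another is
impossible. -/
theorem quad_eq (h : S.IsFlagMarking T κ κ') (hS : S.IsNearPolygon n) {Q : Set P}
    (hQ : S.IsQuad Q) : ∃ x, Q = {y | κ y = κ x} ∨ Q = {y | κ' y = κ' x} := by
  obtain ⟨⟨x, hx⟩⟩ := hQ.2.1
  refine ⟨x, ?_⟩
  obtain ⟨l, hl, hlT, hxl⟩ : ∃ l, S.LineIn Q l ∧ l ∉ T ∧ S.Inc x l := by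
    obtain ⟨l, m, hlm, hl, hm, hxl, hxm⟩ := hQ.exists_two_lines hx
    by_cases hlT : l ∈ T
    · exact ⟨m, hm, fun hmT => hlm ((h.isLineSpread hS x).unique ⟨hlT, hxl⟩ ⟨hmT, hxm⟩), hxm⟩
    · exact ⟨l, hl, hlT, hxl⟩
  obtain ⟨y, hyx, hyl⟩ := exists_other_point hS.1 x l
  have hadj : S.collinearityGraph.Adj x y := ⟨hyx.symm, l, hxl, hyl⟩
  have hns : ¬ (κ y = κ x ∧ κ' y = κ' x) := fun h1 => hlT ((h.spread l y x hyl hxl hyx).2 h1)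
  rcases h.eq_or_eq_of_adj hadj with h1 | h1
  · left
    exact hQ.eq_of_subset hS.1 (h.isQuad hS x)
      (h.quad_subset hS hQ hx (hl y hyl) hadj fun h2 => hns ⟨h1.symm, h2⟩)
  · right
    exact hQ.eq_of_subset hS.1 (h.swap.isQuad hS x)
      (h.swap.quad_subset hS hQ hx (hl y hyl) hadj fun h2 => hns ⟨h2, h1.symm⟩)

theorem lineIn_quad_of_mem (h : S.IsFlagMarking T κ κ') (hS : S.IsNearPolygon n) {Q : Set P}
    (hQ : S.IsQuad Q) {x : P} (hx : x ∈ Q) {l : L} (hl : l ∈ T) (hxl : S.Inc x l) :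
    S.LineIn Q l := by
  intro y hy
  have h1 := h.flag_eq_of_mem hl hy hxl
  obtain ⟨z, rfl | rfl⟩ := h.quad_eq hS hQ
  · exact h1.1.trans hx
  · exact h1.2.trans hx

theorem isLineSpread_induced (h : S.IsFlagMarking T κ κ') (hS : S.IsNearPolygon n) {Q : Set P}
    (hQ : S.IsQuad Q) : (S.induced Q).IsLineSpread {l | l.1 ∈ T} := by
  rintro ⟨x, hx⟩
  obtain ⟨l, ⟨hl, hxl⟩, huniq⟩ := h.isLineSpread hS x
  refine ⟨⟨l, h.lineIn_quad_of_mem hS hQ hx hl hxl⟩, ⟨hl, hxl⟩, ?_⟩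
  rintro m ⟨hm, hxm⟩
  exact Subtype.ext (huniq m.1 ⟨hm, hxm⟩)

end IsFlagMarking

end PointLineGeometry

/-! ### The distance from the base elation, verified on labels -/

namespace ElationLabel

open QVec Quart PlaneGroup

/-- Boolean equality. -/
def beq : ElationLabel → ElationLabel → Bool
  | (p, f), (q, g) => QVec.beq p q && QVec.beq f g

theorem beq_iff {a b : ElationLabel} : a.beq b = true ↔ a = b := by
  obtain ⟨p, f⟩ := a
  obtain ⟨q, g⟩ := b
  simp [beq, QVec.beq_iff]

/-- The distance to the base point. -/
def level : ElationLabel → ℕ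
  | (mk .z a b, mk c d .z) =>
    cond (beq base (mk .z a b, mk c d .z)) 0
      (cond (spread base (mk .z a b, mk c d .z) || line base (mk .z a b, mk c d .z)) 1 2)
  | (mk s _ _, mk _ d .z) => cond ((s.mul s).beq d) 2 3
  | (mk .z a _, mk _ _ r) => cond ((r.mul r).beq a) 2 3
  | (mk s _ _, mk _ _ r) => cond ((s.mul r).beq .u) 3 4

/-- Representatives of the lines through the base point. -/
def representative : Fin 5 → ElationLabel
  | 0 => (mk .z .z .u, mk .w .z .z)
  | 1 => (mk .z .z .u, mk .z .u .z)
  | 2 => (mk .z .z .u, mk .w .u .z)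
  | 3 => (mk .z .u .z, mk .u .z .z)
  | 4 => (mk .z .u .w, mk .u .z .z)

/-- The label is one of the representatives. -/
def isRepresentative (a : ElationLabel) : Bool :=
  beq a (representative 0) || (beq a (representative 1) || (beq a (representative 2) ||
    (beq a (representative 3) || beq a (representative 4))))

theorem isRepresentative_iff {a : ElationLabel} :
    isRepresentative a = true ↔ ∃ i, a = representative i := by
  simp only [isRepresentative, Bool.or_eq_true, beq_iff]
  constructor
  · rintro (h | h | h | h | h)
    exacts [⟨_, h⟩, ⟨_, h⟩, ⟨_, h⟩, ⟨_, h⟩, ⟨_, h⟩]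
  · rintro ⟨i, rfl⟩
    fin_cases i <;> simp

/-- The first level is the least one, and the other two exceed it by one. -/
def isNearest (a b c : ℕ) : Bool := Nat.beq b (a + 1) && Nat.beq c (a + 1)

/-- Exactly one of three Booleans is true. -/
def exactlyOne : Bool → Bool → Bool → Bool
  | true, false, false => true
  | false, true, false => true
  | false, false, true => true
  | _, _, _ => false

/-- The Boolean version of the properties of the levels on a line. -/
def lineCheck (a b c : ElationLabel) : Bool :=
  (isNearest (level a) (level b) (level c) || (isNearest (level b) (level a) (level c) ||
    isNearest (level c) (level a) (level b))) &&
  (!(Nat.beq (level a * (level b * level c)) 0) ||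
    exactlyOne (isRepresentative a) (isRepresentative b) (isRepresentative c))

/-- The condition on axes for lines whose points have a common centre. -/
def centreCondition (p f g : QVec) : Bool :=
  valid (p, g) && ((!(QVec.beq f g) && QVec.beq (cross f g) zero) || QVec.beq (cross f g) p)

/-- The condition on centres for lines whose points have a common axis. -/
def axisCondition (f p q : QVec) : Bool :=
  !((lead q).beq .z) && ((dot q f).beq .z && QVec.beq (cross p q) f)

theorem centreCondition_iff {p f g : QVec} : centreCondition p f g = true ↔
    valid (p, g) = true ∧ ((f ≠ g ∧ cross f g = zero) ∨ cross f g = p) := by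
  simp only [centreCondition, Bool.and_eq_true, Bool.or_eq_true, QVec.beq_iff, Bool.not_eq_true',
    ← Bool.not_eq_true, ne_eq]

theorem axisCondition_iff {f p q : QVec} : axisCondition f p q = true ↔
    lead q ≠ .z ∧ dot q f = .z ∧ cross p q = f := by
  simp only [axisCondition, Bool.and_eq_true, QVec.beq_iff, Quart.beq_iff, Bool.not_eq_true',
    ← Bool.not_eq_true, ne_eq]

theorem forall_of_all {F : QVec → Bool} (h : QVec.all.all F = true) (a : QVec) : F a = true :=
  List.all_eq_true.1 h a (QVec.mem_all a)

theorem exists_of_any {F : QVec → Bool} (h : QVec.all.any F = true) : ∃ a, F a = true :=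
  (List.any_eq_true.1 h).imp fun _ h => h.2

theorem implies_of_or {a b : Bool} (h : (!a || b) = true) (ha : a = true) : b = true := by
  subst ha; exact h

/-- This is a finite verification. Each quantifier is guarded by the condition on the vectors chosen
so far, so that unsuitable choices are discarded before the inner loops are evaluated. -/
theorem lineCheck_of_centreCondition {p f g : QVec} (hf : valid (p, f) = true)
    (h : centreCondition p f g = true) : lineCheck (p, f) (p, g) (p, QVec.add f g) = true := by
  have h0 : (QVec.all.all fun p => !((lead p).beq .u) || QVec.all.all fun f => !(valid (p, f)) ||
      QVec.all.all fun g => !(centreCondition p f g) ||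
        lineCheck (p, f) (p, g) (p, QVec.add f g)) = true := by
    decide +kernel
  have h1 := implies_of_or (forall_of_all h0 p) (Quart.beq_iff.2 (valid_iff.1 hf).1)
  exact implies_of_or (forall_of_all (implies_of_or (forall_of_all h1 f) hf) g) h

theorem lineCheck_of_axisCondition {f p q : QVec} (hf : lead f = .u) (hp : lead p ≠ .z)
    (hpf : dot p f = .z) (h : axisCondition f p q = true) :
    lineCheck (norm (p, f)) (norm (q, f)) (norm (QVec.add p q, f)) = true := by
  have h0 : (QVec.all.all fun f => !((lead f).beq .u) || QVec.all.all fun p =>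
      !(!((lead p).beq .z) && (dot p f).beq .z) || QVec.all.all fun q => !(axisCondition f p q) ||
        lineCheck (norm (p, f)) (norm (q, f)) (norm (QVec.add p q, f))) = true := by
    decide +kernel
  have h1 := implies_of_or (forall_of_all h0 f) (Quart.beq_iff.2 hf)
  refine implies_of_or (forall_of_all (implies_of_or (forall_of_all h1 p) ?_) q) h
  simp only [Bool.and_eq_true, Quart.beq_iff, Bool.not_eq_true', ← Bool.not_eq_true]
  exact ⟨hp, hpf⟩

theorem IsLine.lineCheck {a b c : ElationLabel} (h : IsLine a b c) : lineCheck a b c = true := by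
  rcases h with ⟨p, f, g, ha, hb, h, rfl, rfl, rfl⟩ |
    ⟨f, p, q, hf, hp, hq, h1, h2, h3, rfl, rfl, rfl⟩
  · exact lineCheck_of_centreCondition ha (centreCondition_iff.2 ⟨hb, h⟩)
  · exact lineCheck_of_axisCondition hf hp h1 (axisCondition_iff.2 ⟨hq, h2, h3⟩)

/-- In the formula for `level`, the first coordinate `s` of `p` vanishes when the centre lies on the
base axis, and the last coordinate `r` of `f` vanishes when the axis passes through the base centre.
If both vanish, orthogonality forces a common centre or a common axis with the base, and the level
is at most 2. If one vanishes, it is 2 or 3; if none does, 3 or 4. The deciding equations `s² = d`,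
`r² = a` and `s r = 1` are unaffected by rescaling a label, since nonzero scalars have cube 1. -/
theorem IsLine.level {a b c : ElationLabel} (h : IsLine a b c) :
    (b.level = a.level + 1 ∧ c.level = a.level + 1) ∨
    (a.level = b.level + 1 ∧ c.level = b.level + 1) ∨
    (a.level = c.level + 1 ∧ b.level = c.level + 1) := by
  have h1 := h.lineCheck
  simp only [ElationLabel.lineCheck, isNearest, Bool.and_eq_true, Bool.or_eq_true,
    Nat.beq_eq] at h1
  exact h1.1

/-- The product of the three levels is zero when the base is on the line, and in this case
`lineCheck` demands exactly one representative. The five representatives stand for the spread line,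
the two further lines with the base centre and the two further lines with the base axis. -/
theorem IsLine.existsUnique_representative {a b c : ElationLabel} (h : IsLine a b c)
    (h0 : a = base ∨ b = base ∨ c = base) :
    ∃ i, (a = representative i ∨ b = representative i ∨ c = representative i) ∧
      ∀ j, (a = representative j ∨ b = representative j ∨ c = representative j) →
        representative i = representative j := by
  have h1 := h.lineCheck
  simp only [ElationLabel.lineCheck, Bool.and_eq_true] at h1
  have hb : base.level = 0 := rfl
  have h2 : Nat.beq (a.level * (b.level * c.level)) 0 = true := by
    rw [Nat.beq_eq]
    rcases h0 with rfl | rfl | rfl <;> simp [hb]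
  replace h2 := implies_of_or h1.2 h2
  have key : ∀ d j, d = representative j → isRepresentative d = true := fun d j h =>
    isRepresentative_iff.2 ⟨j, h⟩
  generalize ha' : isRepresentative a = a' at h2
  generalize hb' : isRepresentative b = b' at h2
  generalize hc' : isRepresentative c = c' at h2
  match a', b', c', h2 with
  | true, false, false, _ =>
    obtain ⟨i, hi⟩ := isRepresentative_iff.1 ha'
    refine ⟨i, Or.inl hi, ?_⟩
    rintro j (h | h | h)
    · rw [← hi, h]
    · simp [key _ _ h] at hb'
    · simp [key _ _ h] at hc'
  | false, true, false, _ =>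
    obtain ⟨i, hi⟩ := isRepresentative_iff.1 hb'
    refine ⟨i, Or.inr (Or.inl hi), ?_⟩
    rintro j (h | h | h)
    · simp [key _ _ h] at ha'
    · rw [← hi, h]
    · simp [key _ _ h] at hc'
  | false, false, true, _ =>
    obtain ⟨i, hi⟩ := isRepresentative_iff.1 hc'
    refine ⟨i, Or.inr (Or.inr hi), ?_⟩
    rintro j (h | h | h)
    · simp [key _ _ h] at ha'
    · simp [key _ _ h] at hb'
    · rw [← hi, h]

theorem representative_injective : Function.Injective representative := by
  intro i j
  fin_cases i <;> fin_cases j <;> decide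

/-- The Boolean version of the existence of a line towards the base point. -/
def descends (p f : QVec) : Bool :=
  (QVec.all.any fun g => centreCondition p f g && Nat.blt (level (p, g)) (level (p, f))) ||
    QVec.all.any fun q => axisCondition (scale (lead f).inv f) (scale (lead f) p) q &&
      Nat.blt (level (norm (q, scale (lead f).inv f))) (level (p, f))

/-- Every valid label arises by normalising a pair whose axis vector has leading coefficient 1,
which is the shape required in the second case of `IsLine`. -/
theorem norm_scale {p f : QVec} (h : valid (p, f) = true) :
    norm (scale (lead f) p, scale (lead f).inv f) = (p, f) := by
  rw [valid_iff] at h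
  obtain ⟨hp, hf, -⟩ := h
  simp only [norm, lead_scale, hp]
  rcases p with ⟨p₁, p₂, p₃⟩
  rcases f with ⟨f₁, f₂, f₃⟩
  revert hf
  generalize lead (mk f₁ f₂ f₃) = s
  clear hp
  cases s
  · exact fun h => absurd rfl h
  all_goals
    intro _
    refine Prod.ext ?_ ?_
    · cases p₁ <;> cases p₂ <;> cases p₃ <;> rfl
    · cases f₁ <;> cases f₂ <;> cases f₃ <;> rfl

theorem isLine_of_centreCondition {p f g : QVec} (hf : valid (p, f) = true)
    (h : centreCondition p f g = true) : IsLine (p, f) (p, g) (p, QVec.add f g) := by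
  rw [centreCondition_iff] at h
  exact Or.inl ⟨p, f, g, hf, h.1, h.2, rfl, rfl, rfl⟩

theorem isLine_of_axisCondition {p f q : QVec} (h : valid (p, f) = true)
    (hq : axisCondition (scale (lead f).inv f) (scale (lead f) p) q = true) :
    IsLine (p, f) (norm (q, scale (lead f).inv f))
      (norm (QVec.add (scale (lead f) p) q, scale (lead f).inv f)) := by
  rw [axisCondition_iff] at hq
  refine Or.inr ⟨scale (lead f).inv f, scale (lead f) p, q, ?_, ?_, hq.1, ?_, hq.2.1, hq.2.2,
    (norm_scale h).symm, rfl, rfl⟩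
  all_goals rw [valid_iff] at h
  · rw [lead_scale]
    have := h.2.1
    revert this
    cases lead f <;> decide
  · rw [lead_scale, h.1]
    have := h.2.1
    revert this
    cases lead f <;> decide
  · have := h.2.2
    rw [dot_eq_z] at this ⊢
    rw [toVec_scale, toVec_scale, smul_dotProduct, dotProduct_smul, this, smul_zero, smul_zero]

theorem exists_level_lt {a : ElationLabel} (ha : valid a = true) (hab : a ≠ base) :
    ∃ b c, IsLine a b c ∧ level b < level a := by
  have h0 : (QVec.all.all fun p => !((lead p).beq .u) || QVec.all.all fun f => !(valid (p, f)) ||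
      (beq (p, f) base || descends p f)) = true := by
    decide +kernel
  obtain ⟨p, f⟩ := a
  have h1 := implies_of_or (forall_of_all h0 p) (Quart.beq_iff.2 (valid_iff.1 ha).1)
  have h2 := implies_of_or (forall_of_all h1 f) ha
  rw [Bool.or_eq_true, beq_iff] at h2
  replace h2 := h2.resolve_left hab
  rw [descends, Bool.or_eq_true] at h2
  rcases h2 with h2 | h2
  · obtain ⟨g, hg⟩ := exists_of_any h2
    rw [Bool.and_eq_true, Nat.blt_eq] at hg
    exact ⟨_, _, isLine_of_centreCondition ha hg.1, hg.2⟩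
  · obtain ⟨q, hq⟩ := exists_of_any h2
    rw [Bool.and_eq_true, Nat.blt_eq] at hq
    exact ⟨_, _, isLine_of_axisCondition ha hq.1, hq.2⟩

theorem exists_isLine_centre {p f : QVec} (ha : valid (p, f) = true) :
    ∃ g, valid (p, g) = true ∧ cross f g = p := by
  have h0 : (QVec.all.all fun p => !((lead p).beq .u) || QVec.all.all fun f => !(valid (p, f)) ||
      QVec.all.any fun g => valid (p, g) && QVec.beq (cross f g) p) = true := by
    decide +kernel
  have h1 := implies_of_or (forall_of_all h0 p) (Quart.beq_iff.2 (valid_iff.1 ha).1)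
  obtain ⟨g, hg⟩ := exists_of_any (implies_of_or (forall_of_all h1 f) ha)
  rw [Bool.and_eq_true, QVec.beq_iff] at hg
  exact ⟨g, hg⟩

theorem exists_isLine_axis {p f : QVec} (ha : valid (p, f) = true) :
    ∃ q, axisCondition (scale (lead f).inv f) (scale (lead f) p) q = true ∧
      scale (lead q).inv q ≠ p := by
  have h0 : (QVec.all.all fun p => !((lead p).beq .u) || QVec.all.all fun f => !(valid (p, f)) ||
      QVec.all.any fun q => axisCondition (scale (lead f).inv f) (scale (lead f) p) q &&
        !(QVec.beq (scale (lead q).inv q) p)) = true := by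
    decide +kernel
  have h1 := implies_of_or (forall_of_all h0 p) (Quart.beq_iff.2 (valid_iff.1 ha).1)
  obtain ⟨q, hq⟩ := exists_of_any (implies_of_or (forall_of_all h1 f) ha)
  rw [Bool.and_eq_true, Bool.not_eq_true', ← Bool.not_eq_true, QVec.beq_iff] at hq
  exact ⟨q, hq⟩

theorem level_le (a : ElationLabel) : level a ≤ 4 := by
  have h : ∀ (b : Bool) (m n : ℕ), m ≤ 4 → n ≤ 4 → cond b m n ≤ 4 := by
    intro b m n hm hn; cases b <;> assumption
  unfold level
  split
  · exact h _ _ _ (by norm_num) (h _ _ _ (by norm_num) (by norm_num))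
  all_goals exact h _ _ _ (by norm_num) (by norm_num)

/-- This bounds the distances inside the prospective quads through the base elation. -/
theorem level_le_two {a : ElationLabel} (ha : valid a = true)
    (h : centrePt _ ha = centrePt _ valid_base ∨ axisPt _ ha = axisPt _ valid_base) :
    level a ≤ 2 := by
  have h0 : (QVec.all.all fun p => QVec.all.all fun f => !(valid (p, f) &&
      (QVec.beq p base.1 || [Quart.z, .u, .w, .v].any fun c =>
        QVec.beq f (scale c base.2))) || Nat.ble (level (p, f)) 2) = true := by
    decide +kernel
  obtain ⟨p, f⟩ := a
  rw [← Nat.ble_eq]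
  refine implies_of_or (forall_of_all (forall_of_all h0 p) f) ?_
  rw [Bool.and_eq_true, Bool.or_eq_true, QVec.beq_iff, List.any_eq_true]
  refine ⟨ha, ?_⟩
  rw [centrePt_eq_iff, eq_comm (a := axisPt _ _), axisPt_eq_iff] at h
  refine h.imp id ?_
  rintro ⟨c, hc⟩
  exact ⟨c, by cases c <;> simp, QVec.beq_iff.2 hc⟩

theorem exists_isLine_representative (i : Fin 5) : ∃ c, IsLine base (representative i) c := by
  fin_cases i
  · exact ⟨_, isLine_of_centreCondition valid_base (g := mk .w .z .z) (by decide)⟩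
  · exact ⟨_, isLine_of_centreCondition valid_base (g := mk .z .u .z) (by decide)⟩
  · exact ⟨_, isLine_of_centreCondition valid_base (g := mk .w .u .z) (by decide)⟩
  · exact ⟨_, isLine_of_axisCondition valid_base (q := mk .z .u .z) (by decide)⟩
  · exact ⟨_, isLine_of_axisCondition valid_base (q := mk .z .u .w) (by decide)⟩

theorem IsLine.valid {a b c : ElationLabel} (h : IsLine a b c) :
    valid a = true ∧ valid b = true ∧ valid c = true := by
  rcases h with ⟨p, f, g, ha, hb, h, rfl, rfl, rfl⟩ |
    ⟨f, p, q, hf, hp, hq, h1, h2, h3, rfl, rfl, rfl⟩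
  · refine ⟨ha, hb, ?_⟩
    rw [valid_iff] at *
    refine ⟨ha.1, lead_add_ne ?_, dot_add_right ha.2.2 hb.2.2⟩
    rcases h with h | h
    · exact h.1
    · rintro rfl
      rw [cross_self_eq_zero] at h
      rw [← h] at ha
      exact absurd ha.1 (by decide)
  · have hf' : lead f ≠ .z := by rw [hf]; decide
    refine ⟨valid_norm hp hf' h1, valid_norm hq hf' h2,
      valid_norm (lead_add_ne ?_) hf' (dot_add_left h1 h2)⟩
    rintro rfl
    rw [cross_self_eq_zero] at h3
    rw [← h3] at hf
    exact absurd hf (by decide)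

theorem IsLine.ne {a b c : ElationLabel} (h : IsLine a b c) : a ≠ b ∧ a ≠ c ∧ b ≠ c := by
  obtain ⟨h1, h2⟩ := rel_of_isLine h
  have ha := (isElation_toElation h.valid.1).ne_one
  have hb := (isElation_toElation h.valid.2.1).ne_one
  refine ⟨?_, ?_, ?_⟩
  · rintro rfl
    exact ne_of_rel h1 rfl
  · rintro rfl
    exact hb (left_eq_mul.1 h2)
  · rintro rfl
    exact ha (right_eq_mul.1 h2)

end ElationLabel

/-! ### Order, diameter and flag marking of a labelled geometry -/

namespace Coordinates

open ElationLabel PointLineGeometry QVec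

variable {P L : Type*} {S : PointLineGeometry P L} {T : Set L} {C : P → P → Prop}
  {lab : P → ElationLabel}

/-- The centre of a point. -/
noncomputable def centre (h : Coordinates S T C lab) (x : P) : PlaneGroup.PG2 F4 :=
  centrePt _ (h.valid x)

/-- The axis of a point. -/
noncomputable def axis (h : Coordinates S T C lab) (x : P) : PlaneGroup.PG2 F4 :=
  axisPt _ (h.valid x)

theorem exists_third (h : Coordinates S T C lab) {a b c : ElationLabel} (habc : IsLine a b c) :
    ∃ x y z l, lab x = a ∧ lab y = b ∧ lab z = c ∧ ∀ t, S.Inc t l ↔ t = x ∨ t = y ∨ t = z := by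
  obtain ⟨x, rfl⟩ := h.surjective a habc.valid.1
  obtain ⟨y, rfl⟩ := h.surjective b habc.valid.2.1
  obtain ⟨z, rfl⟩ := h.surjective c habc.valid.2.2
  obtain ⟨l, hl⟩ := h.exists_line x y z habc
  exact ⟨x, y, z, l, rfl, rfl, rfl, hl⟩

theorem exists_adj_of_isLine (h : Coordinates S T C lab) {x : P} {b c : ElationLabel}
    (hx : IsLine (lab x) b c) : ∃ y, S.collinearityGraph.Adj x y ∧ lab y = b := by
  obtain ⟨x', y, z, l, h1, rfl, -, hl⟩ := h.exists_third hx
  obtain rfl := h.injective h1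
  refine ⟨y, ⟨?_, l, (hl _).2 (Or.inl rfl), (hl _).2 (Or.inr (Or.inl rfl))⟩, rfl⟩
  rintro rfl
  exact hx.ne.1 rfl

theorem adj_of_isLine (h : Coordinates S T C lab) {x y : P} {c : ElationLabel}
    (hxy : IsLine (lab x) (lab y) c) : S.collinearityGraph.Adj x y := by
  obtain ⟨z, hz, hzy⟩ := h.exists_adj_of_isLine hxy
  rwa [← h.injective hzy]

theorem isLevel (h : Coordinates S T C lab) {x : P} (hx : lab x = base) :
    S.IsLevel x fun y => level (lab y) where
  zero := by rw [hx]; rfl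
  line l := by
    obtain ⟨a, b, c, habc, hl⟩ := h.line l
    rcases habc.level with h1 | h1 | h1
    · refine ⟨a, (hl a).2 (Or.inl rfl), fun z hz hne => ?_⟩
      rcases (hl z).1 hz with rfl | rfl | rfl
      exacts [absurd rfl hne, h1.1, h1.2]
    · refine ⟨b, (hl b).2 (Or.inr (Or.inl rfl)), fun z hz hne => ?_⟩
      rcases (hl z).1 hz with rfl | rfl | rfl
      exacts [h1.1, absurd rfl hne, h1.2]
    · refine ⟨c, (hl c).2 (Or.inr (Or.inr rfl)), fun z hz hne => ?_⟩
      rcases (hl z).1 hz with rfl | rfl | rfl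
      exacts [h1.1, h1.2, absurd rfl hne]
  descent y hy := by
    have hne : lab y ≠ base := fun h' => hy (h.injective (h'.trans hx.symm))
    obtain ⟨b, c, h1, h2⟩ := exists_level_lt (h.valid y) hne
    obtain ⟨z, hz, rfl⟩ := h.exists_adj_of_isLine h1
    exact ⟨z, hz, h2⟩

theorem encard_line (h : Coordinates S T C lab) (l : L) : {x | S.Inc x l}.encard = 3 := by
  obtain ⟨x, y, z, hl, hl'⟩ := h.line l
  rw [Set.encard_eq_three]
  refine ⟨x, y, z, ?_, ?_, ?_, ?_⟩
  · rintro rfl; exact hl.ne.1 rfl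
  · rintro rfl; exact hl.ne.2.1 rfl
  · rintro rfl; exact hl.ne.2.2 rfl
  · ext t; exact hl' t

/-- Each line through the base contains exactly one of the five representatives, and each
representative is joined to the base; so there are five lines. -/
theorem encard_lines (h : Coordinates S T C lab) {x : P} (hx : lab x = base) :
    {l | S.Inc x l}.encard = 5 := by
  have h1 : ∀ i, ∃ y l, lab y = representative i ∧ S.Inc x l ∧ S.Inc y l ∧ x ≠ y := by
    intro i
    obtain ⟨c, hc⟩ := exists_isLine_representative i
    rw [← hx] at hc
    obtain ⟨y, ⟨hxy, l, h1, h2⟩, h3⟩ := h.exists_adj_of_isLine hc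
    exact ⟨y, l, h3, h1, h2, hxy⟩
  choose y l hy hxl hyl hxy using h1
  have h2 : ∀ m, S.Inc x m → ∃ i, S.Inc (y i) m ∧ ∀ j, S.Inc (y j) m → i = j := by
    intro m hm
    obtain ⟨a, b, c, habc, hm'⟩ := h.line m
    have h3 : ∀ j, S.Inc (y j) m ↔ (lab a = representative j ∨ lab b = representative j ∨
        lab c = representative j) := by
      intro j
      rw [hm', ← hy j, h.injective.eq_iff, h.injective.eq_iff, h.injective.eq_iff,
        eq_comm, eq_comm (a := y j) (b := b), eq_comm (a := y j) (b := c)]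
    obtain ⟨i, hi, huniq⟩ := habc.existsUnique_representative (by
      rw [← hx, h.injective.eq_iff, h.injective.eq_iff, h.injective.eq_iff, eq_comm,
        eq_comm (a := b), eq_comm (a := c)]
      exact (hm' x).1 hm)
    exact ⟨i, (h3 i).2 hi, fun j hj => representative_injective (huniq j ((h3 j).1 hj))⟩
  have h3 : {l | S.Inc x l} = Set.range l := by
    ext m
    constructor
    · intro hm
      obtain ⟨i, hi, -⟩ := h2 m hm
      exact ⟨i, h.partialLinear.2 x (y i) (hxy i) _ _ (hxl i) (hyl i) hm hi⟩
    · rintro ⟨i, rfl⟩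
      exact hxl i
  have h4 : Function.Injective l := by
    intro i j hij
    obtain ⟨k, -, hk⟩ := h2 (l i) (hxl i)
    exact (hk i (hyl i)).symm.trans (hk j (by rw [hij]; exact hyl j))
  rw [h3, ← Set.image_univ, h4.encard_image, Set.encard_univ, ENat.card_eq_coe_fintype_card]
  rfl

theorem hasOrder (h : Coordinates S T C lab)
    (hbase : ∀ x, ∃ lab, Coordinates S T C lab ∧ lab x = base) : S.HasOrder 2 4 := by
  constructor
  · intro l
    rw [h.encard_line]; norm_num
  · intro x
    obtain ⟨lab, h, hx⟩ := hbase x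
    rw [h.encard_lines hx]; norm_num

theorem isNearPolygon (h : Coordinates S T C lab)
    (hbase : ∀ x, ∃ lab, Coordinates S T C lab ∧ lab x = base) : S.IsNearPolygon 4 := by
  apply isNearPolygon_of_isLevel h.partialLinear
  · intro x
    obtain ⟨lab, h, hx⟩ := hbase x
    exact ⟨_, h.isLevel hx, fun y => level_le _⟩
  · obtain ⟨x, hx⟩ := h.surjective base valid_base
    -- For this label `s = 1` and `r = w`, so `s r ≠ 1` and the distance 4 is attained.
    obtain ⟨y, hy⟩ := h.surjective (QVec.mk .u .z .z, QVec.mk .z .z .w) (by decide)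
    exact ⟨x, _, y, h.isLevel hx, by rw [hy]; rfl⟩

/-- The bound is known only from the base, and the labelling that makes `x` the base need not have
the same centres and axes. Commutation transports the hypothesis from one labelling to the other. -/
theorem dist_le (h : Coordinates S T C lab)
    (hbase : ∀ x, ∃ lab, Coordinates S T C lab ∧ lab x = base) {x y : P}
    (hxy : h.centre x = h.centre y ∨ h.axis x = h.axis y) :
    S.collinearityGraph.dist x y ≤ 2 := by
  have hC := (h.commute x y).2 hxy
  obtain ⟨lab', h', hx⟩ := hbase x
  rw [(h'.isLevel hx).dist_eq]
  apply level_le_two (h'.valid y)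
  have h2 := (h'.commute x y).1 hC
  rw [eq_comm, eq_comm (a := axisPt _ (h'.valid x))] at h2
  simpa only [hx] using h2

theorem exists_axis_ne (h : Coordinates S T C lab) (x : P) :
    ∃ y, S.collinearityGraph.Adj x y ∧ h.centre y = h.centre x ∧ h.axis y ≠ h.axis x := by
  have hv := h.valid x
  obtain ⟨⟨p, f⟩, hx⟩ : ∃ a, lab x = a := ⟨_, rfl⟩
  rw [hx] at hv
  obtain ⟨g, hg, hgp⟩ := exists_isLine_centre hv
  have hl : IsLine (lab x) (p, g) (p, QVec.add f g) := by
    rw [hx]; exact Or.inl ⟨p, f, g, hv, hg, Or.inr hgp, rfl, rfl, rfl⟩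
  obtain ⟨y, hxy, hy⟩ := h.exists_adj_of_isLine hl
  refine ⟨y, hxy, ?_, ?_⟩
  · rw [centre, centre, centrePt_eq_iff, hx, hy]
  · rw [ne_comm, axis, axis, Ne, axisPt_eq_iff, hx, hy]
    rintro ⟨c, rfl⟩
    rw [← toVec_injective.eq_iff, toVec_cross, toVec_scale, map_smul, cross_self, smul_zero] at hgp
    exact toVec_fst_ne_zero hv hgp.symm

theorem exists_centre_ne (h : Coordinates S T C lab) (x : P) :
    ∃ y, S.collinearityGraph.Adj x y ∧ h.axis y = h.axis x ∧ h.centre y ≠ h.centre x := by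
  have hv := h.valid x
  obtain ⟨⟨p, f⟩, hx⟩ : ∃ a, lab x = a := ⟨_, rfl⟩
  rw [hx] at hv
  obtain ⟨q, hq, hqp⟩ := exists_isLine_axis hv
  have hl := isLine_of_axisCondition hv hq
  rw [← hx] at hl
  obtain ⟨y, hxy, hy⟩ := h.exists_adj_of_isLine hl
  refine ⟨y, hxy, ?_, ?_⟩
  · rw [eq_comm, axis, axis, axisPt_eq_iff, hx, hy]
    refine ⟨(lead q).mul (lead f).inv, ?_⟩
    apply toVec_injective
    simp only [ElationLabel.norm, toVec_scale, Quart.toF4_mul, mul_smul]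
  · rwa [centre, centre, Ne, centrePt_eq_iff, hx, hy]

theorem adj_of_eq (h : Coordinates S T C lab) {x y : P} (hxy : x ≠ y)
    (h1 : h.centre x = h.centre y) (h2 : h.axis x = h.axis y) : S.collinearityGraph.Adj x y := by
  rw [centre, centre, centrePt_eq_iff] at h1
  rw [axis, axis, axisPt_eq_iff] at h2
  obtain ⟨c, h2⟩ := h2
  apply h.adj_of_isLine (c := ((lab x).1, QVec.add (lab x).2 (lab y).2))
  refine Or.inl ⟨(lab x).1, (lab x).2, (lab y).2, h.valid x, by rw [h1]; exact h.valid y,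
    Or.inl ⟨fun h3 => hxy (h.injective (Prod.ext h1 h3)), ?_⟩, rfl, by rw [h1], rfl⟩
  apply toVec_injective
  rw [h2, toVec_cross, toVec_scale, map_smul, cross_self, smul_zero, toVec_zero]

theorem exists_ne (h : Coordinates S T C lab) (x : P) :
    ∃ y, y ≠ x ∧ h.centre y = h.centre x ∧ h.axis y = h.axis x := by
  have hv := h.valid x
  obtain ⟨⟨p, f⟩, hx⟩ : ∃ a, lab x = a := ⟨_, rfl⟩
  rw [hx, valid_iff] at hv
  have hv' : ElationLabel.valid (p, scale .w f) = true := by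
    rw [valid_iff, lead_scale]
    refine ⟨hv.1, ?_, ?_⟩
    · have := hv.2.1
      revert this
      cases lead f <;> decide
    · rw [dot_eq_z, toVec_scale, dotProduct_smul, dot_eq_z.1 hv.2.2, smul_zero]
  obtain ⟨y, hy⟩ := h.surjective _ hv'
  refine ⟨y, ?_, ?_, ?_⟩
  · rintro rfl
    rw [hx, Prod.mk.injEq] at hy
    have h3 := congrArg lead hy.2
    rw [lead_scale] at h3
    have := hv.2.1
    revert this h3
    cases lead f <;> decide
  · rw [centre, centre, centrePt_eq_iff, hx, hy]
  · rw [eq_comm, axis, axis, axisPt_eq_iff, hx, hy]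
    exact ⟨_, rfl⟩

theorem axis_eq_of_norm (h : Coordinates S T C lab) {x y : P} {p q f : QVec}
    (hx : lab x = ElationLabel.norm (p, f)) (hy : lab y = ElationLabel.norm (q, f)) : h.axis x = h.axis y := by
  have hv := toVec_snd_ne_zero (h.valid x)
  rw [axis, axis, axisPt_eq_iff, hx, hy]
  rw [hx] at hv
  refine ⟨(lead q).mul (lead p).inv, ?_⟩
  apply toVec_injective
  simp only [ElationLabel.norm, toVec_scale] at hv ⊢
  rw [Quart.toF4_mul, Quart.toF4_inv, mul_smul, inv_smul_smul₀]
  intro h0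
  rw [h0, zero_smul] at hv
  exact hv rfl

theorem orthogonal (h : Coordinates S T C lab) (x : P) : (h.centre x).orthogonal (h.axis x) :=
  centrePt_orthogonal_axisPt _

theorem isFlagMarking (h : Coordinates S T C lab)
    (hbase : ∀ x, ∃ lab, Coordinates S T C lab ∧ lab x = base) :
    S.IsFlagMarking T h.centre h.axis where
  line l := by
    obtain ⟨a, b, c, hl, hm⟩ := h.line l
    have key : ∀ {κ : P → PlaneGroup.PG2 F4}, κ a = κ b → κ a = κ c → κ b = κ c →
        ∀ x y, S.Inc x l → S.Inc y l → κ x = κ y := by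
      intro κ h3 h4 h5 x y hx hy
      rcases (hm x).1 hx with rfl | rfl | rfl <;> rcases (hm y).1 hy with rfl | rfl | rfl <;>
        first | rfl | assumption | (symm; assumption)
    rcases hl with ⟨p, f, g, -, -, -, ha, hb, hc⟩ | ⟨f, p, q, -, -, -, -, -, -, ha, hb, hc⟩
    · left
      apply key <;> rw [centre, centre, centrePt_eq_iff] <;>
        simp only [ha, hb, hc]
    · right
      exact key (h.axis_eq_of_norm ha hb) (h.axis_eq_of_norm ha hc)
        (h.axis_eq_of_norm hb hc)
  adj _ _ := h.adj_of_eq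
  dist_le _ _ hxy := h.dist_le hbase (Or.inl hxy)
  dist_le' _ _ hxy := h.dist_le hbase (Or.inr hxy)
  exists_adj := h.exists_axis_ne
  exists_adj' := h.exists_centre_ne
  exists_flag := h.exists_ne
  -- The centres of `x` and `z` both lie on the axes of `x` and `y`, so two points or two lines of
  -- the plane coincide.
  rectangle x y z w h1 h2 h3 h4 := by
    classical
    apply Configuration.ofField.eq_or_eq_of_orthogonal (h.orthogonal x)
    · rw [h2]; exact h.orthogonal z
    · rw [h1]; exact h.orthogonal y
    · rw [← h3, ← h4]; exact h.orthogonal w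
  spread := h.spread

theorem exists_flag (h : Coordinates S T C lab) {p l : PlaneGroup.PG2 F4} (hpl : p.orthogonal l) :
    ∃ x, h.centre x = p ∧ h.axis x = l := by
  obtain ⟨a, ha, rfl, rfl⟩ := exists_label hpl
  obtain ⟨x, rfl⟩ := h.surjective a ha
  exact ⟨x, rfl, rfl⟩

end Coordinates

/-! ### Generalized hexagons and invariance under isomorphism -/

namespace PointLineGeometry

variable {P L P' L' : Type*} {S : PointLineGeometry P L} {S' : PointLineGeometry P' L'}

/-- A description of a generalized hexagon by distances. -/
structure IsHexagon (S : PointLineGeometry P L) : Prop where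
  partialLinear : S.IsPartialLinearSpace
  two_lines : ∀ x, ∃ l m, l ≠ m ∧ S.Inc x l ∧ S.Inc x m
  level : ∀ x, ∃ d, S.IsLevel x d ∧ (∀ y, d y ≤ 3) ∧
    ∀ y, d y = 2 → ∃! z, S.collinearityGraph.Adj x z ∧ S.collinearityGraph.Adj z y
  exists_level : ∃ x d y, S.IsLevel x d ∧ d y = 3

theorem IsHexagon.isGeneralizedHexagon (h : S.IsHexagon) : S.IsGeneralizedHexagon := by
  refine ⟨isNearPolygon_of_isLevel h.partialLinear ?_ h.exists_level, h.two_lines, ?_⟩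
  · intro x
    obtain ⟨d, h1, h2, -⟩ := h.level x
    exact ⟨d, h1, h2⟩
  · intro x y hxy
    obtain ⟨d, h1, -, h2⟩ := h.level x
    rw [h1.dist_eq] at hxy
    exact h2 y hxy

theorem adj_map_iff {f : P ≃ P'} {g : L ≃ L'} (h : ∀ x l, S.Inc x l ↔ S'.Inc (f x) (g l))
    {x y : P} : S.collinearityGraph.Adj x y ↔ S'.collinearityGraph.Adj (f x) (f y) := by
  refine and_congr f.injective.ne_iff.symm ?_
  rw [g.surjective.exists]
  simp only [h]

theorem IsLevel.comap {f : P ≃ P'} {g : L ≃ L'} (h : ∀ x l, S.Inc x l ↔ S'.Inc (f x) (g l))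
    {x : P} {d : P' → ℕ} (hd : S'.IsLevel (f x) d) : S.IsLevel x (d ∘ f) where
  zero := hd.zero
  line l := by
    obtain ⟨y, hy, hl⟩ := hd.line (g l)
    obtain ⟨y, rfl⟩ := f.surjective y
    exact ⟨y, (h _ _).2 hy, fun z hz hzy => hl _ ((h _ _).1 hz) (f.injective.ne hzy)⟩
  descent y hy := by
    obtain ⟨z, hz, hlt⟩ := hd.descent (f y) (f.injective.ne hy)
    obtain ⟨z, rfl⟩ := f.surjective z
    exact ⟨z, (adj_map_iff h).2 hz, hlt⟩

theorem IsHexagon.of_isomorphic (hS : S'.IsHexagon) (h : S.Isomorphic S') : S.IsHexagon := by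
  obtain ⟨f, g, h⟩ := h
  refine ⟨⟨?_, ?_⟩, ?_, ?_, ?_⟩
  · intro l
    have := hS.partialLinear.1 (g l)
    rw [f.surjective.exists] at this
    obtain ⟨x, hx⟩ := this
    rw [f.surjective.exists] at hx
    obtain ⟨y, hxy, hx, hy⟩ := hx
    exact ⟨x, y, fun h => hxy (congrArg f h), (h _ _).2 hx, (h _ _).2 hy⟩
  · intro x y hxy l m h1 h2 h3 h4
    simp only [h] at h1 h2 h3 h4
    exact g.injective (hS.partialLinear.2 _ _ (f.injective.ne hxy) _ _ h1 h2 h3 h4)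
  · intro x
    obtain ⟨l, m, hlm, hl, hm⟩ := hS.two_lines (f x)
    obtain ⟨l, rfl⟩ := g.surjective l
    obtain ⟨m, rfl⟩ := g.surjective m
    exact ⟨l, m, fun h => hlm (congrArg g h), (h _ _).2 hl, (h _ _).2 hm⟩
  · intro x
    obtain ⟨d, h1, h2, h3⟩ := hS.level (f x)
    refine ⟨d ∘ f, h1.comap h, fun y => h2 _, fun y hy => ?_⟩
    obtain ⟨z, hz, huniq⟩ := h3 (f y) hy
    obtain ⟨z, rfl⟩ := f.surjective z
    refine ⟨z, ⟨(adj_map_iff h).2 hz.1, (adj_map_iff h).2 hz.2⟩, fun w hw => f.injective ?_⟩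
    exact huniq _ ⟨(adj_map_iff h).1 hw.1, (adj_map_iff h).1 hw.2⟩
  · obtain ⟨x, d, y, hd, hy⟩ := hS.exists_level
    obtain ⟨x, rfl⟩ := f.surjective x
    obtain ⟨y, rfl⟩ := f.surjective y
    exact ⟨x, d ∘ f, y, hd.comap h, hy⟩

theorem HasOrder.of_isomorphic {s t : ℕ} (hS : S'.HasOrder s t) (h : S.Isomorphic S') :
    S.HasOrder s t := by
  obtain ⟨f, g, h⟩ := h
  constructor
  · intro l
    rw [← hS.1 (g l), ← f.injective.encard_image]
    congr 1
    ext x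
    obtain ⟨x, rfl⟩ := f.surjective x
    simp [h]
  · intro x
    rw [← hS.2 (f x), ← g.injective.encard_image]
    congr 1
    ext l
    obtain ⟨l, rfl⟩ := g.surjective l
    simp [h]

end PointLineGeometry

/-! ### The flags of a projective plane form a generalized hexagon -/

namespace PlaneGroup

open PointLineGeometry Projectivization

section

variable {K : Type*} [Field K]

/-- The flags obtained by interchanging points and lines. -/
def Flag.swap (x : Flag K) : Flag K := ⟨(x.1.2, x.1.1), orthogonal_comm.1 x.2⟩

theorem Flag.swap_swap (x : Flag K) : x.swap.swap = x := rfl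

theorem flag_ext {x y : Flag K} (h1 : x.1.1 = y.1.1) (h2 : x.1.2 = y.1.2) : x = y :=
  Subtype.ext (Prod.ext h1 h2)

theorem flagGeometry_adj {x y : Flag K} : (flagGeometry K).collinearityGraph.Adj x y ↔
    x ≠ y ∧ (x.1.1 = y.1.1 ∨ x.1.2 = y.1.2) := by
  refine and_congr_right fun _ => ?_
  constructor
  · rintro ⟨e | e, h1 | h1, h2 | h2⟩
    · exact Or.inl (Sum.inl_injective (h1.symm.trans h2))
    · cases h2
    · cases h1
    · cases h1
    · cases h1
    · cases h1
    · cases h2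
    · exact Or.inr (Sum.inr_injective (h1.symm.trans h2))
  · rintro (h | h)
    · exact ⟨Sum.inl x.1.1, Or.inl rfl, Or.inl (by rw [h])⟩
    · exact ⟨Sum.inr x.1.2, Or.inr rfl, Or.inr (by rw [h])⟩

theorem inc_inl {x : Flag K} {p : PG2 K} :
    (flagGeometry K).Inc x (Sum.inl p) ↔ x.1.1 = p := by
  constructor
  · rintro (h | h)
    · exact (Sum.inl_injective h).symm
    · cases h
  · rintro rfl
    exact Or.inl rfl

theorem inc_inr {x : Flag K} {l : PG2 K} :
    (flagGeometry K).Inc x (Sum.inr l) ↔ x.1.2 = l := by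
  constructor
  · rintro (h | h)
    · cases h
    · exact (Sum.inr_injective h).symm
  · rintro rfl
    exact Or.inr rfl

theorem exists_join [DecidableEq K] (p q : PG2 K) :
    ∃ l : PG2 K, p.orthogonal l ∧ q.orthogonal l := by
  by_cases h : p = q
  · obtain ⟨l, hl⟩ := exists_point_on p
    exact ⟨l, orthogonal_comm.1 hl, h ▸ orthogonal_comm.1 hl⟩
  · exact ⟨cross p q, orthogonal_comm.1 (cross_orthogonal_left h),
      orthogonal_comm.1 (cross_orthogonal_right h)⟩

open Classical in
/-- The distance between two flags. -/
noncomputable def flagLevel (x y : Flag K) : ℕ :=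
  if y.1.1 = x.1.1 then if y.1.2 = x.1.2 then 0 else 1
  else if y.1.2 = x.1.2 then 1
  else if x.1.1.orthogonal y.1.2 ∨ y.1.1.orthogonal x.1.2 then 2 else 3

/-- Duality of the plane preserves the level, so for lines of the geometry it suffices to treat
those given by a point. -/
theorem flagLevel_swap (x y : Flag K) : flagLevel x.swap y.swap = flagLevel x y := by
  have h1 : (x.swap.1.1.orthogonal y.swap.1.2 ∨ y.swap.1.1.orthogonal x.swap.1.2) ↔
      (x.1.1.orthogonal y.1.2 ∨ y.1.1.orthogonal x.1.2) := by
    rw [orthogonal_comm, orthogonal_comm (v := y.swap.1.1), or_comm]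
    rfl
  have h2 : y.swap.1.1 = x.swap.1.1 ↔ y.1.2 = x.1.2 := Iff.rfl
  have h3 : y.swap.1.2 = x.swap.1.2 ↔ y.1.1 = x.1.1 := Iff.rfl
  by_cases h4 : y.1.1 = x.1.1 <;> by_cases h5 : y.1.2 = x.1.2 <;>
    simp only [flagLevel, h2, h3, h4, h5, if_true, if_false]
  by_cases h : x.1.1.orthogonal y.1.2 ∨ y.1.1.orthogonal x.1.2
  · rw [if_pos h, if_pos (h1.2 h)]
  · rw [if_neg h, if_neg (mt h1.1 h)]

/-- Among the flags on the point `q`, the nearest to `(p, l)` has the line `l` if `q` is on `l`, and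
the line `pq` otherwise. -/
theorem flagLevel_line_inl [DecidableEq K] (x : Flag K) (q : PG2 K) :
    ∃ y : Flag K, y.1.1 = q ∧ ∀ z : Flag K, z.1.1 = q → z ≠ y →
      flagLevel x z = flagLevel x y + 1 := by
  obtain ⟨⟨p, l⟩, hpl⟩ := x
  have hne : ∀ {z : Flag K} {m : PG2 K} (hm : q.orthogonal m), z.1.1 = q →
      z ≠ ⟨(q, m), hm⟩ → z.1.2 ≠ m := fun hm h1 h2 h3 => h2 (flag_ext h1 h3)
  by_cases hqp : q = p
  · subst hqp
    refine ⟨⟨(q, l), hpl⟩, rfl, fun z hz hzy => ?_⟩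
    simp [flagLevel, hz, hne hpl hz hzy]
  by_cases hql : q.orthogonal l
  · refine ⟨⟨(q, l), hql⟩, rfl, fun z hz hzy => ?_⟩
    simp [flagLevel, hz, hqp, hne hql hz hzy, hql]
  · obtain ⟨m, hpm, hqm⟩ := exists_join p q
    refine ⟨⟨(q, m), hqm⟩, rfl, fun z hz hzy => ?_⟩
    have hml : m ≠ l := by rintro rfl; exact hql hqm
    have hzl : z.1.2 ≠ l := by
      intro h
      have := z.2
      rw [hz, h] at this
      exact hql this
    have hpz : ¬ p.orthogonal z.1.2 := by
      intro h
      have h2 := z.2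
      rw [hz] at h2
      rcases Configuration.ofField.eq_or_eq_of_orthogonal h h2 hpm hqm with h3 | h3
      · exact hqp h3.symm
      · exact hne hqm hz hzy h3
    simp [flagLevel, hz, hqp, hql, hml, hzl, hpz, hpm]

theorem isLevel_flagLevel [DecidableEq K] (x : Flag K) :
    (flagGeometry K).IsLevel x (flagLevel x) where
  zero := by simp [flagLevel]
  line := by
    rintro (q | m)
    · obtain ⟨y, hy, h⟩ := flagLevel_line_inl x q
      exact ⟨y, inc_inl.2 hy, fun z hz => h z (inc_inl.1 hz)⟩
    · obtain ⟨y, hy, h⟩ := flagLevel_line_inl x.swap m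
      refine ⟨y.swap, inc_inr.2 hy, fun z hz hzy => ?_⟩
      have := h z.swap (inc_inr.1 hz) fun h' => hzy (by rw [← h', Flag.swap_swap])
      rw [← flagLevel_swap x z, ← flagLevel_swap x y.swap]
      exact this
  descent := by
    intro y hy
    obtain ⟨⟨p, l⟩, hpl⟩ := x
    obtain ⟨⟨q, m⟩, hqm⟩ := y
    by_cases hqp : q = p
    · subst hqp
      refine ⟨⟨(q, l), hpl⟩, flagGeometry_adj.2 ⟨hy, Or.inl rfl⟩, ?_⟩
      have hml : m ≠ l := by rintro rfl; exact hy rfl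
      simp [flagLevel, hml]
    by_cases hml : m = l
    · subst hml
      refine ⟨⟨(p, m), hpl⟩, flagGeometry_adj.2 ⟨hy, Or.inr rfl⟩, ?_⟩
      simp [flagLevel, hqp]
    by_cases hpm : p.orthogonal m
    · refine ⟨⟨(p, m), hpm⟩, flagGeometry_adj.2 ⟨?_, Or.inr rfl⟩, ?_⟩
      · intro h
        exact hqp (congrArg (fun x : Flag K => x.1.1) h)
      · simp [flagLevel, hqp, hml, hpm]
    by_cases hql : q.orthogonal l
    · refine ⟨⟨(q, l), hql⟩, flagGeometry_adj.2 ⟨?_, Or.inl rfl⟩, ?_⟩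
      · intro h
        exact hml (congrArg (fun x : Flag K => x.1.2) h)
      · simp [flagLevel, hqp, hml, hql]
    · obtain ⟨n, hpn, hqn⟩ := exists_join p q
      have hnl : n ≠ l := by rintro rfl; exact hql hqn
      refine ⟨⟨(q, n), hqn⟩, flagGeometry_adj.2 ⟨?_, Or.inl rfl⟩, ?_⟩
      · intro h
        have : m = n := congrArg (fun x : Flag K => x.1.2) h
        subst this
        exact hpm hpn
      · simp [flagLevel, hqp, hml, hql, hpm, hnl, hpn]

theorem flagLevel_le (x y : Flag K) : flagLevel x y ≤ 3 := by
  unfold flagLevel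
  split_ifs <;> norm_num

/-- A common neighbour of `(p, l)` and `(q, m)` must be `(p, m)` or `(q, l)`. Level 2 says that one
of these is a flag, and they cannot both be: otherwise `p` and `q` would both lie on `l` and `m`. -/
theorem existsUnique_adj_of_flagLevel [DecidableEq K] {x y : Flag K} (h : flagLevel x y = 2) :
    ∃! z, (flagGeometry K).collinearityGraph.Adj x z ∧
      (flagGeometry K).collinearityGraph.Adj z y := by
  obtain ⟨⟨p, l⟩, hpl⟩ := x
  obtain ⟨⟨q, m⟩, hqm⟩ := y
  change p.orthogonal l at hpl
  change q.orthogonal m at hqm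
  have hqp : ¬ q = p := by
    intro hqp
    by_cases hml : m = l <;> simp [flagLevel, hqp, hml] at h
  have hml : ¬ m = l := by
    intro hml
    simp [flagLevel, hqp, hml] at h
  have hinc : p.orthogonal m ∨ q.orthogonal l := by
    by_contra hinc
    simp [flagLevel, hqp, hml, hinc] at h
  -- a common neighbour is one of the two mixed flags
  have key : ∀ z : Flag K, ((p = z.1.1 ∨ l = z.1.2) ∧ (z.1.1 = q ∨ z.1.2 = m)) →
      (z.1.1 = p ∧ z.1.2 = m) ∨ (z.1.1 = q ∧ z.1.2 = l) := by
    rintro z ⟨h1 | h1, h2 | h2⟩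
    · exact absurd (h1.trans h2).symm hqp
    · exact Or.inl ⟨h1.symm, h2⟩
    · exact Or.inr ⟨h2, h1.symm⟩
    · exact absurd (h1.trans h2).symm hml
  have hboth : ¬ (p.orthogonal m ∧ q.orthogonal l) := by
    rintro ⟨h1, h2⟩
    rcases Configuration.ofField.eq_or_eq_of_orthogonal hpl h2 h1 hqm with h3 | h3
    · exact hqp h3.symm
    · exact hml h3.symm
  simp only [flagGeometry_adj]
  rcases hinc with hinc | hinc
  · refine ⟨⟨(p, m), hinc⟩, ⟨⟨?_, Or.inl rfl⟩, ?_, Or.inr rfl⟩, ?_⟩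
    · exact fun h => hml (congrArg (fun x : Flag K => x.1.2) h).symm
    · exact fun h => hqp (congrArg (fun x : Flag K => x.1.1) h).symm
    · rintro z ⟨⟨-, h1⟩, -, h2⟩
      rcases key z ⟨h1, h2⟩ with h3 | h3
      · exact flag_ext h3.1 h3.2
      · have := z.2
        rw [h3.1, h3.2] at this
        exact absurd ⟨hinc, this⟩ hboth
  · refine ⟨⟨(q, l), hinc⟩, ⟨⟨?_, Or.inr rfl⟩, ?_, Or.inl rfl⟩, ?_⟩
    · exact fun h => hqp (congrArg (fun x : Flag K => x.1.1) h).symm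
    · exact fun h => hml (congrArg (fun x : Flag K => x.1.2) h).symm
    · rintro z ⟨⟨-, h1⟩, -, h2⟩
      rcases key z ⟨h1, h2⟩ with h3 | h3
      · have := z.2
        rw [h3.1, h3.2] at this
        exact absurd ⟨this, hinc⟩ hboth
      · exact flag_ext h3.1 h3.2

theorem isPartialLinearSpace_flagGeometry [DecidableEq K] :
    (flagGeometry K).IsPartialLinearSpace := by
  constructor
  · have key : ∀ q : PG2 K, ∃ x y : Flag K, x ≠ y ∧ x.1.1 = q ∧ y.1.1 = q := by
      intro q
      obtain ⟨l, hl⟩ := exists_point_on q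
      obtain ⟨m, hml, hm⟩ := exists_two_points_of_mem hl
      exact ⟨⟨(q, l), orthogonal_comm.1 hl⟩, ⟨(q, m), orthogonal_comm.1 hm⟩,
        fun h => hml (congrArg (fun x : Flag K => x.1.2) h).symm, rfl, rfl⟩
    rintro (q | m)
    · obtain ⟨x, y, hxy, hx, hy⟩ := key q
      exact ⟨x, y, hxy, inc_inl.2 hx, inc_inl.2 hy⟩
    · obtain ⟨x, y, hxy, hx, hy⟩ := key m
      exact ⟨x.swap, y.swap, fun h => hxy (congrArg Flag.swap h), inc_inr.2 hx, inc_inr.2 hy⟩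
  · rintro x y hxy (l | l) (m | m) h1 h2 h3 h4 <;> simp only [inc_inl, inc_inr] at h1 h2 h3 h4
    · rw [← h1, h3]
    · exact absurd (flag_ext (h1.trans h2.symm) (h3.trans h4.symm)) hxy
    · exact absurd (flag_ext (h3.trans h4.symm) (h1.trans h2.symm)) hxy
    · rw [← h1, h3]

theorem isHexagon_flagGeometry [DecidableEq K] : (flagGeometry K).IsHexagon where
  partialLinear := isPartialLinearSpace_flagGeometry
  two_lines x := ⟨Sum.inl x.1.1, Sum.inr x.1.2, by simp, Or.inl rfl, Or.inr rfl⟩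
  level x := ⟨_, isLevel_flagLevel x, flagLevel_le x, fun _ => existsUnique_adj_of_flagLevel⟩
  exists_level := by
    have h1 : (![1, 0, 0] : Fin 3 → K) ≠ 0 := fun h => by simpa using congrFun h 0
    have h2 : (![0, 0, 1] : Fin 3 → K) ≠ 0 := fun h => by simpa using congrFun h 2
    have h3 : (Projectivization.mk K _ h1).orthogonal (Projectivization.mk K _ h2) := by
      rw [orthogonal_mk]; simp
    have h4 : ∀ {v : Fin 3 → K} (hv : v ≠ 0), v ⬝ᵥ v ≠ 0 →
        ¬ (Projectivization.mk K v hv).orthogonal (Projectivization.mk K v hv) := by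
      intro v hv h; rwa [orthogonal_mk]
    have h5 := h4 h1 (by simp)
    have h6 := h4 h2 (by simp)
    have h7 : Projectivization.mk K _ h1 ≠ Projectivization.mk K _ h2 := by
      intro h
      rw [← h] at h3
      exact h5 h3
    generalize Projectivization.mk K _ h1 = p at h3 h5 h7
    generalize Projectivization.mk K _ h2 = l at h3 h6 h7
    -- Exchanging the coordinates of point and line gives an opposite flag, because neither vector
    -- is orthogonal to itself.
    refine ⟨⟨(p, l), h3⟩, _, ⟨(l, p), orthogonal_comm.1 h3⟩, isLevel_flagLevel _, ?_⟩
    simp [flagLevel, h7, h7.symm, h5, h6]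

end

theorem order_PG2_F4 [DecidableEq F4] :
    Configuration.ProjectivePlane.order (PG2 F4) (PG2 F4) = 4 := by
  have : Fintype (PG2 F4) := Fintype.ofFinite _
  have h1 := Configuration.ProjectivePlane.card_points (PG2 F4) (PG2 F4)
  have h2 : Nat.card (PG2 F4) = 21 := by
    rw [Projectivization.card_of_finrank F4 (Fin 3 → F4) (n := 3) (by simp),
      GaloisField.card 2 2 two_ne_zero]
    decide
  rw [← Nat.card_eq_fintype_card, h2] at h1
  -- The order `n` satisfies `n² + n + 1 = 21`.
  nlinarith

theorem hasOrder_H41 : H41.HasOrder 4 1 := by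
  classical
  have key : ∀ p : PG2 F4, {x : Flag F4 | x.1.1 = p}.encard = 5 := by
    intro p
    have h1 := Configuration.ProjectivePlane.lineCount_eq (PG2 F4) p
    rw [order_PG2_F4, Configuration.lineCount] at h1
    have h2 : {x : Flag F4 | x.1.1 = p} =
        Set.range fun l : {l : PG2 F4 // p ∈ l} => (⟨(p, l.1), l.2⟩ : Flag F4) := by
      ext ⟨⟨q, l⟩, h⟩
      constructor
      · intro hq
        change q = p at hq
        subst hq
        exact ⟨⟨l, h⟩, rfl⟩
      · rintro ⟨m, hm⟩
        exact (congrArg (fun x : Flag F4 => x.1.1) hm).symm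
    rw [h2, ← Set.image_univ, Function.Injective.encard_image, Set.encard_univ,
      ENat.card_eq_coe_natCard, h1]
    · norm_num
    · intro l m h
      exact Subtype.ext (congrArg (fun x : Flag F4 => x.1.2) h)
  constructor
  · rintro (p | l)
    · simp only [inc_inl, key]
      norm_num
    · simp only [inc_inr]
      have h1 : {x : Flag F4 | x.1.2 = l} = Flag.swap '' {x : Flag F4 | x.1.1 = l} := by
        ext x
        constructor
        · intro hx
          exact ⟨x.swap, hx, rfl⟩
        · rintro ⟨y, hy, rfl⟩
          exact hy
      rw [h1, Function.Injective.encard_image (f := Flag.swap (K := F4))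
        fun _ _ h => congrArg Flag.swap h, key]
      norm_num
  · intro x
    have h1 : {l | H41.Inc x l} = {Sum.inl x.1.1, Sum.inr x.1.2} := rfl
    rw [h1, Set.encard_pair (by simp)]
    norm_num

end PlaneGroup

/-! ### The geometry of spread lines and quads is H(4,1) -/

namespace Coordinates

open ElationLabel PointLineGeometry

variable {P L : Type*} {S : PointLineGeometry P L} {T : Set L} {C : P → P → Prop}
  {lab : P → ElationLabel}

/-- A spread line goes to the common flag of its points, and a quad goes to the centre or axis
shared by its points. The first map is bijective because points with equal flags lie on one spread
line and every flag occurs; the second by `quad_eq`, and because no centre class is an axis class.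
-/
theorem isomorphic (h : Coordinates S T C lab)
    (hbase : ∀ x, ∃ lab, Coordinates S T C lab ∧ lab x = base) :
    (S.lineQuadGeometry T).Isomorphic H41 := by
  classical
  have hm := h.isFlagMarking hbase
  have hS := h.isNearPolygon hbase
  have h1 : ∀ l : {l // l ∈ T}, ∃ x, S.Inc x l.1 := fun l =>
    (hS.1.1 l.1).imp fun x hx => by obtain ⟨_, -, hx, -⟩ := hx; exact hx
  choose pt hpt using h1
  let f : {l // l ∈ T} → PlaneGroup.Flag F4 := fun l =>
    ⟨(h.centre (pt l), h.axis (pt l)), h.orthogonal _⟩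
  have hf : Function.Bijective f := by
    constructor
    · intro l m hlm
      have h2 : h.centre (pt l) = h.centre (pt m) :=
        congrArg (fun x : PlaneGroup.Flag F4 => x.1.1) hlm
      have h3 : h.axis (pt l) = h.axis (pt m) :=
        congrArg (fun x : PlaneGroup.Flag F4 => x.1.2) hlm
      apply Subtype.ext
      by_cases h4 : pt l = pt m
      · exact (hm.isLineSpread hS (pt l)).unique ⟨l.2, hpt l⟩ ⟨m.2, by rw [h4]; exact hpt m⟩
      · obtain ⟨-, k, hk, hk'⟩ := hm.adj _ _ h4 h2 h3
        have hkT := (hm.spread k _ _ hk hk' h4).2 ⟨h2, h3⟩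
        rw [(hm.isLineSpread hS (pt l)).unique ⟨l.2, hpt l⟩ ⟨hkT, hk⟩,
          (hm.isLineSpread hS (pt m)).unique ⟨m.2, hpt m⟩ ⟨hkT, hk'⟩]
    · rintro ⟨⟨p, l⟩, hpl⟩
      obtain ⟨x, rfl, rfl⟩ := h.exists_flag hpl
      obtain ⟨l, hl, hx⟩ := hm.exists_mem_spread x
      refine ⟨⟨l, hl⟩, ?_⟩
      have h2 := hm.flag_eq_of_mem hl (hpt ⟨l, hl⟩) hx
      exact PlaneGroup.flag_ext h2.1 h2.2
  have hc : ∀ p, ∃ x, h.centre x = p := fun p => by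
    obtain ⟨l, hl⟩ := PlaneGroup.exists_point_on p
    exact (h.exists_flag (Projectivization.orthogonal_comm.1 hl)).imp fun _ h => h.1
  have ha : ∀ l, ∃ x, h.axis x = l := fun l => by
    obtain ⟨p, hp⟩ := PlaneGroup.exists_point_on l
    exact (h.exists_flag hp).imp fun _ h => h.2
  have hqc : ∀ p, S.IsQuad {x | h.centre x = p} := fun p => by
    obtain ⟨x, rfl⟩ := hc p
    exact hm.isQuad hS x
  have hqa : ∀ l, S.IsQuad {x | h.axis x = l} := fun l => by
    obtain ⟨x, rfl⟩ := ha l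
    exact hm.swap.isQuad hS x
  let q : PlaneGroup.PG2Elements F4 → {Q // S.IsQuad Q} :=
    Sum.elim (fun p => ⟨_, hqc p⟩) fun l => ⟨_, hqa l⟩
  have hne : ∀ p l, {x | h.centre x = p} ≠ {x | h.axis x = l} := by
    intro p l hpl
    obtain ⟨x, rfl⟩ := hc p
    obtain ⟨y, -, h2, h3⟩ := hm.exists_adj x
    have hx : x ∈ {y | h.axis y = l} := by rw [← hpl]; rfl
    have hy : y ∈ {y | h.axis y = l} := by rw [← hpl]; exact h2
    exact h3 (hy.trans hx.symm)
  have hq : Function.Bijective q := by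
    constructor
    · rintro (p | p) (r | r) hpr <;> replace hpr := congrArg Subtype.val hpr
      · obtain ⟨x, rfl⟩ := hc p
        have hx : x ∈ {y | h.centre y = r} := (Set.ext_iff.1 hpr x).1 rfl
        exact congrArg _ hx
      · exact absurd hpr (hne p r)
      · exact absurd hpr.symm (hne r p)
      · obtain ⟨x, rfl⟩ := ha p
        have hx : x ∈ {y | h.axis y = r} := (Set.ext_iff.1 hpr x).1 rfl
        exact congrArg _ hx
    · rintro ⟨Q, hQ⟩
      obtain ⟨x, rfl | rfl⟩ := hm.quad_eq hS hQ
      · exact ⟨Sum.inl (h.centre x), rfl⟩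
      · exact ⟨Sum.inr (h.axis x), rfl⟩
  refine ⟨Equiv.ofBijective f hf, (Equiv.ofBijective q hq).symm, fun l Q => ?_⟩
  obtain ⟨e, rfl⟩ := hq.2 Q
  -- A spread line lies in a quad as soon as one of its points does, so incidence can be tested at
  -- the chosen point.
  have h2 : (S.lineQuadGeometry T).Inc l (q e) ↔ pt l ∈ (q e).1 :=
    ⟨fun h2 => h2 _ (hpt l), fun h2 => hm.lineIn_quad_of_mem hS (q e).2 h2 l.2 (hpt l)⟩
  rw [h2, Equiv.ofBijective_symm_apply_apply]
  rcases e with p | l'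
  · exact (PlaneGroup.inc_inl (x := f l) (p := p)).symm
  · exact (PlaneGroup.inc_inr (x := f l) (l := l')).symm

end Coordinates

/-! ### Assembling the theorem -/

open PlaneGroup in
theorem card_isCentralInvolution {G : Type*} [Group G] (e : G ≃* L34Ext) :
    Nat.card {x : G // IsCentralInvolution x} = 315 := by
  have : Finite G := Finite.of_equiv _ e.symm.toEquiv
  rw [← ElationLabel.ncard_isElation, ← Nat.card_coe_set_eq]
  refine Nat.card_congr (e.toEquiv.subtypeEquiv fun x => ?_)
  rw [← isCentralInvolution_map_iff e, isCentralInvolution_iff]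
  rfl

open PlaneGroup in
theorem isNontrivialElation_iff {G : Type*} [Group G] (e : G ≃* L34Ext)
    (g : Equiv.Perm (PG2Elements F4)) : IsNontrivialElation g ↔
      ∃ x : G, IsCentralInvolution x ∧ (e x : Equiv.Perm (PG2Elements F4)) = g := by
  classical
  have : Finite G := Finite.of_equiv _ e.symm.toEquiv
  constructor
  · intro hg
    obtain ⟨x, hx, rfl⟩ := exists_isElation_of_isNontrivialElation hg
    obtain ⟨x, rfl⟩ := e.surjective x
    exact ⟨x, (isCentralInvolution_map_iff e).1 (isCentralInvolution_iff.2 hx), rfl⟩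
  · rintro ⟨x, hx, rfl⟩
    exact isNontrivialElation_of_isElation (isCentralInvolution_iff.1 (hx.map e))

theorem theorem1p2 (G : Type*) [Group G] (e : G ≃* L34Ext) :
    -- the points: 315 central involutions, which are the nontrivial elations of `PG(2, 4)`
    (Nat.card {x : G // IsCentralInvolution x} = 315 ∧
      ∀ g : Equiv.Perm (PlaneGroup.PG2Elements F4),
        PlaneGroup.IsNontrivialElation g ↔
          ∃ x : G, IsCentralInvolution x ∧ (e x : Equiv.Perm (PlaneGroup.PG2Elements F4)) = g) ∧
    -- part (a)
    ((involutionGeometry G).IsNearPolygon 4 ∧ (involutionGeometry G).HasOrder 2 4) ∧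
    -- part (b): the spread, the spreads of the quads, the generalized hexagon
    (involutionGeometry G).IsLineSpread (involutionSpread G) ∧
    (∀ Q, (involutionGeometry G).IsQuad Q →
      ((involutionGeometry G).induced Q).IsLineSpread {l | l.1 ∈ involutionSpread G}) ∧
    (((involutionGeometry G).lineQuadGeometry (involutionSpread G)).IsGeneralizedHexagon ∧
      ((involutionGeometry G).lineQuadGeometry (involutionSpread G)).HasOrder 4 1 ∧
      ((involutionGeometry G).lineQuadGeometry (involutionSpread G)).Isomorphic H41) := by
  classical
  have h := PlaneGroup.coordinates_involutionGeometry e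
  have hbase := PlaneGroup.exists_coordinates_base e
  have hS := h.isNearPolygon hbase
  have hm := h.isFlagMarking hbase
  have hiso := h.isomorphic hbase
  exact ⟨⟨card_isCentralInvolution e, isNontrivialElation_iff e⟩, ⟨hS, h.hasOrder hbase⟩,
    hm.isLineSpread hS, fun Q hQ => hm.isLineSpread_induced hS hQ,
    (PlaneGroup.isHexagon_flagGeometry.of_isomorphic hiso).isGeneralizedHexagon,
    PlaneGroup.hasOrder_H41.of_isomorphic hiso, hiso⟩
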